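/- Let $S^2\subset\mathbb{R}^3$ be the round unit sphere, $p:S^2\to S^2$, $p(x)=-x$, the antipodal map, $\pi:S^2\to\mathbb{RP}^2=S^2/\{1,p\}$ the covering projection, and give $\mathbb{RP}^2$ the metric for which $\pi$ is a local isometry. For $n\ge 1$ let $\mathrm{M}_n$ be the space of harmonic maps $S^2\to S^2$ of degree $n$. Let $\widetilde{\mathrm M}_n$ be the space of harmonic maps $\varphi:\mathbb{RP}^2\to\mathbb{RP}^2$ of absolute degree $n$, that is, those which lift to a map $\widetilde\varphi:S^2\to S^2$ with $\pi\circ\widetilde\varphi=\varphi\circ\pi$, $\widetilde\varphi\circ p=p\circ\widetilde\varphi$ and $|\deg\widetilde\varphi|=n$. In stereographic coordinates, the elements of $\mathrm{M}_n$ are exactly the rational maps $$W(z)=\frac{a_1+a_2z+\cdots+a_{n+1}z^n}{a_{n+2}+a_{n+3}z+\cdots+a_{2n+2}z^n},$$ where $a_{n+1},a_{2n+2}$ do not both vanish and numerator and denominator have no common root; two coefficient vectors define the same map if and only if they are proportional, so that $\mathrm{M}_n$ is an open subset of $\mathbb{CP}^{2n+1}$, with the induced complex structure $J$. Let $\gamma(X,Y)=\int_{S^2}\langle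 X,Y\rangle\,d\mu$ be the $L^2$ metric on $\mathrm{M}_n$ (tangent vectors at $\phi\in\mathrm{M}_n$ being regarded as vector fields along $\phi$) and $\Omega(X,Y)=\gamma(JX,Y)$; $(\mathrm{M}_n,\gamma,\Omega)$ is a Kähler manifold. **Theorem.** Let $n\ge 1$ be odd. Then: 1. The map $\mathsf{P}:\phi\mapsto p\circ\phi\circ p$ is an antiholomorphic isometry of $(\mathrm{M}_n,\gamma)$ onto itself. 2. Every $\varphi\in\widetilde{\mathrm M}_n$ has exactly one lift $\phi\in\mathrm{M}_n$ (a map with $\pi\circ\phi=\varphi\circ\pi$), and distinct $\varphi$ have distinct lifts; the image of the resulting injection $\widetilde{\mathrm M}_n\hookrightarrow\mathrm{M}_n$ is the fixed-point set $\{\phi\in\mathrm{M}_n:\mathsf{P}(\phi)=\phi\}$. 3. Identified with this (nonempty) subset of $\mathrm{M}_n$, $\widetilde{\mathrm M}_n$ is a smooth embedded submanifold of real dimension $2n+1$, it is totally geodesic with respect to $\gamma$, and it is Lagrangian with respect to $\Omega$ (that is, $\Omega$ vanishes on its tangent spaces and its dimension is half the real dimension of $\mathrm{M}_n$). The statements about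 $\mathrm{M}_n$ made above (description by rational maps, openness in $\mathbb{CP}^{2n+1}$, smoothness of $\gamma$ and the Kähler property) are part of the assertion. -/

import Mathlib

open Set Filter Topology MeasureTheory
open scoped ContDiff LinearAlgebra.Projectivization

noncomputable section

namespace HarmonicL2

/-! ### The sphere, the projective plane, harmonic maps and degree -/

/-- Euclidean three-space. -/
abbrev E3 : Type := EuclideanSpace ℝ (Fin 3)

/-- The round unit two-sphere in Euclidean three-space. The antipodal map is `x ↦ -x`. -/
abbrev S2 : Type := Metric.sphere (0 : E3) 1

/-- The real projective plane: the lines of `ℝ³`, i.e. the unit sphere modulo the antipodal map. -/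
abbrev RP2 : Type := ℙ ℝ E3

lemma S2.ne_zero (x : S2) : (x : E3) ≠ 0 :=
  ne_zero_of_mem_unit_sphere x

/-- The covering projection `S² → RP²`; the metric of `RP²` is the one for which it is a local
isometry. -/
def proj (x : S2) : RP2 := Projectivization.mk ℝ (x : E3) (S2.ne_zero x)

lemma normalize_mem {y : E3} (hy : y ≠ 0) : ‖y‖⁻¹ • y ∈ Metric.sphere (0 : E3) 1 := by
  have h : ‖y‖ ≠ 0 := norm_ne_zero_iff.mpr hy
  simp [norm_smul, h]

open Classical in
/-- The radially constant extension `y ↦ f (y / ‖y‖)` of a map `f : S² → S²` to `ℝ³ \ {0}`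
(with value `0` at the origin, which is never used). -/
def ext (f : S2 → S2) (y : E3) : E3 :=
  if hy : y ≠ 0 then ((f ⟨‖y‖⁻¹ • y, normalize_mem hy⟩ : S2) : E3) else 0

/-- `f` is smooth near the point `x` of the sphere. -/
def SmoothAt (f : S2 → S2) (x : S2) : Prop := ContDiffAt ℝ ∞ (ext f) (x : E3)

/-- The squared length `|df|²` of the differential of `f : S² → S²` at `x`
(the radial derivative of the extension vanishes). -/
def normSqDeriv (f : S2 → S2) (x : S2) : ℝ :=
  ∑ i : Fin 3, ‖fderiv ℝ (ext f) (x : E3) (EuclideanSpace.single i 1)‖ ^ 2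

/-- `f` is smooth near `x` and satisfies at `x` the harmonic map equation `Δf + |df|² f = 0`
for maps into the unit sphere. At points of the unit sphere the Laplacian of the
radially constant extension is the Laplace-Beltrami operator of the sphere applied to `f`. -/
def HarmonicAt (f : S2 → S2) (x : S2) : Prop :=
  SmoothAt f x ∧
    Laplacian.laplacian (ext f) (x : E3) + normSqDeriv f x • ((f x : S2) : E3) = 0

/-- Harmonic maps `S² → S²`. -/
def IsHarmonic (f : S2 → S2) : Prop := ∀ x, HarmonicAt f x

/-- The Jacobian determinant of `f : S² → S²` at `x`, for the orientations of the two tangent planes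
by the outward normal: the determinant of the endomorphism of `ℝ³` which is `df` on the
tangent plane at `x` and maps the normal `x` to the normal `f x`. -/
def jac (f : S2 → S2) (x : S2) : ℝ :=
  LinearMap.det
    (((fderiv ℝ (ext f) (x : E3)) +
      (innerSL ℝ (x : E3)).smulRight ((f x : S2) : E3) : E3 →L[ℝ] E3) : E3 →ₗ[ℝ] E3)

/-- The smooth map `f : S² → S²` has topological degree `d`: over every regular
value, the number of preimages counted with the sign of the Jacobian is `d`. -/
def HasDegree (f : S2 → S2) (d : ℤ) : Prop :=
  (∀ x, SmoothAt f x) ∧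
    ∀ y : S2, (∀ x, f x = y → jac f x ≠ 0) →
      ∑ᶠ x ∈ {x : S2 | f x = y}, ((SignType.sign (jac f x) : SignType) : ℤ) = d

/-- `f : S² → S²` covers `φ : RP² → RP²`. -/
def Covers (f : S2 → S2) (φ : RP2 → RP2) : Prop := ∀ x, proj (f x) = φ (proj x)

/-- Harmonic maps `RP² → RP²`. As the projection `S² → RP²` is a local isometry, this says
that near every point `φ` is represented, through local inverses of the projection, by
a harmonic map between open subsets of the sphere. -/
def IsHarmonicRP (φ : RP2 → RP2) : Prop :=
  ∀ x : S2, ∃ f : S2 → S2, ∀ᶠ y in 𝓝 x, proj (f y) = φ (proj y) ∧ HarmonicAt f y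

/-- `φ : RP² → RP²` has absolute degree `d`: it lifts to a map of the sphere
which commutes with the antipodal map (i.e. `φ` acts as the identity on the fundamental group
`ℤ/2`) and which has degree `d` or `-d`. -/
def HasAbsDegree (φ : RP2 → RP2) (d : ℕ) : Prop :=
  ∃ f : S2 → S2, Continuous f ∧ Covers f φ ∧ (∀ x, f (-x) = -f x) ∧
    (HasDegree f d ∨ HasDegree f (-d))

/-- The space `M_n` of degree `n` harmonic maps `S² → S²`. -/
def M (n : ℕ) : Set (S2 → S2) := {f | IsHarmonic f ∧ HasDegree f n}

/-- The space of harmonic maps `RP² → RP²` of absolute degree `n`. -/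
def MTilde (n : ℕ) : Set (RP2 → RP2) := {φ | IsHarmonicRP φ ∧ HasAbsDegree φ n}

/-- The subset of `M_n` consisting of the degree `n` lifts of the harmonic maps `RP² → RP²` of
absolute degree `n`. -/
def MTildeLift (n : ℕ) : Set (S2 → S2) := {f | f ∈ M n ∧ ∃ φ ∈ MTilde n, Covers f φ}

/-- Conjugation `f ↦ p ∘ f ∘ p` by the antipodal map `p`. -/
def conjAntipodal (f : S2 → S2) : S2 → S2 := fun x => -f (-x)

/-! ### Rational maps and the coordinates of the space of degree `n` maps -/

/-- Coefficient vectors `(a₁, …, a₂ₙ₊₂)` (indexed from `0` here). -/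
abbrev Coeff (n : ℕ) : Type := Fin (2 * n + 1 + 1) → ℂ

/-- The numerator, homogenized: `∑ aᵢ₊₁ zⁱ wⁿ⁻ⁱ`. -/
def num {n : ℕ} (a : Coeff n) (z w : ℂ) : ℂ :=
  ∑ i : Fin (n + 1), a ⟨i, by omega⟩ * z ^ (i : ℕ) * w ^ (n - i : ℕ)

/-- The denominator, homogenized: `∑ aₙ₊₂₊ᵢ zⁱ wⁿ⁻ⁱ`. -/
def den {n : ℕ} (a : Coeff n) (z w : ℂ) : ℂ :=
  ∑ i : Fin (n + 1), a ⟨n + 1 + i, by omega⟩ * z ^ (i : ℕ) * w ^ (n - i : ℕ)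

/-- `a` is the coefficient vector of a rational map of degree exactly `n`: the two leading
coefficients do not both vanish, and numerator and denominator have no common root. -/
def IsRat {n : ℕ} (a : Coeff n) : Prop :=
  (a ⟨n, by omega⟩ ≠ 0 ∨ a ⟨2 * n + 1, by omega⟩ ≠ 0) ∧
    ∀ z : ℂ, ¬ (num a z 1 = 0 ∧ den a z 1 = 0)

/-- A homogeneous pair `(z, w)` whose quotient is the stereographic coordinate
`(x₁ + i x₂) / (1 - x₃)` of the point `x` (the point `∞` being the north pole). -/
def homog (x : S2) : ℂ × ℂ :=
  if (x : E3) 2 = 1 then (1, 0) else (⟨(x : E3) 0, (x : E3) 1⟩, ((1 - (x : E3) 2 : ℝ) : ℂ))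

/-- The point `(2 p q̄, |p|² - |q|²) / (|p|² + |q|²)` of `ℂ × ℝ = ℝ³`. -/
def invStereoVec (p q : ℂ) : E3 :=
  (Complex.normSq p + Complex.normSq q)⁻¹ •
    !₂[2 * (p * (starRingEnd ℂ) q).re, 2 * (p * (starRingEnd ℂ) q).im,
      Complex.normSq p - Complex.normSq q]

lemma invStereoVec_mem {p q : ℂ} (h : ¬ (p = 0 ∧ q = 0)) :
    invStereoVec p q ∈ Metric.sphere (0 : E3) 1 := by
  have hpos : 0 < Complex.normSq p + Complex.normSq q := by
    rcases not_and_or.mp h with h | h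
    · have := Complex.normSq_pos.mpr h
      have := Complex.normSq_nonneg q
      linarith
    · have := Complex.normSq_pos.mpr h
      have := Complex.normSq_nonneg p
      linarith
  have hsq : ‖invStereoVec p q‖ ^ 2 = 1 := by
    rw [EuclideanSpace.norm_sq_eq]
    simp only [invStereoVec, Fin.sum_univ_three, PiLp.smul_apply, smul_eq_mul, Real.norm_eq_abs,
      sq_abs]
    simp only [Matrix.cons_val_zero, Matrix.cons_val_one, Matrix.cons_val_two, Matrix.head_cons,
      Matrix.tail_cons]
    field_simp
    simp only [Complex.normSq_apply, Complex.mul_re, Complex.mul_im, Complex.conj_re,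
      Complex.conj_im]
    ring
  have h1 : ‖invStereoVec p q‖ = 1 := by
    have := norm_nonneg (invStereoVec p q)
    nlinarith
  simpa using h1

open Classical in
/-- The point of the sphere with stereographic coordinate `p / q`
(an arbitrary point in the meaningless case `p = q = 0`). -/
def invStereo (p q : ℂ) : S2 :=
  if h : p = 0 ∧ q = 0 then ⟨invStereoVec 1 0, invStereoVec_mem (by simp)⟩
  else ⟨invStereoVec p q, invStereoVec_mem h⟩

/-- The map `S² → S²` which in the stereographic coordinate is the quotient
`W(z) = (a₁ + a₂ z + ⋯ + aₙ₊₁ zⁿ) / (aₙ₊₂ + aₙ₊₃ z + ⋯ + a₂ₙ₊₂ zⁿ)`. -/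
def ratMap {n : ℕ} (a : Coeff n) (x : S2) : S2 :=
  invStereo (num a (homog x).1 (homog x).2) (den a (homog x).1 (homog x).2)

/-- The degree `n` harmonic maps are exactly the degree `n` rational maps, and coefficient vectors
of the same map are proportional: `M_n` is an open subset of the complex
projective space of dimension `2n+1`. -/
def IsOpenInProjectiveSpace (n : ℕ) : Prop :=
  IsOpen {a : Coeff n | IsRat a} ∧ M n = ratMap '' {a : Coeff n | IsRat a} ∧
    ∀ a a' : Coeff n, IsRat a → IsRat a' →
      (ratMap a = ratMap a' ↔ ∃ ξ : ℂ, ξ ≠ 0 ∧ a' = ξ • a)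

/-- The space `ℂ²ⁿ⁺¹` in which the local coordinates of `M_n` take their values. -/
abbrev Model (n : ℕ) : Type := Fin (2 * n + 1) → ℂ

/-- The coefficient vector with entry `1` in position `k` and the remaining entries `b`: the
affine (inhomogeneous) coordinates `b` of projective space. -/
def affine {n : ℕ} (k : Fin (2 * n + 1 + 1)) (b : Model n) : Coeff n :=
  Fin.insertNth (α := fun _ => ℂ) k 1 b

/-- The open set of `ℂ²ⁿ⁺¹` onto which the `k`-th chart of `M_n` maps. -/
def dom (n : ℕ) (k : Fin (2 * n + 1 + 1)) : Set (Model n) := {b | IsRat (affine k b)}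

/-- The inverse of the `k`-th chart of `M_n`, for the complex structure induced from
projective space. -/
def param {n : ℕ} (k : Fin (2 * n + 1 + 1)) (b : Model n) : S2 → S2 := ratMap (affine k b)

/-- The part of `N ⊆ M_n` that lies in the `k`-th chart. -/
def inChart {n : ℕ} (k : Fin (2 * n + 1 + 1)) (N : Set (S2 → S2)) : Set (Model n) :=
  {b | b ∈ dom n k ∧ param k b ∈ N}

/-! ### The `L²` metric and the Kähler form -/

/-- The tangent vector to `M_n` with components `u` at the point with coordinates `b`, as a vector
field along the corresponding map `φ : S² → S²`: its value at `x` is the derivative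
of `φ x` in the direction `u`. -/
def variation {n : ℕ} (k : Fin (2 * n + 1 + 1)) (b u : Model n) (x : S2) : E3 :=
  fderiv ℝ (fun b' : Model n => ((param k b' x : S2) : E3)) b u

/-- The `L²` metric `γ(X, Y) = ∫ h(X, Y) dμ` over the round sphere, in the `k`-th chart. -/
def gam {n : ℕ} (k : Fin (2 * n + 1 + 1)) (b u v : Model n) : ℝ :=
  ∫ x : S2, inner ℝ (variation k b u x) (variation k b v x) ∂((volume : Measure E3).toSphere)

/-- The form `Ω(X, Y) = γ(JX, Y)`, in the `k`-th chart. -/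
def kahlerForm {n : ℕ} (k : Fin (2 * n + 1 + 1)) (b u v : Model n) : ℝ :=
  gam k b (Complex.I • u) v

/-- `(M_n, γ, Ω)` is Kähler: the integrals defining `γ` converge, `γ` is a smooth, positive definite
Hermitian metric, and the 2-form `Ω` is closed (the exterior derivative is
evaluated on constant vector fields). -/
def IsKahler (n : ℕ) : Prop :=
  ∀ k : Fin (2 * n + 1 + 1),
    (∀ b ∈ dom n k, ∀ u v : Model n, Integrable
      (fun x : S2 => inner ℝ (variation k b u x) (variation k b v x))
      ((volume : Measure E3).toSphere)) ∧
    (∀ u v : Model n, ContDiffOn ℝ ∞ (fun b => gam k b u v) (dom n k)) ∧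
    (∀ b ∈ dom n k, ∀ u : Model n, u ≠ 0 → 0 < gam k b u u) ∧
    (∀ b ∈ dom n k, ∀ u v : Model n,
      gam k b (Complex.I • u) (Complex.I • v) = gam k b u v) ∧
    (∀ b ∈ dom n k, ∀ u v w : Model n,
      fderiv ℝ (fun y => kahlerForm k y v w) b u + fderiv ℝ (fun y => kahlerForm k y w u) b v +
        fderiv ℝ (fun y => kahlerForm k y u v) b w = 0)

/-- `Φ` restricts to a bijection of `M_n` which is antiholomorphic (in local coordinates, the complex
conjugate of its coordinate expression `F` is holomorphic) and isometric for `γ`. -/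
def IsAntiholomorphicIsometry (n : ℕ) (Φ : (S2 → S2) → (S2 → S2)) : Prop :=
  BijOn Φ (M n) (M n) ∧
    ∀ (k j : Fin (2 * n + 1 + 1)), ∀ b ∈ dom n k, ∀ b' ∈ dom n j, param j b' = Φ (param k b) →
      ∃ F : Model n → Model n, F b = b' ∧ ∀ᶠ y in 𝓝 b,
        F y ∈ dom n j ∧ param j (F y) = Φ (param k y) ∧
        DifferentiableAt ℂ (fun y' => star (F y')) y ∧
        ∀ u v : Model n, gam j (F y) (fderiv ℝ F y u) (fderiv ℝ F y v) = gam k y u v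

/-! ### Submanifolds -/

/-- `S` is an embedded smooth submanifold, of dimension `d`, of the real vector space `E`: locally
it is the zero set of a submersion. -/
def IsSubmanifold {E : Type*} [NormedAddCommGroup E] [NormedSpace ℝ E] (d : ℕ) (S : Set E) : Prop :=
  ∀ x ∈ S, ∃ (U : Set E) (m : ℕ) (F : E → (Fin m → ℝ)),
    IsOpen U ∧ x ∈ U ∧ m + d = Module.finrank ℝ E ∧ ContDiffOn ℝ ∞ F U ∧
    (∀ y ∈ U, Function.Surjective (fderiv ℝ F y)) ∧ S ∩ U = {y | y ∈ U ∧ F y = 0}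

/-- The tangent vectors to `S` at `x`: the velocities of smooth curves in `S` through `x`. -/
def tangent {E : Type*} [NormedAddCommGroup E] [NormedSpace ℝ E] (S : Set E) (x : E) : Set E :=
  {v | ∃ c : ℝ → E, ContDiffAt ℝ ∞ c 0 ∧ c 0 = x ∧ (∀ᶠ t in 𝓝 (0 : ℝ), c t ∈ S) ∧ deriv c 0 = v}

/-- `N` is an embedded smooth submanifold of `M_n`, of real dimension `d`. -/
def IsSubmanifoldOfM (n d : ℕ) (N : Set (S2 → S2)) : Prop :=
  N ⊆ M n ∧ ∀ k : Fin (2 * n + 1 + 1), IsSubmanifold d (inChart (n := n) k N)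

/-- `N` is a Lagrangian submanifold of `(M_n, Ω)`: its dimension is half the real dimension
of `M_n`, and `Ω` vanishes on its tangent spaces. -/
def IsLagrangian (n : ℕ) (N : Set (S2 → S2)) : Prop :=
  (∃ d : ℕ, IsSubmanifoldOfM n d N ∧ 2 * d = Module.finrank ℝ (Model n)) ∧
    ∀ k : Fin (2 * n + 1 + 1), ∀ b ∈ inChart k N,
      ∀ u ∈ tangent (inChart k N) b, ∀ v ∈ tangent (inChart k N) b, kahlerForm k b u v = 0

/-- The directional derivative `∂_u (γ(v, w))` of the metric coefficients, `v` and `w` constant. -/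
def dGam {n : ℕ} (k : Fin (2 * n + 1 + 1)) (b u v w : Model n) : ℝ :=
  fderiv ℝ (fun y => gam k y v w) b u

/-- The Christoffel symbols of the first kind of `γ`: by the Koszul formula this is
`γ(∇_u V, w)` for the constant field `V = v`. -/
def christoffel {n : ℕ} (k : Fin (2 * n + 1 + 1)) (b u v w : Model n) : ℝ :=
  (dGam k b u v w + dGam k b v u w - dGam k b w u v) / 2

/-- `A = ∇_u Y` at the point with coordinates `b`, for the Levi-Civita connection of `γ`. -/
def IsCovDeriv {n : ℕ} (k : Fin (2 * n + 1 + 1)) (b u : Model n) (Y : Model n → Model n)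
    (A : Model n) : Prop :=
  ∀ w : Model n, gam k b A w = gam k b (fderiv ℝ Y b u) w + christoffel k b u (Y b) w

/-- The submanifold `N` of `(M_n, γ)` is totally geodesic (its second fundamental form vanishes):
the covariant derivative `∇_u Y`, for the Levi-Civita connection of `γ`, of a vector field
tangent to `N` in a direction `u` tangent to `N` is tangent to `N`. -/
def IsTotallyGeodesic (n : ℕ) (N : Set (S2 → S2)) : Prop :=
  ∀ k : Fin (2 * n + 1 + 1), ∀ b ∈ inChart k N, ∀ u ∈ tangent (inChart k N) b,
    ∀ Y : Model n → Model n, ContDiffAt ℝ ∞ Y b →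
      (∀ᶠ y in 𝓝 b, y ∈ inChart k N → Y y ∈ tangent (inChart k N) y) →
      ∃ A ∈ tangent (inChart k N) b, IsCovDeriv k b u Y A

end HarmonicL2

end

/-!
The proof first identifies the space of harmonic maps of degree `n` with the space of rational maps.

*Harmonic maps are rational.* Let `f` be a harmonic map of the sphere, written in the stereographic
chart `sig`. By conformal invariance the Laplacian of `g = f ∘ sig` is normal to the sphere, so that
the Hopf differential `|g_x|² - |g_y|² - 2 i ⟨g_x, g_y⟩` is an entire function. As it tends to zero
at infinity, it vanishes (`hopf_eq_zero`), and `f` is weakly conformal: at every point it is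
holomorphic or antiholomorphic (`conf_or_conf_of_isHarmonic`). Such a map has a harmonic local
coordinate, to which the identity theorem applies, so that one of the two alternatives holds
everywhere (`holomorphic_or_antiholomorphic`, `conf_global`). Positive degree excludes constant and
antiholomorphic maps (`holAt_of_mem_M`); here a regular value is needed, and Sard's theorem provides
it when applied to the homogeneous extension of `f` (`exists_regular_value`). The stereographic
coordinate of `f` is then a meromorphic function on the Riemann sphere, hence rational
(`exists_rational_of_meromorphic`), and the algebraic degree is `n` because the topological degree
of a rational map is found by counting the roots of a polynomial (`hasDegree_ratMap`). Conversely,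
rational maps are holomorphic and therefore harmonic (`harmonicAt_of_holAt`).

*The Kähler metric.* In homogeneous coordinates on the domain, rational maps form a smooth family
over the compact unit sphere of `ℂ²`, which gives the smoothness of `γ`
(`contDiffOn_integral_family`). Multiplication of a tangent vector by `i` rotates the corresponding
vector field along the map `F` by a right angle in the tangent planes of the target
(`pderiv_family_I_smul`), so that `Ω(v, w) = -∫ det (F, ∂_v F, ∂_w F)`. In `dΩ` there remain only
determinants of three tangent vectors, which vanish, and second derivatives of `F`, which cancel by
symmetry (`pderiv_density`, `kahlerForm_closed`).

*The antipodal conjugation.* For odd `n`, the map `f ↦ p ∘ f ∘ p` is given by an antilinear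
involution of the coefficient vectors (`conjAntipodal_ratMap`). It is isometric because it acts on
vector fields by `X ↦ -X ∘ p` and `p` preserves the area (`gam_antiMap`). In a chart, a smooth
involution is linear near a fixed point after the change of coordinates `lin`, so that its fixed
points form a submanifold whose tangent vectors are the fixed vectors of the differential
(`LocalInvolution.isSubmanifold_fixed`, `LocalInvolution.tangent_fixed`). As the differential
anticommutes with `i`, the dimension is half of that of the space
(`LocalInvolution.two_mul_finrank_fixed`) and `Ω` vanishes on fixed vectors
(`isLagrangian_equivariant`); as it is isometric, the fixed-point set is totally geodesic
(`LocalInvolution.exists_covDeriv_mem_tangent`).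

*Maps of the projective plane.* Two lifts of a map differ by a global sign
(`eq_or_eq_neg_of_proj_eq`), and `-f` has degree `-n` when `f` has degree `n`; so exactly one of
them has degree `n`, and the maps that arise as lifts are those that commute with `p`
(`MTildeLift_eq`).
-/

noncomputable section

namespace HarmonicL2

/-! ### Vector algebra in three-space -/

/-- The cross product of `ℝ³`, as a continuous bilinear map. -/
def cr : E3 →L[ℝ] E3 →L[ℝ] E3 :=
  LinearMap.toContinuousBilinearMap <| LinearMap.mk₂ ℝ
    (fun u v : E3 => (!₂[u 1 * v 2 - u 2 * v 1, u 2 * v 0 - u 0 * v 2, u 0 * v 1 - u 1 * v 0] : E3))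
    (by intro u u' v; ext i; fin_cases i <;> simp <;> ring)
    (by intro c u v; ext i; fin_cases i <;> simp <;> ring)
    (by intro u v v'; ext i; fin_cases i <;> simp <;> ring)
    (by intro c u v; ext i; fin_cases i <;> simp <;> ring)

@[simp] lemma cr_zero' (u v : E3) : cr u v 0 = u 1 * v 2 - u 2 * v 1 := rfl
@[simp] lemma cr_one' (u v : E3) : cr u v 1 = u 2 * v 0 - u 0 * v 2 := rfl
@[simp] lemma cr_two' (u v : E3) : cr u v 2 = u 0 * v 1 - u 1 * v 0 := rfl

lemma inner_coord (u v : E3) : inner ℝ u v = u 0 * v 0 + u 1 * v 1 + u 2 * v 2 := by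
  simp [PiLp.inner_apply, Fin.sum_univ_three]; ring

lemma ext3 {u v : E3} (h0 : u 0 = v 0) (h1 : u 1 = v 1) (h2 : u 2 = v 2) : u = v := by
  ext i; fin_cases i <;> assumption

lemma cr_self (u : E3) : cr u u = 0 := by apply ext3 <;> simp <;> ring

lemma cr_swap (u v : E3) : cr u v = -cr v u := by apply ext3 <;> simp <;> ring

lemma cr_cr (u v w : E3) : cr u (cr v w) = inner ℝ u w • v - inner ℝ u v • w := by
  apply ext3 <;> simp [inner_coord] <;> ring

lemma inner_cr_left (u v : E3) : inner ℝ u (cr u v) = 0 := by simp [inner_coord]; ring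

lemma inner_cr_right (u v : E3) : inner ℝ v (cr u v) = 0 := by simp [inner_coord]; ring

lemma inner_cr_cr (u v w z : E3) :
    inner ℝ (cr u v) (cr w z) = inner ℝ u w * inner ℝ v z - inner ℝ u z * inner ℝ v w := by
  simp [inner_coord]; ring

/-- The square of the volume of a parallelepiped is its Gram determinant. -/
lemma inner_cr_sq (u v w : E3) :
    inner ℝ u (cr v w) ^ 2 =
      inner ℝ u u * (inner ℝ v v * inner ℝ w w - inner ℝ v w ^ 2)
      - inner ℝ u v * (inner ℝ u v * inner ℝ w w - inner ℝ v w * inner ℝ u w)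
      + inner ℝ u w * (inner ℝ u v * inner ℝ v w - inner ℝ v v * inner ℝ u w) := by
  simp only [inner_coord, cr_zero', cr_one', cr_two']; ring

/-- Three vectors in a plane have vanishing volume. -/
lemma inner_cr_eq_zero_of_perp {h u v w : E3} (hh : inner ℝ h h = 1) (hu : inner ℝ h u = 0)
    (hv : inner ℝ h v = 0) (hw : inner ℝ h w = 0) : inner ℝ u (cr v w) = 0 := by
  have h1 : cr h (cr v w) = 0 := by rw [cr_cr, hw, hv]; simp
  have h2 : cr h (cr h (cr v w)) = 0 := by rw [h1]; simp
  rw [cr_cr, hh, one_smul, sub_eq_zero] at h2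
  rw [← h2, inner_smul_right, real_inner_comm h u, hu, mul_zero]

lemma cr_cr_of_perp {h v : E3} (hh : inner ℝ h h = 1) (hv : inner ℝ h v = 0) :
    cr h (cr h v) = -v := by
  rw [cr_cr, hv, hh]; simp

lemma norm_sq_inner (v : E3) : ‖v‖ ^ 2 = inner ℝ v v := (real_inner_self_eq_norm_sq v).symm

/-- The orthonormal frame `x, e, x × e`. -/
lemma exists_frame {x e : E3} (hx : inner ℝ x x = 1) (he : inner ℝ e e = 1)
    (hxe : inner ℝ x e = 0) :
    ∃ b : OrthonormalBasis (Fin 3) ℝ E3, b 0 = x ∧ b 1 = e ∧ b 2 = cr x e := by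
  have hex : inner ℝ e x = 0 := by rw [real_inner_comm]; exact hxe
  have ho : Orthonormal ℝ ![x, e, cr x e] := by
    rw [orthonormal_iff_ite]
    intro i j
    have h1 := inner_cr_left x e
    have h2 := inner_cr_right x e
    have h3 : inner ℝ (cr x e) x = 0 := by rw [real_inner_comm]; exact h1
    have h4 : inner ℝ (cr x e) e = 0 := by rw [real_inner_comm]; exact h2
    have h5 : inner ℝ (cr x e) (cr x e) = 1 := by rw [inner_cr_cr, hx, he, hxe]; ring
    fin_cases i <;> fin_cases j <;> simp [-inner_self_eq_norm_sq_to_K, *]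
  have hsp : ⊤ ≤ Submodule.span ℝ (Set.range ![x, e, cr x e]) := by
    rw [top_le_iff]
    apply LinearIndependent.span_eq_top_of_card_eq_finrank ho.linearIndependent
    simp
  refine ⟨OrthonormalBasis.mk ho hsp, ?_, ?_, ?_⟩ <;> simp

lemma exists_unit_perp (x : E3) :
    ∃ e : E3, inner ℝ e e = 1 ∧ inner ℝ x e = 0 := by
  have : ∃ v : E3, v ≠ 0 ∧ inner ℝ x v = 0 := by
    by_cases h : x 0 = 0 ∧ x 1 = 0
    · refine ⟨!₂[1, 0, 0], ?_, ?_⟩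
      · intro hv
        have := congrArg (fun v : E3 => v 0) hv
        simp at this
      · simp [inner_coord, h.1]
    · refine ⟨!₂[x 1, -x 0, 0], ?_, ?_⟩
      · intro hv
        have h0 := congrArg (fun v : E3 => v 0) hv
        have h1 := congrArg (fun v : E3 => v 1) hv
        simp at h0 h1
        exact h ⟨h1, h0⟩
      · simp [inner_coord]; ring
  obtain ⟨v, hv, hxv⟩ := this
  have hn : ‖v‖ ≠ 0 := norm_ne_zero_iff.mpr hv
  refine ⟨‖v‖⁻¹ • v, ?_, ?_⟩
  · rw [real_inner_self_eq_norm_sq, norm_smul, norm_inv, norm_norm, inv_mul_cancel₀ hn, one_pow]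
  · rw [inner_smul_right, hxv, mul_zero]

/-- Expansion of a vector in the orthogonal frame `x, e, x × e`. -/
lemma frame_expand {x e : E3} (hx : inner ℝ x x = 1) (hxe : inner ℝ x e = 0) (v : E3) :
    inner ℝ e e • v = (inner ℝ e e * inner ℝ x v) • x + inner ℝ e v • e
      + inner ℝ (cr x e) v • cr x e := by
  by_cases h0 : e = 0
  · simp [h0]
  have hn : ‖e‖ ≠ 0 := norm_ne_zero_iff.mpr h0
  have hee : inner ℝ e e = ‖e‖ ^ 2 := real_inner_self_eq_norm_sq e
  obtain ⟨b, b0, b1, b2⟩ := exists_frame (x := x) (e := ‖e‖⁻¹ • e) hx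
    (by rw [real_inner_self_eq_norm_sq, norm_smul, norm_inv, norm_norm, inv_mul_cancel₀ hn,
      one_pow]) (by rw [inner_smul_right, hxe, mul_zero])
  have h := b.sum_repr v
  simp only [Fin.sum_univ_three, b.repr_apply_apply, b0, b1, b2, map_smul, inner_smul_left,
    smul_smul] at h
  conv_lhs => rw [← h]
  simp only [hee, smul_add, smul_smul]
  simp only [conj_trivial]
  congr 2
  · congr 1; field_simp
  · field_simp

/-- The trace of a symmetric bilinear map in the frame given by `x`, `e`, `x × e`. -/
lemma frame_trace {G : Type*} [NormedAddCommGroup G] [NormedSpace ℝ G]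
    (F : E3 → G) {x y e : E3} (hx : inner ℝ x x = 1) (hxe : inner ℝ x e = 0) :
    fderiv ℝ (fderiv ℝ F) y e e + fderiv ℝ (fderiv ℝ F) y (cr x e) (cr x e)
      = inner ℝ e e • (Laplacian.laplacian F y - fderiv ℝ (fderiv ℝ F) y x x) := by
  by_cases h0 : e = 0
  · simp [h0]
  have hn : ‖e‖ ≠ 0 := norm_ne_zero_iff.mpr h0
  have hee : inner ℝ e e = ‖e‖ ^ 2 := real_inner_self_eq_norm_sq e
  obtain ⟨b, b0, b1, b2⟩ := exists_frame (x := x) (e := ‖e‖⁻¹ • e) hx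
    (by rw [real_inner_self_eq_norm_sq, norm_smul, norm_inv, norm_norm, inv_mul_cancel₀ hn,
      one_pow]) (by rw [inner_smul_right, hxe, mul_zero])
  rw [InnerProductSpace.laplacian_eq_iteratedFDeriv_orthonormalBasis F b]
  simp only [Fin.sum_univ_three, iteratedFDeriv_two_apply, b0, b1, b2]
  simp only [Matrix.cons_val_zero, Matrix.cons_val_one, map_smul,
    smul_apply, smul_smul, hee]
  rw [add_assoc, add_sub_cancel_left, smul_add, smul_smul, smul_smul]
  have : ‖e‖ ^ 2 * (‖e‖⁻¹ * ‖e‖⁻¹) = 1 := by field_simp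
  rw [this, one_smul, one_smul]

/-- Two orthogonal vectors of equal length in the plane perpendicular to the unit vector `g` differ
by a rotation by a right angle. -/
lemma eq_cr_or_eq_neg_cr {g a b : E3} (hg : inner ℝ g g = 1) (ha : inner ℝ g a = 0)
    (hb : inner ℝ g b = 0) (hab : inner ℝ a b = 0) (hl : inner ℝ a a = inner ℝ b b) :
    b = cr g a ∨ b = -cr g a := by
  have hba : inner ℝ b a = 0 := by rw [real_inner_comm]; exact hab
  have hbg : inner ℝ b g = 0 := by rw [real_inner_comm]; exact hb
  have h1 : inner ℝ b (cr g a) ^ 2 = inner ℝ a a ^ 2 := by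
    rw [inner_cr_sq, ← hl, hg, ha, hba, hbg]; ring
  have hcc : inner ℝ (cr g a) (cr g a) = inner ℝ a a := by
    rw [inner_cr_cr, hg, ha]; ring
  have hc2 : inner ℝ (cr g a) b = inner ℝ b (cr g a) := real_inner_comm _ _
  rcases sq_eq_sq_iff_eq_or_eq_neg.mp h1 with h | h
  · left
    rw [← sub_eq_zero, ← inner_self_eq_zero (𝕜 := ℝ)]
    simp only [inner_sub_left, inner_sub_right]
    rw [hc2, hcc, h, ← hl]; ring
  · right
    rw [← sub_eq_zero, ← inner_self_eq_zero (𝕜 := ℝ)]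
    simp only [inner_sub_left, inner_sub_right, inner_neg_left, inner_neg_right]
    rw [hc2, hcc, h, ← hl]; ring

/-! ### The differential of the stereographic parametrization -/

/-- The differential of `(p, q) ↦ invStereoVec p q` in the direction `(p', q')`, which
depends on `(p', q')` only through `w = p' q - p q'`. -/
def stereoD (p q : ℂ) : ℂ →L[ℝ] E3 :=
  LinearMap.toContinuousLinearMap
  { toFun := fun w => (2 * ((Complex.normSq p + Complex.normSq q) ^ 2)⁻¹) •
      !₂[((starRingEnd ℂ q) ^ 2 * w - p ^ 2 * starRingEnd ℂ w).re,
        ((starRingEnd ℂ q) ^ 2 * w - p ^ 2 * starRingEnd ℂ w).im,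
        2 * (starRingEnd ℂ p * starRingEnd ℂ q * w).re]
    map_add' := by
      intro u v
      apply ext3 <;> simp <;> ring
    map_smul' := by
      intro u v
      apply ext3 <;> simp <;> ring }

lemma stereoD_apply (p q w : ℂ) : stereoD p q w =
    (2 * ((Complex.normSq p + Complex.normSq q) ^ 2)⁻¹) •
      !₂[((starRingEnd ℂ q) ^ 2 * w - p ^ 2 * starRingEnd ℂ w).re,
        ((starRingEnd ℂ q) ^ 2 * w - p ^ 2 * starRingEnd ℂ w).im,
        2 * (starRingEnd ℂ p * starRingEnd ℂ q * w).re] := rfl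

lemma normSq_add_pos {p q : ℂ} (h : ¬ (p = 0 ∧ q = 0)) :
    0 < Complex.normSq p + Complex.normSq q := by
  rcases not_and_or.mp h with h | h
  · have := Complex.normSq_pos.mpr h
    have := Complex.normSq_nonneg q
    linarith
  · have := Complex.normSq_pos.mpr h
    have := Complex.normSq_nonneg p
    linarith

/-- The parametrization is conformal. -/
lemma inner_stereoD (p q w w₁ : ℂ) : inner ℝ (stereoD p q w) (stereoD p q w₁) =
    4 * (w * starRingEnd ℂ w₁).re * ((Complex.normSq p + Complex.normSq q) ^ 2)⁻¹ := by
  by_cases h : p = 0 ∧ q = 0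
  · simp [h.1, h.2, stereoD_apply]
  have hN := (normSq_add_pos h).ne'
  rw [inner_coord]
  simp only [stereoD_apply, PiLp.smul_apply, smul_eq_mul, Matrix.cons_val_zero,
    Matrix.cons_val_one, Matrix.cons_val]
  field_simp
  simp only [Complex.normSq_apply, Complex.mul_re, Complex.mul_im, Complex.conj_re,
    Complex.conj_im, Complex.sub_re, Complex.sub_im, pow_two]
  ring

lemma stereoD_eq_zero {p q w : ℂ} (h : ¬ (p = 0 ∧ q = 0)) :
    stereoD p q w = 0 ↔ w = 0 := by
  refine ⟨fun h0 => ?_, fun h0 => by rw [h0, map_zero]⟩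
  have h1 := inner_stereoD p q w w
  rw [h0, inner_zero_left, Complex.mul_conj] at h1
  have hN := normSq_add_pos h
  have h2 : Complex.normSq w = 0 := by
    by_contra h3
    have : (4 * Complex.normSq w * ((Complex.normSq p + Complex.normSq q) ^ 2)⁻¹) ≠ 0 := by
      positivity
    exact this (by simpa using h1.symm)
  exact Complex.normSq_eq_zero.mp h2

/-- Multiplication by `i` corresponds to rotation by a right angle in the tangent plane; the sign
is due to the projection from the north pole reversing the orientation of the outward normal. -/
lemma stereoD_I_mul {p q : ℂ} (h : ¬ (p = 0 ∧ q = 0)) (w : ℂ) :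
    stereoD p q (Complex.I * w) = -cr (invStereoVec p q) (stereoD p q w) := by
  have hN := (normSq_add_pos h).ne'
  apply ext3 <;>
  simp only [stereoD_apply, invStereoVec, PiLp.smul_apply, smul_eq_mul, Matrix.cons_val_zero,
    Matrix.cons_val_one, Matrix.cons_val, PiLp.neg_apply, cr_zero', cr_one', cr_two'] <;>
  field_simp <;>
  simp only [Complex.normSq_apply, Complex.mul_re, Complex.mul_im, Complex.conj_re,
    Complex.conj_im, Complex.sub_re, Complex.sub_im, pow_two, Complex.I_re, Complex.I_im] <;>
  ring

lemma inner_invStereoVec {p q : ℂ} (h : ¬ (p = 0 ∧ q = 0)) :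
    inner ℝ (invStereoVec p q) (invStereoVec p q) = 1 := by
  have := invStereoVec_mem h
  rw [real_inner_self_eq_norm_sq, mem_sphere_zero_iff_norm.mp this, one_pow]

lemma inner_invStereoVec_stereoD {p q : ℂ} (h : ¬ (p = 0 ∧ q = 0)) (w : ℂ) :
    inner ℝ (invStereoVec p q) (stereoD p q w) = 0 := by
  have hN := (normSq_add_pos h).ne'
  rw [inner_coord]
  simp only [stereoD_apply, invStereoVec, PiLp.smul_apply, smul_eq_mul, Matrix.cons_val_zero,
    Matrix.cons_val_one, Matrix.cons_val]
  field_simp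
  simp only [Complex.normSq_apply, Complex.mul_re, Complex.mul_im, Complex.conj_re,
    Complex.conj_im, Complex.sub_re, Complex.sub_im, pow_two]
  ring

lemma invStereoVec_smul {c : ℂ} (hc : c ≠ 0) (p q : ℂ) :
    invStereoVec (c * p) (c * q) = invStereoVec p q := by
  by_cases h : p = 0 ∧ q = 0
  · simp [h.1, h.2]
  have hN := (normSq_add_pos h).ne'
  have hc' : Complex.normSq c ≠ 0 := by simpa using hc
  have e : Complex.normSq (c * p) + Complex.normSq (c * q)
    = Complex.normSq c * (Complex.normSq p + Complex.normSq q) := by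
    rw [map_mul, map_mul]; ring
  have h3 : c * p * starRingEnd ℂ (c * q)
      = (Complex.normSq c : ℂ) * (p * starRingEnd ℂ q) := by
    rw [Complex.normSq_eq_conj_mul_self, map_mul]; ring
  unfold invStereoVec
  rw [e, h3]
  apply ext3 <;>
  simp only [PiLp.smul_apply, smul_eq_mul, Matrix.cons_val_zero,
    Matrix.cons_val_one, Matrix.cons_val, map_mul, Complex.re_ofReal_mul,
    Complex.im_ofReal_mul] <;>
  field_simp

/-- The parametrization is smooth away from the origin of `ℂ²`. -/
lemma contDiffAt_invStereoVec {E : Type*} [NormedAddCommGroup E] [NormedSpace ℝ E]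
    {P Q : E → ℂ} {x : E} {n : WithTop ℕ∞} (hP : ContDiffAt ℝ n P x) (hQ : ContDiffAt ℝ n Q x)
    (h : ¬ (P x = 0 ∧ Q x = 0)) :
    ContDiffAt ℝ n (fun y => invStereoVec (P y) (Q y)) x := by
  have hre : ContDiff ℝ n Complex.re := Complex.reCLM.contDiff
  have him : ContDiff ℝ n Complex.im := Complex.imCLM.contDiff
  have hp1 := hre.contDiffAt.comp x hP
  have hp2 := him.contDiffAt.comp x hP
  have hq1 := hre.contDiffAt.comp x hQ
  have hq2 := him.contDiffAt.comp x hQ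
  simp only [Function.comp_def] at hp1 hp2 hq1 hq2
  have hN := (normSq_add_pos h).ne'
  rw [contDiffAt_euclidean]
  intro i
  fin_cases i <;>
  · simp [invStereoVec, Complex.normSq_apply, Complex.mul_re, Complex.mul_im] at hN ⊢
    refine ContDiffAt.mul (ContDiffAt.inv ?_ hN) ?_ <;> fun_prop

/-- The derivative of the parametrization along a curve, from which the total differential
`hasFDerivAt_invStereoVec` is read off on lines. -/
lemma hasDerivAt_invStereoVec {p q : ℝ → ℂ} {p' q' : ℂ} {t : ℝ} (hp : HasDerivAt p p' t)
    (hq : HasDerivAt q q' t) (h : ¬ (p t = 0 ∧ q t = 0)) :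
    HasDerivAt (fun s => invStereoVec (p s) (q s))
      (stereoD (p t) (q t) (p' * q t - p t * q')) t := by
  have hre : ∀ {f : ℝ → ℂ} {f' : ℂ}, HasDerivAt f f' t →
      HasDerivAt (fun s => (f s).re) f'.re t := fun hf =>
    (Complex.reCLM.hasFDerivAt.comp_hasDerivAt t hf)
  have him : ∀ {f : ℝ → ℂ} {f' : ℂ}, HasDerivAt f f' t →
      HasDerivAt (fun s => (f s).im) f'.im t := fun hf =>
    (Complex.imCLM.hasFDerivAt.comp_hasDerivAt t hf)
  have hp1 := hre hp
  have hp2 := him hp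
  have hq1 := hre hq
  have hq2 := him hq
  have hN := (normSq_add_pos h).ne'
  have hNd : HasDerivAt (fun s => (Complex.normSq (p s) + Complex.normSq (q s)))
      (p'.re * (p t).re + (p t).re * p'.re + (p'.im * (p t).im + (p t).im * p'.im)
        + (q'.re * (q t).re + (q t).re * q'.re + (q'.im * (q t).im + (q t).im * q'.im))) t := by
    simp only [Complex.normSq_apply]
    exact ((hp1.mul hp1).add (hp2.mul hp2)).add ((hq1.mul hq1).add (hq2.mul hq2))
  have hNi := hNd.inv hN
  have e : HasDerivAt (fun s => (WithLp.toLp 2 ![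
      ((Complex.normSq (p s) + Complex.normSq (q s)))⁻¹ *
        (2 * ((p s).re * (q s).re + (p s).im * (q s).im)),
      ((Complex.normSq (p s) + Complex.normSq (q s)))⁻¹ *
        (2 * ((p s).im * (q s).re - (p s).re * (q s).im)),
      ((Complex.normSq (p s) + Complex.normSq (q s)))⁻¹ *
        ((p s).re * (p s).re + (p s).im * (p s).im
         - ((q s).re * (q s).re + (q s).im * (q s).im))] : E3))
      (stereoD (p t) (q t) (p' * q t - p t * q')) t := by
    rw [hasDerivAt_iff_hasFDerivAt, ← hasFDerivWithinAt_univ, hasFDerivWithinAt_euclidean]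
    intro i
    rw [hasFDerivWithinAt_univ]
    have key : ∀ {f : ℝ → ℝ} {L : ℝ →L[ℝ] ℝ} {c : ℝ}, HasDerivAt f c t → L 1 = c →
        HasFDerivAt f L t := by
      intro f L c hf hL
      have := hf.hasFDerivAt
      refine this.congr_fderiv ?_
      ext
      simp [hL]
    fin_cases i
    · refine key (hNi.mul (((hp1.mul hq1).add (hp2.mul hq2)).const_mul 2)) ?_
      simp [stereoD_apply]
      field_simp
      simp [Complex.normSq_apply, pow_two]
      ring
    · refine key (hNi.mul (((hp2.mul hq1).sub (hp1.mul hq2)).const_mul 2)) ?_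
      simp [stereoD_apply]
      field_simp
      simp [Complex.normSq_apply, pow_two]
      ring
    · refine key (hNi.mul (((hp1.mul hp1).add (hp2.mul hp2)).sub
        ((hq1.mul hq1).add (hq2.mul hq2)))) ?_
      simp [stereoD_apply]
      field_simp
      simp [Complex.normSq_apply, pow_two]
      ring
  convert e using 2 with s
  apply ext3 <;> simp [invStereoVec, Complex.normSq_apply, -mul_eq_mul_left_iff]
  ring

lemma hasFDerivAt_invStereoVec {E : Type*} [NormedAddCommGroup E] [NormedSpace ℝ E]
    {P Q : E → ℂ} {P' Q' : E →L[ℝ] ℂ} {x : E} (hP : HasFDerivAt P P' x) (hQ : HasFDerivAt Q Q' x)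
    (h : ¬ (P x = 0 ∧ Q x = 0)) :
    HasFDerivAt (fun y => invStereoVec (P y) (Q y))
      (stereoD (P x) (Q x) ∘L (Q x • P' - P x • Q')) x := by
  have hd : DifferentiableAt ℝ (fun y : ℂ × ℂ => invStereoVec y.1 y.2) (P x, Q x) :=
    (contDiffAt_invStereoVec (n := 1) contDiffAt_fst contDiffAt_snd h).differentiableAt one_ne_zero
  have hc := hd.hasFDerivAt.comp x (hP.prodMk hQ)
  refine hc.congr_fderiv ?_
  symm
  ext1 v
  have hline : HasDerivAt (fun t : ℝ => ((P x + t * P' v, Q x + t * Q' v) : ℂ × ℂ))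
      (P' v, Q' v) 0 := by
    have h1 : HasDerivAt (fun t : ℝ => (t : ℂ)) 1 0 := Complex.ofRealCLM.hasDerivAt
    have h2 : ∀ a b : ℂ, HasDerivAt (fun t : ℝ => a + (t : ℂ) * b) b 0 := by
      intro a b
      simpa using (h1.mul_const b).const_add a
    exact (h2 _ _).prodMk (h2 _ _)
  have e1 : HasFDerivAt (fun y : ℂ × ℂ => invStereoVec y.1 y.2)
      (fderiv ℝ (fun y : ℂ × ℂ => invStereoVec y.1 y.2) (P x, Q x))
      ((fun t : ℝ => ((P x + t * P' v, Q x + t * Q' v) : ℂ × ℂ)) 0) := by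
    simpa using hd.hasFDerivAt
  have e2 := e1.comp_hasDerivAt 0 hline
  have e3 := hasDerivAt_invStereoVec (t := 0) (hline.fst) (hline.snd) (by simpa using h)
  have e4 := e2.unique e3
  simp only [ContinuousLinearMap.comp_apply, ContinuousLinearMap.prod_apply] at e4 ⊢
  rw [e4]
  simp [mul_comm]

/-! ### The radially constant extension -/

lemma S2.inner_self (x : S2) : inner ℝ (x : E3) (x : E3) = 1 := by
  rw [real_inner_self_eq_norm_sq, norm_eq_of_mem_sphere, one_pow]

lemma ext_coe (f : S2 → S2) (x : S2) : ext f x = f x := by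
  rw [ext, dif_pos (S2.ne_zero x)]
  congr 2
  ext1
  simp

lemma ext_smul (f : S2 → S2) {t : ℝ} (ht : 0 < t) (y : E3) : ext f (t • y) = ext f y := by
  by_cases hy : y = 0
  · simp [hy]
  have hty : t • y ≠ 0 := smul_ne_zero ht.ne' hy
  rw [ext, ext, dif_pos hy, dif_pos hty]
  congr 2
  ext1
  simp only [norm_smul, Real.norm_eq_abs, abs_of_pos ht, smul_smul, mul_inv]
  congr 1
  field_simp

lemma inner_ext_self (f : S2 → S2) {y : E3} (hy : y ≠ 0) :
    inner ℝ (ext f y) (ext f y) = 1 := by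
  rw [ext, dif_pos hy]
  exact S2.inner_self _

/-- The radial projection to the sphere. -/
def toS2 (y : E3) (hy : y ≠ 0) : S2 := ⟨‖y‖⁻¹ • y, normalize_mem hy⟩

lemma eq_norm_smul_toS2 (y : E3) (hy : y ≠ 0) : y = ‖y‖ • (toS2 y hy : E3) := by
  have : ‖y‖ ≠ 0 := norm_ne_zero_iff.mpr hy
  simp [toS2, smul_smul, this]

lemma ext_eq_toS2 (f : S2 → S2) (y : E3) (hy : y ≠ 0) : ext f y = f (toS2 y hy) := by
  rw [ext, dif_pos hy]; rfl

lemma ext_comp_smul (f : S2 → S2) {t : ℝ} (ht : 0 < t) : (fun y => ext f (t • y)) = ext f :=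
  funext fun y => ext_smul f ht y

lemma fderiv_ext_smul (f : S2 → S2) {y : E3} {t : ℝ} (ht : 0 < t) (v : E3) :
    fderiv ℝ (ext f) (t • y) v = t⁻¹ • fderiv ℝ (ext f) y v := by
  have h := fderiv_comp_smul (f := ext f) (x := y) t (𝕜 := ℝ)
  rw [ext_comp_smul f ht] at h
  rw [h, smul_apply, smul_smul, inv_mul_cancel₀ ht.ne', one_smul]

/-- The radial derivative of a radially constant map vanishes. -/
lemma fderiv_ext_radial {f : S2 → S2} {y : E3} (hd : DifferentiableAt ℝ (ext f) y) :
    fderiv ℝ (ext f) y y = 0 := by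
  have h1 : HasDerivAt (fun t : ℝ => t • y) y 1 := by
    simpa using (hasDerivAt_id (1 : ℝ)).smul_const y
  have h2 : HasFDerivAt (ext f) (fderiv ℝ (ext f) y) ((1 : ℝ) • y) := by
    rw [one_smul]; exact hd.hasFDerivAt
  have h3 := h2.comp_hasDerivAt (1 : ℝ) h1
  have h4 : HasDerivAt (ext f ∘ fun t : ℝ => t • y) 0 1 := by
    refine (hasDerivAt_const (1 : ℝ) (ext f y)).congr_of_eventuallyEq ?_
    filter_upwards [lt_mem_nhds (zero_lt_one' ℝ)] with t ht
    exact ext_smul f ht y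
  exact h3.unique h4

/-- Derivatives of a map to the sphere are tangent to the sphere. -/
lemma inner_ext_fderiv {f : S2 → S2} {y : E3} (hy : y ≠ 0)
    (hd : DifferentiableAt ℝ (ext f) y) (v : E3) :
    inner ℝ (ext f y) (fderiv ℝ (ext f) y v) = 0 := by
  have h1 := (hd.hasFDerivAt.inner ℝ hd.hasFDerivAt)
  have h2 : HasFDerivAt (fun z => inner ℝ (ext f z) (ext f z)) (0 : E3 →L[ℝ] ℝ) y := by
    refine (hasFDerivAt_const (1 : ℝ) y).congr_of_eventuallyEq ?_
    filter_upwards [isOpen_ne.mem_nhds hy] with z hz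
    exact inner_ext_self f hz
  have h3 := congrArg (fun L => L v) (h1.unique h2)
  simp at h3
  have h5 := real_inner_comm (ext f y) (fderiv ℝ (ext f) y v)
  linarith

lemma hasFDerivAt_fderiv {E G : Type*} [NormedAddCommGroup E] [NormedSpace ℝ E]
    [NormedAddCommGroup G] [NormedSpace ℝ G] {F : E → G} {x : E} (h : ContDiffAt ℝ 2 F x) :
    HasFDerivAt (fderiv ℝ F) (fderiv ℝ (fderiv ℝ F) x) x :=
  ((h.fderiv_right (m := 1) le_rfl).differentiableAt one_ne_zero).hasFDerivAt

lemma eventually_differentiableAt {E G : Type*} [NormedAddCommGroup E] [NormedSpace ℝ E]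
    [NormedAddCommGroup G] [NormedSpace ℝ G] {F : E → G} {x : E} (h : ContDiffAt ℝ 2 F x) :
    ∀ᶠ y in 𝓝 x, DifferentiableAt ℝ F y := by
  filter_upwards [h.eventually (by simp)] with y hy
  exact hy.differentiableAt two_ne_zero

lemma fderiv_fderiv_symm {E G : Type*} [NormedAddCommGroup E] [NormedSpace ℝ E]
    [NormedAddCommGroup G] [NormedSpace ℝ G] {F : E → G} {x : E} (h : ContDiffAt ℝ 2 F x)
    (u v : E) : fderiv ℝ (fderiv ℝ F) x u v = fderiv ℝ (fderiv ℝ F) x v u :=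
  (h.isSymmSndFDerivAt (by simp)).eq u v

lemma fderiv_fderiv_ext_radial {f : S2 → S2} {y : E3} (h : ContDiffAt ℝ 2 (ext f) y) :
    fderiv ℝ (fderiv ℝ (ext f)) y y y = 0 := by
  have h1 := (hasFDerivAt_fderiv h).clm_apply (hasFDerivAt_id y)
  have h2 : HasFDerivAt (fun z => fderiv ℝ (ext f) z (id z)) (0 : E3 →L[ℝ] E3) y := by
    refine (hasFDerivAt_const (0 : E3) y).congr_of_eventuallyEq ?_
    filter_upwards [eventually_differentiableAt h] with z hz
    exact fderiv_ext_radial hz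
  have h3 := congrArg (fun L => L y) (h1.unique h2)
  have h4 := fderiv_ext_radial (h.differentiableAt two_ne_zero)
  simpa [h4] using h3

/-! ### Weakly conformal maps -/

/-- For `s = 1` the differential of `f` at `x` is complex linear (`f` is holomorphic at `x`), for
`s = -1` it is antilinear; the complex structure of the tangent plane at `x` is
the cross product with `x`. -/
def HolAt (s : ℝ) (f : S2 → S2) (x : S2) : Prop :=
  ∀ v : E3, fderiv ℝ (ext f) x (cr x v) = s • cr (f x) (fderiv ℝ (ext f) x v)

lemma SmoothAt.contDiffAt_two {f : S2 → S2} {x : S2} (h : SmoothAt f x) :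
    ContDiffAt ℝ 2 (ext f) (x : E3) := ContDiffAt.of_le h (by norm_cast)

lemma SmoothAt.differentiableAt {f : S2 → S2} {x : S2} (h : SmoothAt f x) :
    DifferentiableAt ℝ (ext f) (x : E3) := h.contDiffAt_two.differentiableAt two_ne_zero

lemma inner_fderiv {f : S2 → S2} {x : S2} (h : SmoothAt f x) (v : E3) :
    inner ℝ ((f x : S2) : E3) (fderiv ℝ (ext f) x v) = 0 := by
  rw [← ext_coe]; exact inner_ext_fderiv (S2.ne_zero x) h.differentiableAt v

/-- The energy density does not depend on the orthonormal frame: it is the trace of `A* A`. -/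
lemma sum_norm_sq_frame (A : E3 →L[ℝ] E3) (b : OrthonormalBasis (Fin 3) ℝ E3) :
    ∑ i, ‖A (EuclideanSpace.single i 1)‖ ^ 2 = ∑ i, ‖A (b i)‖ ^ 2 := by
  have key : ∀ c : OrthonormalBasis (Fin 3) ℝ E3, ∑ i, ‖A (c i)‖ ^ 2 =
      LinearMap.trace ℝ E3 ((ContinuousLinearMap.adjoint A ∘L A : E3 →L[ℝ] E3) : E3 →ₗ[ℝ] E3) := by
    intro c
    rw [LinearMap.trace_eq_sum_inner _ c]
    refine Finset.sum_congr rfl fun i _ => ?_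
    simp [ContinuousLinearMap.adjoint_inner_right]
  rw [key b, ← key (EuclideanSpace.basisFun (Fin 3) ℝ)]
  simp

/-- A linear map multiplies oriented volumes by its determinant. -/
lemma det_mul_volume (A : E3 →ₗ[ℝ] E3) (u v w : E3) :
    inner ℝ (A u) (cr (A v) (A w)) = LinearMap.det A * inner ℝ u (cr v w) := by
  set b := (EuclideanSpace.basisFun (Fin 3) ℝ).toBasis
  have hA : ∀ (u : E3) (i : Fin 3), A u i = ∑ j, LinearMap.toMatrix b b A i j * u j := by
    intro u i
    have := congrFun (LinearMap.toMatrix_mulVec_repr b b A u) i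
    simp only [Matrix.mulVec, dotProduct, b, OrthonormalBasis.coe_toBasis_repr_apply,
      EuclideanSpace.basisFun_repr] at this
    exact this.symm
  rw [← LinearMap.det_toMatrix b, Matrix.det_fin_three]
  simp only [inner_coord, cr_zero', cr_one', cr_two', hA, Fin.sum_univ_three]
  ring

/-- The identity `|e|² jac f = s |df e|²` for tangent vectors `e`, obtained by comparing the
oriented volumes of `x, e, x × e` and of its image `f x, df e, s (f x × df e)`. -/
lemma inner_mul_jac {s : ℝ} {f : S2 → S2} {x : S2} (hf : SmoothAt f x)
    (h : HolAt s f x) {e : E3} (he : inner ℝ (x : E3) e = 0) :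
    inner ℝ e e * jac f x =
      s * inner ℝ (fderiv ℝ (ext f) x e) (fderiv ℝ (ext f) x e) := by
  have h1 := det_mul_volume
    (((fderiv ℝ (ext f) (x : E3)) +
      (innerSL ℝ (x : E3)).smulRight ((f x : S2) : E3) : E3 →L[ℝ] E3) : E3 →ₗ[ℝ] E3)
    x e (cr x e)
  have hx := S2.inner_self x
  have hx' : ‖(x : E3)‖ = 1 := norm_eq_of_mem_sphere x
  have hF := S2.inner_self (f x)
  have ha := inner_fderiv hf e
  change _ = jac f x * _ at h1
  simp only [ContinuousLinearMap.coe_coe, add_apply, ContinuousLinearMap.smulRight_apply,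
    innerSL_apply_apply, he, inner_cr_left, zero_smul, add_zero, hx,
    one_smul, fderiv_ext_radial hf.differentiableAt, zero_add, h e, map_smul] at h1
  rw [cr_cr, cr_cr] at h1
  simp only [inner_smul_right, inner_sub_right, ha, hx, hF, mul_zero, sub_zero, mul_one, he] at h1
  linarith

lemma HolAt.normSqDeriv {s : ℝ} (hs : s * s = 1) {f : S2 → S2} {x : S2}
    (hf : SmoothAt f x) (h : HolAt s f x) {e : E3} (hee : inner ℝ e e = 1)
    (he : inner ℝ (x : E3) e = 0) : normSqDeriv f x =
      2 * inner ℝ (fderiv ℝ (ext f) x e) (fderiv ℝ (ext f) x e) := by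
  obtain ⟨b, b0, b1, b2⟩ := exists_frame (S2.inner_self x) hee he
  have ha := inner_fderiv hf e
  rw [HarmonicL2.normSqDeriv, sum_norm_sq_frame _ b, Fin.sum_univ_three, b0, b1, b2,
    fderiv_ext_radial hf.differentiableAt, h e]
  simp only [norm_sq_inner, inner_smul_left, inner_smul_right, inner_cr_cr, ha,
    S2.inner_self (f x), conj_trivial, inner_zero_left]
  linear_combination (inner ℝ (fderiv ℝ (ext f) x e) (fderiv ℝ (ext f) x e)) * hs

/-- The sign of the Jacobian tells holomorphic maps from antiholomorphic ones. -/
lemma HolAt.jac_eq {s : ℝ} (hs : s * s = 1) {f : S2 → S2} {x : S2} (hf : SmoothAt f x)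
    (h : HolAt s f x) : jac f x = s * (HarmonicL2.normSqDeriv f x / 2) := by
  obtain ⟨e, hee, he⟩ := exists_unit_perp (x : E3)
  have := inner_mul_jac hf h he
  rw [hee] at this
  rw [h.normSqDeriv hs hf hee he]
  linarith

lemma normSqDeriv_nonneg (f : S2 → S2) (x : S2) : 0 ≤ normSqDeriv f x :=
  Finset.sum_nonneg fun _ _ => by positivity

/-- Holomorphic maps of the sphere are harmonic: on tangent vectors the equation
`dF (y × v) = ‖y‖ F × dF v` is differentiated in the two directions of a tangent frame. -/
lemma harmonicAt_of_holAt {f : S2 → S2} (hsm : ∀ x, SmoothAt f x) (hol : ∀ x, HolAt 1 f x)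
    (x : S2) : HarmonicAt f x := by
  refine ⟨hsm x, ?_⟩
  have hf := hsm x
  have h2 := hf.contDiffAt_two
  have hx := S2.inner_self x
  set F := ext f with hF
  set D := fderiv ℝ F (x : E3) with hD
  set D2 := fderiv ℝ (fderiv ℝ F) (x : E3) with hD2
  have hFx : F x = f x := ext_coe f x
  have hol' : ∀ᶠ y in 𝓝 (x : E3), ∀ v, fderiv ℝ F y (cr y v)
      = ‖y‖ • cr (F y) (fderiv ℝ F y v) := by
    filter_upwards [isOpen_ne.mem_nhds (S2.ne_zero x)] with y hy v
    have hy' : 0 < ‖y‖ := norm_pos_iff.mpr hy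
    have e := hol (toS2 y hy) v
    rw [one_smul] at e
    have e1 : ∀ w, fderiv ℝ F y w = ‖y‖⁻¹ • fderiv ℝ F (toS2 y hy : E3) w := by
      intro w
      rw [← fderiv_ext_smul f hy', ← eq_norm_smul_toS2]
    rw [e1, e1, hF, ext_eq_toS2 f y hy]
    have e2 : cr y v = ‖y‖ • cr (toS2 y hy) v := by
      conv_lhs => rw [eq_norm_smul_toS2 y hy]
      simp
    rw [e2, map_smul, e, map_smul, smul_smul, smul_smul, mul_comm]
  have step : ∀ e w : E3, inner ℝ (x : E3) w = 0 →
      D2 w (cr x e) + D (cr w e) = cr (D w) (D e) + cr (F x) (D2 w e) := by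
    intro e w hw
    have hl : HasFDerivAt (fun y => fderiv ℝ F y (cr y e)) _ (x : E3) :=
      (hasFDerivAt_fderiv h2).clm_apply
        ((cr.hasFDerivAt (x := (x : E3))).clm_apply (hasFDerivAt_const e (x : E3)))
    have hr1 : HasFDerivAt (fun y => cr (F y) (fderiv ℝ F y e)) _ (x : E3) :=
      ((cr.hasFDerivAt (x := F x)).comp (x : E3)
        (hf.differentiableAt.hasFDerivAt)).clm_apply
        ((hasFDerivAt_fderiv h2).clm_apply (hasFDerivAt_const e (x : E3)))
    have hn : HasFDerivAt (fun y : E3 => ‖y‖) (fderiv ℝ (fun y : E3 => ‖y‖) (x : E3)) (x : E3) :=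
      ((contDiffAt_norm ℝ (S2.ne_zero x)).differentiableAt one_ne_zero).hasFDerivAt
    have hnw : fderiv ℝ (fun y : E3 => ‖y‖) (x : E3) w = 0 := by
      have h1 := hn.pow 2
      have h3 : HasFDerivAt (fun y : E3 => ‖y‖ ^ 2) (2 • innerSL ℝ (x : E3)) (x : E3) :=
        (hasStrictFDerivAt_norm_sq (x : E3)).hasFDerivAt
      have h4 := congrArg (fun L => L w) (h1.unique h3)
      simp [hw] at h4
      exact h4
    have hr := hn.smul hr1
    have he := hl.unique (hr.congr_of_eventuallyEq (hol'.mono fun y hy => hy e))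
    have he' := congrArg (fun L => L w) he
    simp [hnw] at he'
    rw [add_comm]
    exact he'.trans (add_comm _ _)
  obtain ⟨e, hee, he⟩ := exists_unit_perp (x : E3)
  have hDx : D x = 0 := fderiv_ext_radial hf.differentiableAt
  have s1 := step e (cr x e) (inner_cr_left _ _)
  have s2 := step (cr x e) e he
  have t1 : cr (cr x e) e = -(x : E3) := by
    rw [cr_swap, cr_cr, hee, real_inner_comm, he]; simp
  have t2 : cr e (cr x e) = (x : E3) := by
    rw [cr_cr, hee, real_inner_comm, he]; simp
  rw [t1, map_neg, hDx] at s1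
  rw [t2, hDx, cr_cr_of_perp hx he, map_neg] at s2
  have tr := frame_trace F (y := (x : E3)) hx he
  rw [hee, one_smul, fderiv_fderiv_ext_radial h2, sub_zero] at tr
  have sym := fderiv_fderiv_symm h2 e (cr x e)
  have hDe : D (cr x e) = cr (f x) (D e) := by simpa using hol x e
  have ha := inner_fderiv hf e
  have hcc : cr (D e) (D (cr x e)) = inner ℝ (D e) (D e) • ((f x : S2) : E3) := by
    rw [hDe, cr_cr, real_inner_comm (f x : E3) (D e)]; simp [D, hF, ha]
  rw [← tr, (hol x).normSqDeriv (by norm_num) hf hee he]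
  have hcc' : cr (D (cr x e)) (D e) = -(inner ℝ (D e) (D e) • ((f x : S2) : E3)) := by
    rw [cr_swap, hcc]
  rw [hcc'] at s1
  rw [hcc] at s2
  change D2 e e + D2 (cr x e) (cr x e) + _ = 0
  have sym' : D2 e (cr x e) = D2 (cr x e) e := sym
  rw [sym', add_zero] at s2
  rw [neg_zero, add_zero] at s1
  have s2' : D2 e e = -(inner ℝ (D e) (D e) • ((f x : S2) : E3) + cr (F x) (D2 (cr x e) e)) := by
    rw [← s2, neg_neg]
  rw [s1, s2']
  change _ + (2 * inner ℝ (D e) (D e)) • ((f x : S2) : E3) = 0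
  module

/-! ### Homogeneous coordinates and conformal charts -/

lemma invStereo_coe {p q : ℂ} (h : ¬ (p = 0 ∧ q = 0)) :
    ((invStereo p q : S2) : E3) = invStereoVec p q := by
  rw [invStereo, dif_neg h]

lemma invStereo_smul {c : ℂ} (hc : c ≠ 0) (p q : ℂ) :
    invStereo (c * p) (c * q) = invStereo p q := by
  by_cases h : p = 0 ∧ q = 0
  · simp [h.1, h.2]
  have h' : ¬ (c * p = 0 ∧ c * q = 0) := by simpa [hc] using h
  apply Subtype.ext
  rw [invStereo_coe h, invStereo_coe h', invStereoVec_smul hc]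

lemma sphere_eq (x : S2) : (x : E3) 0 ^ 2 + (x : E3) 1 ^ 2 + (x : E3) 2 ^ 2 = 1 := by
  have := S2.inner_self x
  rw [inner_coord] at this
  linarith

lemma homog_ne (x : S2) : ¬ ((homog x).1 = 0 ∧ (homog x).2 = 0) := by
  unfold homog
  split_ifs with h
  · simp
  · intro h0
    have : 1 - (x : E3) 2 = 0 := Complex.ofReal_eq_zero.mp h0.2
    exact h (by linarith)

lemma invStereo_homog (x : S2) : invStereo (homog x).1 (homog x).2 = x := by
  apply Subtype.ext
  rw [invStereo_coe (homog_ne x)]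
  have hx := sphere_eq x
  unfold homog
  split_ifs with h
  · have h0 : (x : E3) 0 = 0 := by nlinarith [sq_nonneg ((x : E3) 0), sq_nonneg ((x : E3) 1)]
    have h1 : (x : E3) 1 = 0 := by nlinarith [sq_nonneg ((x : E3) 0), sq_nonneg ((x : E3) 1)]
    apply ext3 <;> simp [invStereoVec, h, h0, h1]
  · have h' : 1 - (x : E3) 2 ≠ 0 := fun h0 => h (by linarith)
    have e : (x : E3) 0 * (x : E3) 0 + (x : E3) 1 * (x : E3) 1 +
      (1 - (x : E3) 2) * (1 - (x : E3) 2) = 2 * (1 - (x : E3) 2) := by linarith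
    apply ext3 <;>
      simp only [invStereoVec, Complex.normSq_apply, Complex.ofReal_re, Complex.ofReal_im,
        mul_zero, add_zero, PiLp.smul_apply, smul_eq_mul, Matrix.cons_val_zero, e,
        Matrix.cons_val_one, Matrix.cons_val, Complex.conj_ofReal, Complex.re_mul_ofReal,
        Complex.im_mul_ofReal]
    · field_simp
    · field_simp
    · field_simp; linarith

/-- The pair `homog` recovers homogeneous coordinates up to a nonzero factor. -/
lemma homog_invStereo {p q : ℂ} (h : ¬ (p = 0 ∧ q = 0)) :
    ∃ c : ℂ, c ≠ 0 ∧ (homog (invStereo p q)).1 = c * p ∧ (homog (invStereo p q)).2 = c * q := by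
  have hN := (normSq_add_pos h).ne'
  have e2 : (invStereoVec p q) 2 = (Complex.normSq p - Complex.normSq q) /
      (Complex.normSq p + Complex.normSq q) := by
    simp [invStereoVec]; field_simp
  unfold homog
  rw [invStereo_coe h]
  split_ifs with h1
  · rw [e2, div_eq_one_iff_eq hN] at h1
    have hq : q = 0 := by
      rw [← Complex.normSq_eq_zero]; linarith
    have hp : p ≠ 0 := fun hp => h ⟨hp, hq⟩
    exact ⟨p⁻¹, inv_ne_zero hp, by simp [hp], by simp [hq]⟩
  · have hq : q ≠ 0 := by
      rintro rfl
      apply h1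
      rw [e2]
      simp at hN ⊢
      exact hN
    refine ⟨(((2 * (Complex.normSq p + Complex.normSq q)⁻¹ : ℝ)) : ℂ) * starRingEnd ℂ q, ?_, ?_, ?_⟩
    · apply mul_ne_zero
      · simpa using by exact_mod_cast hN
      · simpa using hq
    · apply Complex.ext <;>
        simp only [invStereoVec, mul_assoc, Complex.re_ofReal_mul, Complex.im_ofReal_mul,
          PiLp.smul_apply, smul_eq_mul, Matrix.cons_val_zero, Matrix.cons_val_one,
          mul_comm (starRingEnd ℂ q) p] <;> ring
    · have : 1 - (invStereoVec p q) 2 = 2 * (Complex.normSq p + Complex.normSq q)⁻¹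
        * Complex.normSq q := by
        rw [e2]; field_simp; ring
      change ((1 - (invStereoVec p q) 2 : ℝ) : ℂ) = _
      rw [this, Complex.ofReal_mul, Complex.normSq_eq_conj_mul_self, mul_assoc]

lemma invStereo_eq_iff {p q α β : ℂ} (h : ¬ (p = 0 ∧ q = 0)) (h' : ¬ (α = 0 ∧ β = 0)) :
    invStereo p q = invStereo α β ↔ β * p = α * q := by
  constructor
  · intro e
    obtain ⟨c, hc, h1, h2⟩ := homog_invStereo h
    obtain ⟨d, hd, h3, h4⟩ := homog_invStereo h'
    rw [e] at h1 h2
    have e1 := h1.symm.trans h3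
    have e2 := h2.symm.trans h4
    have : c * d * (β * p) = c * d * (α * q) := by
      linear_combination (d * β) * e1 - d * α * e2
    exact mul_left_cancel₀ (mul_ne_zero hc hd) this
  · intro e
    by_cases hq : q = 0
    · have hp : p ≠ 0 := fun hp => h ⟨hp, hq⟩
      have hβ : β = 0 := by
        rw [hq, mul_zero] at e
        exact (mul_eq_zero.mp e).resolve_right hp
      have hα : α ≠ 0 := fun h => h' ⟨h, hβ⟩
      rw [← invStereo_smul (c := α / p) (div_ne_zero hα hp), hq, hβ]
      congr 1
      · field_simp
      · simp
    · have hβ : β ≠ 0 := by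
        rintro rfl
        rw [zero_mul] at e
        exact h' ⟨(mul_eq_zero.mp e.symm).resolve_right hq, rfl⟩
      rw [← invStereo_smul (c := β / q) (div_ne_zero hβ hq)]
      congr 1
      · field_simp; rw [e, mul_comm]
      · field_simp

/-- A conformal parametrization `τ` of an open part of the sphere by the complex plane, which, like
the inverse of the stereographic projection from the north pole, turns multiplication by `i` into
`-τ ×`. -/
structure ConfChart (τ : ℂ → S2) : Prop where
  smooth : ContDiff ℝ ∞ (fun z => (τ z : E3))
  conf : ∀ z v : ℂ, fderiv ℝ (fun z => (τ z : E3)) z (Complex.I * v) =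
    -cr (τ z) (fderiv ℝ (fun z => (τ z : E3)) z v)
  ne : ∀ z, fderiv ℝ (fun z => (τ z : E3)) z 1 ≠ 0

/-- The condition `HolAt` for a map of the plane to the sphere, with the sign convention
of `ConfChart`. -/
def Conf (s : ℝ) (g : ℂ → E3) (z : ℂ) : Prop :=
  ∀ v : ℂ, fderiv ℝ g z (Complex.I * v) = -(s • cr (g z) (fderiv ℝ g z v))

/-- The differential of a map with holomorphic homogeneous coordinates; only the Wronskian
`P' Q - P Q'` enters. -/
lemma hasFDerivAt_stereo_hol {P Q : ℂ → ℂ} {P' Q' z : ℂ} (hP : HasDerivAt P P' z)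
    (hQ : HasDerivAt Q Q' z) (h : ¬ (P z = 0 ∧ Q z = 0)) :
    ∃ L : ℂ →L[ℝ] E3, HasFDerivAt (fun y => invStereoVec (P y) (Q y)) L z ∧
      ∀ v, L v = stereoD (P z) (Q z) ((P' * Q z - P z * Q') * v) := by
  refine ⟨_, hasFDerivAt_invStereoVec hP.complexToReal_fderiv hQ.complexToReal_fderiv h, ?_⟩
  intro v
  simp only [ContinuousLinearMap.comp_apply]
  congr 1
  simp
  ring

lemma conf_stereo_hol {P Q : ℂ → ℂ} {P' Q' z : ℂ} (hP : HasDerivAt P P' z)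
    (hQ : HasDerivAt Q Q' z) (h : ¬ (P z = 0 ∧ Q z = 0)) :
    Conf 1 (fun y => invStereoVec (P y) (Q y)) z := by
  intro v
  obtain ⟨L, hL, hLv⟩ := hasFDerivAt_stereo_hol hP hQ h
  rw [hL.fderiv, hLv, hLv, one_smul, ← stereoD_I_mul h]
  congr 1
  ring

/-- The inverse of the stereographic projection. -/
def sig (z : ℂ) : S2 := invStereo z 1

/-- The chart `z ↦ 1 / z` around the north pole. -/
def sig' (z : ℂ) : S2 := invStereo 1 z

lemma sig_coe : (fun z => (sig z : E3)) = fun z => invStereoVec z 1 :=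
  funext fun z => invStereo_coe (by simp)

lemma sig'_coe : (fun z => (sig' z : E3)) = fun z => invStereoVec 1 z :=
  funext fun z => invStereo_coe (by simp)

lemma confChart_sig : ConfChart sig where
  smooth := by
    rw [sig_coe, contDiff_iff_contDiffAt]
    intro z
    exact contDiffAt_invStereoVec contDiffAt_id contDiffAt_const (by simp)
  conf z v := by
    have := conf_stereo_hol (hasDerivAt_id z) (hasDerivAt_const z (1 : ℂ)) (by simp) v
    rw [one_smul] at this
    rw [sig_coe, sig, invStereo_coe (by simp)]
    exact this
  ne z := by
    obtain ⟨L, hL, hLv⟩ := hasFDerivAt_stereo_hol (hasDerivAt_id z) (hasDerivAt_const z (1 : ℂ))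
      (by simp)
    rw [sig_coe]
    simp only [id] at hL
    rw [hL.fderiv, hLv, Ne, stereoD_eq_zero (by simp)]
    simp

lemma confChart_sig' : ConfChart sig' where
  smooth := by
    rw [sig'_coe, contDiff_iff_contDiffAt]
    intro z
    exact contDiffAt_invStereoVec contDiffAt_const contDiffAt_id (by simp)
  conf z v := by
    have := conf_stereo_hol (hasDerivAt_const z (1 : ℂ)) (hasDerivAt_id z) (by simp) v
    rw [one_smul] at this
    rw [sig'_coe, sig', invStereo_coe (by simp)]
    exact this
  ne z := by
    obtain ⟨L, hL, hLv⟩ := hasFDerivAt_stereo_hol (hasDerivAt_const z (1 : ℂ)) (hasDerivAt_id z)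
      (by simp)
    rw [sig'_coe]
    simp only [id] at hL
    rw [hL.fderiv, hLv, Ne, stereoD_eq_zero (by simp)]
    simp

/-- The north pole. -/
def north : S2 := sig' 0

/-- The stereographic parametrization misses only the north pole. -/
lemma sig_or_north (x : S2) : (∃ z, x = sig z) ∨ x = north := by
  have h := invStereo_homog x
  have hn := homog_ne x
  by_cases hw : (homog x).2 = 0
  · right
    have hz : (homog x).1 ≠ 0 := fun hz => hn ⟨hz, hw⟩
    rw [← h, north, sig', hw]
    have := invStereo_smul hz 1 0
    simpa using this
  · left
    refine ⟨(homog x).1 / (homog x).2, ?_⟩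
    conv_lhs => rw [← h]
    have := invStereo_smul hw ((homog x).1 / (homog x).2) 1
    rw [sig, ← this]
    congr 1
    · field_simp
    · simp

lemma sig_injective : Function.Injective sig := by
  intro z w h
  rw [sig, sig, invStereo_eq_iff (by simp) (by simp)] at h
  simpa using h

lemma sig_ne_north (z : ℂ) : sig z ≠ north := by
  rw [sig, north, sig', Ne, invStereo_eq_iff (by simp) (by simp)]
  simp

lemma sig'_eq_sig {z : ℂ} (hz : z ≠ 0) : sig' z = sig z⁻¹ := by
  rw [sig, sig', invStereo_eq_iff (by simp) (by simp)]
  simp [hz]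

namespace ConfChart

variable {τ : ℂ → S2}

lemma differentiableAt (h : ConfChart τ) (z : ℂ) :
    DifferentiableAt ℝ (fun z => (τ z : E3)) z :=
  (h.smooth.differentiable (by simp)) z

lemma continuous (h : ConfChart τ) : Continuous τ :=
  continuous_induced_rng.mpr h.smooth.continuous

/-- The tangent vectors of a chart are tangent to the sphere. -/
lemma perp (h : ConfChart τ) (z v : ℂ) :
    inner ℝ (τ z : E3) (fderiv ℝ (fun z => (τ z : E3)) z v) = 0 := by
  have h0 := (h.differentiableAt z).hasFDerivAt
  have h1 := h0.inner ℝ h0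
  have h2 : HasFDerivAt (fun z => inner ℝ (τ z : E3) (τ z : E3)) (0 : ℂ →L[ℝ] ℝ) z := by
    simp_rw [S2.inner_self]
    exact hasFDerivAt_const _ _
  have h3 := congrArg (fun L => L v) (h1.unique h2)
  simp at h3
  have h5 := real_inner_comm (τ z : E3) (fderiv ℝ (fun z => (τ z : E3)) z v)
  linarith

lemma fderiv_comp (h : ConfChart τ) {f : S2 → S2} {z : ℂ} (hf : SmoothAt f (τ z)) (v : ℂ) :
    fderiv ℝ (fun z => ext f (τ z)) z v =
      fderiv ℝ (ext f) (τ z) (fderiv ℝ (fun z => (τ z : E3)) z v) := by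
  have := hf.differentiableAt.hasFDerivAt.comp z (h.differentiableAt z).hasFDerivAt
  have e := this.fderiv
  simp only [Function.comp_def] at e
  rw [e]
  rfl

/-- Being holomorphic or antiholomorphic at a point can be read off in a conformal chart: the
tangent plane is spanned by the two coordinate vectors, and the radial derivative of `ext f`
vanishes. -/
lemma holAt_iff (h : ConfChart τ) {s : ℝ} {f : S2 → S2} {z : ℂ} (hf : SmoothAt f (τ z)) :
    HolAt s f (τ z) ↔ Conf s (fun z => ext f (τ z)) z := by
  constructor
  · intro hol v
    rw [h.fderiv_comp hf, h.fderiv_comp hf, h.conf, map_neg, hol]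
    simp only [ext_coe]
  · intro hc v
    set e := fderiv ℝ (fun z => (τ z : E3)) z 1 with he
    have hne : inner ℝ e e ≠ 0 := by
      rw [Ne, inner_self_eq_zero]; exact h.ne z
    have hc : ∀ v : ℂ, fderiv ℝ (fun z => ext f (τ z)) z (Complex.I * v) =
        -(s • cr (f (τ z)) (fderiv ℝ (fun z => ext f (τ z)) z v)) := by
      rw [← ext_coe]; exact hc
    have hcI := hc 1
    rw [h.fderiv_comp hf, h.fderiv_comp hf, h.conf, map_neg, neg_inj, ← he] at hcI
    have hcI2 := hc Complex.I
    have hx := S2.inner_self (τ z)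
    have hxe : inner ℝ (τ z : E3) e = 0 := h.perp z 1
    have eI : fderiv ℝ (fun z => (τ z : E3)) z Complex.I = -cr (τ z) e := by
      have := h.conf z 1; rwa [mul_one] at this
    rw [h.fderiv_comp hf, h.fderiv_comp hf, h.conf, eI] at hcI2
    simp only [map_neg, smul_neg, neg_neg] at hcI2
    have hexp := frame_expand hx hxe v
    have hr := fderiv_ext_radial hf.differentiableAt
    have : inner ℝ e e • fderiv ℝ (ext f) (τ z) (cr (τ z) v) =
        inner ℝ e e • s • cr (f (τ z)) (fderiv ℝ (ext f) (τ z) v) := by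
      have e1 := congrArg (fun w => fderiv ℝ (ext f) (τ z) (cr (τ z) w)) hexp
      have e2 := congrArg (fun w => cr (f (τ z)) (fderiv ℝ (ext f) (τ z) w)) hexp
      simp only [map_add, map_smul, cr_self, hr, smul_zero, zero_add] at e1 e2
      rw [smul_comm _ s, e1, e2, hcI, hcI2, smul_add, smul_comm s, smul_comm s]
      simp only [hcI, map_smul]
    exact smul_right_injective _ hne this

/-- A critical point of the coordinate expression is a critical point of the map. -/
lemma jac_eq_zero (h : ConfChart τ) {s : ℝ} {f : S2 → S2} {z : ℂ} (hf : SmoothAt f (τ z))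
    (hol : HolAt s f (τ z)) (h0 : fderiv ℝ (fun z => ext f (τ z)) z 1 = 0) : jac f (τ z) = 0 := by
  have h1 := inner_mul_jac hf hol (h.perp z 1)
  rw [← h.fderiv_comp hf, h0, inner_zero_left, mul_zero] at h1
  refine (mul_eq_zero.mp h1).resolve_left ?_
  rw [inner_self_eq_zero]
  exact h.ne z

end ConfChart

/-! ### Rational maps are holomorphic -/

section Rational

variable {n : ℕ}

lemma num_smul (a : Coeff n) (c z w : ℂ) : num a (c * z) (c * w) = c ^ n * num a z w := by
  unfold num
  rw [Finset.mul_sum]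
  refine Finset.sum_congr rfl fun i _ => ?_
  have : c ^ n = c ^ (i : ℕ) * c ^ (n - i : ℕ) := by
    rw [← pow_add]; congr 1; omega
  rw [this, mul_pow, mul_pow]; ring

lemma den_smul (a : Coeff n) (c z w : ℂ) : den a (c * z) (c * w) = c ^ n * den a z w := by
  unfold den
  rw [Finset.mul_sum]
  refine Finset.sum_congr rfl fun i _ => ?_
  have : c ^ n = c ^ (i : ℕ) * c ^ (n - i : ℕ) := by
    rw [← pow_add]; congr 1; omega
  rw [this, mul_pow, mul_pow]; ring

lemma num_one_zero (a : Coeff n) : num a 1 0 = a ⟨n, by omega⟩ := by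
  unfold num
  rw [Finset.sum_eq_single (Fin.last n)]
  · simp
  · intro i _ hi
    have : n - (i : ℕ) ≠ 0 := by
      have := Fin.val_lt_last hi; omega
    simp [this]
  · simp

lemma den_one_zero (a : Coeff n) : den a 1 0 = a ⟨2 * n + 1, by omega⟩ := by
  unfold den
  rw [Finset.sum_eq_single (Fin.last n)]
  · simp; congr 1; ext; simp; omega
  · intro i _ hi
    have : n - (i : ℕ) ≠ 0 := by
      have := Fin.val_lt_last hi; omega
    simp [this]
  · simp

/-- The condition `IsRat` in homogeneous form: no common zero in `ℂ²` other than the origin; the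
condition on the leading coefficients accounts for the point at infinity. -/
lemma IsRat.ne_zero {a : Coeff n} (h : IsRat a) {z w : ℂ} (hzw : ¬ (z = 0 ∧ w = 0)) :
    ¬ (num a z w = 0 ∧ den a z w = 0) := by
  by_cases hw : w = 0
  · have hz : z ≠ 0 := fun hz => hzw ⟨hz, hw⟩
    have h1 := num_smul a z 1 0
    have h2 := den_smul a z 1 0
    rw [mul_one, mul_zero] at h1 h2
    rw [hw, h1, h2, num_one_zero, den_one_zero]
    have := h.1
    have hz' := pow_ne_zero n hz
    simp only [mul_eq_zero, hz', false_or]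
    tauto
  · have h1 := num_smul a w (z / w) 1
    have h2 := den_smul a w (z / w) 1
    rw [mul_one, mul_div_cancel₀ _ hw] at h1 h2
    rw [h1, h2]
    have hz' := pow_ne_zero n hw
    simp only [mul_eq_zero, hz', false_or]
    exact h.2 _

lemma isRat_of_ne_zero {a : Coeff n}
    (h : ∀ z w : ℂ, ¬ (z = 0 ∧ w = 0) → ¬ (num a z w = 0 ∧ den a z w = 0)) : IsRat a := by
  refine ⟨?_, fun z => h z 1 (by simp)⟩
  have := h 1 0 (by simp)
  rw [num_one_zero, den_one_zero] at this
  tauto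

/-- The numerator as a polynomial in the affine coordinate. -/
def numPoly (a : Coeff n) : Polynomial ℂ :=
  ∑ i : Fin (n + 1), Polynomial.C (a ⟨i, by omega⟩) * Polynomial.X ^ (i : ℕ)

/-- The denominator as a polynomial in the affine coordinate. -/
def denPoly (a : Coeff n) : Polynomial ℂ :=
  ∑ i : Fin (n + 1), Polynomial.C (a ⟨n + 1 + i, by omega⟩) * Polynomial.X ^ (i : ℕ)

/-- The numerator as a polynomial in the coordinate at infinity. -/
def numPoly' (a : Coeff n) : Polynomial ℂ :=
  ∑ i : Fin (n + 1), Polynomial.C (a ⟨i, by omega⟩) * Polynomial.X ^ (n - i : ℕ)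

/-- The denominator as a polynomial in the coordinate at infinity. -/
def denPoly' (a : Coeff n) : Polynomial ℂ :=
  ∑ i : Fin (n + 1), Polynomial.C (a ⟨n + 1 + i, by omega⟩) * Polynomial.X ^ (n - i : ℕ)

lemma eval_numPoly (a : Coeff n) (z : ℂ) : (numPoly a).eval z = num a z 1 := by
  simp [numPoly, num, Polynomial.eval_finsetSum]

lemma eval_denPoly (a : Coeff n) (z : ℂ) : (denPoly a).eval z = den a z 1 := by
  simp [denPoly, den, Polynomial.eval_finsetSum]

lemma eval_numPoly' (a : Coeff n) (z : ℂ) : (numPoly' a).eval z = num a 1 z := by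
  simp [numPoly', num, Polynomial.eval_finsetSum]

lemma eval_denPoly' (a : Coeff n) (z : ℂ) : (denPoly' a).eval z = den a 1 z := by
  simp [denPoly', den, Polynomial.eval_finsetSum]

lemma coeff_sum_pow (c : Fin (n + 1) → ℂ) (j : Fin (n + 1)) :
    (∑ i : Fin (n + 1), Polynomial.C (c i) * Polynomial.X ^ (i : ℕ)).coeff j = c j := by
  simp [Polynomial.finsetSum_coeff, Polynomial.coeff_X_pow, Fin.val_inj]

lemma coeff_sum_pow' (c : Fin (n + 1) → ℂ) (j : Fin (n + 1)) :
    (∑ i : Fin (n + 1), Polynomial.C (c i) * Polynomial.X ^ (n - i : ℕ)).coeff (n - j : ℕ)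
      = c j := by
  simp only [Polynomial.finsetSum_coeff, Polynomial.coeff_C_mul_X_pow]
  rw [Finset.sum_eq_single j]
  · simp
  · intro i _ hi
    rw [if_neg]
    intro h
    apply hi
    ext
    omega
  · simp

lemma natDegree_sum_pow_le (c : Fin (n + 1) → ℂ) :
    (∑ i : Fin (n + 1), Polynomial.C (c i) * Polynomial.X ^ (i : ℕ)).natDegree ≤ n := by
  refine Polynomial.natDegree_sum_le_of_forall_le _ _ fun i _ => ?_
  exact (Polynomial.natDegree_C_mul_X_pow_le _ _).trans (by omega)

lemma ratMap_invStereo (a : Coeff n) {z w : ℂ} (hzw : ¬ (z = 0 ∧ w = 0)) :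
    ratMap a (invStereo z w) = invStereo (num a z w) (den a z w) := by
  obtain ⟨c, hc, h1, h2⟩ := homog_invStereo hzw
  rw [ratMap, h1, h2, num_smul, den_smul, invStereo_smul (pow_ne_zero n hc)]

lemma contDiff_num (a : Coeff n) {m : WithTop ℕ∞} :
    ContDiff ℝ m (fun p : ℂ × ℂ => num a p.1 p.2) := by
  unfold num
  fun_prop

lemma contDiff_den (a : Coeff n) {m : WithTop ℕ∞} :
    ContDiff ℝ m (fun p : ℂ × ℂ => den a p.1 p.2) := by
  unfold den
  fun_prop

/-- Homogeneous coordinates of `y / ‖y‖` that depend smoothly on `y` away from the positive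
half-axis through the north pole. -/
lemma toS2_eq_invStereo {y : E3} (hy : y ≠ 0) (h : y 2 ≠ ‖y‖) :
    toS2 y hy = invStereo ⟨y 0, y 1⟩ ((‖y‖ - y 2 : ℝ) : ℂ) := by
  have hn : ‖y‖ ≠ 0 := norm_ne_zero_iff.mpr hy
  have hs : ‖y‖ - y 2 ≠ 0 := sub_ne_zero.mpr (Ne.symm h)
  have hsq : y 0 * y 0 + y 1 * y 1 + y 2 * y 2 = ‖y‖ ^ 2 := by
    rw [← inner_coord, norm_sq_inner]
  apply Subtype.ext
  rw [invStereo_coe (by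
    intro h0
    exact hs (by exact_mod_cast h0.2))]
  have e : y 0 * y 0 + y 1 * y 1 + (‖y‖ - y 2) * (‖y‖ - y 2) = 2 * ‖y‖ * (‖y‖ - y 2) := by
    linear_combination hsq
  apply ext3 <;>
    simp only [toS2, invStereoVec, Complex.normSq_apply, Complex.ofReal_re, Complex.ofReal_im,
      mul_zero, add_zero, PiLp.smul_apply, smul_eq_mul, Matrix.cons_val_zero, e,
      Matrix.cons_val_one, Matrix.cons_val, Complex.conj_ofReal, Complex.re_mul_ofReal,
      Complex.im_mul_ofReal]
  · field_simp
  · field_simp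
  · field_simp; linear_combination -hsq

/-- Homogeneous coordinates of `y / ‖y‖` that depend smoothly on `y` away from the negative
half-axis through the south pole. -/
lemma toS2_eq_invStereo' {y : E3} (hy : y ≠ 0) (h : y 2 ≠ -‖y‖) :
    toS2 y hy = invStereo ((‖y‖ + y 2 : ℝ) : ℂ) ⟨y 0, -y 1⟩ := by
  have hn : ‖y‖ ≠ 0 := norm_ne_zero_iff.mpr hy
  have hs : ‖y‖ + y 2 ≠ 0 := fun h0 => h (by linarith)
  have hsq : y 0 * y 0 + y 1 * y 1 + y 2 * y 2 = ‖y‖ ^ 2 := by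
    rw [← inner_coord, norm_sq_inner]
  apply Subtype.ext
  rw [invStereo_coe (by
    intro h0
    exact hs (by exact_mod_cast h0.1))]
  have e : (‖y‖ + y 2) * (‖y‖ + y 2) + (y 0 * y 0 + y 1 * y 1) = 2 * ‖y‖ * (‖y‖ + y 2) := by
    linear_combination hsq
  apply ext3 <;>
    simp only [toS2, invStereoVec, Complex.normSq_apply, Complex.ofReal_re, Complex.ofReal_im,
      mul_zero, add_zero, PiLp.smul_apply, smul_eq_mul, Matrix.cons_val_zero, e,
      Matrix.cons_val_one, Matrix.cons_val, Complex.re_ofReal_mul, neg_mul_neg,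
      Complex.im_ofReal_mul, Complex.conj_re, Complex.conj_im, neg_neg]
  · field_simp
  · field_simp
  · field_simp; linear_combination hsq

lemma contDiffAt_complex_mk {f g : E3 → ℝ} {y : E3} {m : WithTop ℕ∞} (hf : ContDiffAt ℝ m f y)
    (hg : ContDiffAt ℝ m g y) : ContDiffAt ℝ m (fun y => (⟨f y, g y⟩ : ℂ)) y :=
  (Complex.equivRealProdCLM.symm.contDiff.contDiffAt).comp y (hf.prodMk hg)

/-- Rational maps are smooth. The coordinates `homog` jump at the north pole, so that there the ones
of `toS2_eq_invStereo'` are used. -/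
lemma smoothAt_ratMap {a : Coeff n} (h : IsRat a) (x : S2) : SmoothAt (ratMap a) x := by
  have hx0 := S2.ne_zero x
  have hc : ∀ i : Fin 3, ContDiffAt ℝ ∞ (fun y : E3 => y i) (x : E3) := fun i => by fun_prop
  have hn : ContDiffAt ℝ ∞ (fun y : E3 => ‖y‖) (x : E3) := contDiffAt_norm ℝ hx0
  have hcont : ContinuousAt (fun y : E3 => y 2) (x : E3) := (hc 2).continuousAt
  have hR : ∀ {g : E3 → ℝ}, ContDiffAt ℝ ∞ g (x : E3) →
      ContDiffAt ℝ ∞ (fun y => (g y : ℂ)) (x : E3) := fun hg =>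
    Complex.ofRealCLM.contDiff.contDiffAt.comp _ hg
  have hx1 : ‖(x : E3)‖ = 1 := norm_eq_of_mem_sphere x
  by_cases h2 : (x : E3) 2 = ‖(x : E3)‖
  · have h3 : (x : E3) 2 ≠ -‖(x : E3)‖ := by rw [h2, hx1]; norm_num
    have hev : ext (ratMap a) =ᶠ[𝓝 (x : E3)] fun y =>
        invStereoVec (num a ((‖y‖ + y 2 : ℝ) : ℂ) ⟨y 0, -y 1⟩)
          (den a ((‖y‖ + y 2 : ℝ) : ℂ) ⟨y 0, -y 1⟩) := by
      filter_upwards [isOpen_ne.mem_nhds hx0, hcont.ne_iff_eventually_ne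
        hn.continuousAt.neg |>.mp h3] with y hy hy2
      have hne : ¬ (((‖y‖ + y 2 : ℝ) : ℂ) = 0 ∧ (⟨y 0, -y 1⟩ : ℂ) = 0) := by
        intro h0
        have : ‖y‖ + y 2 = 0 := by exact_mod_cast h0.1
        exact hy2 (eq_neg_of_add_eq_zero_right this)
      rw [ext_eq_toS2 _ y hy, toS2_eq_invStereo' hy hy2, ratMap_invStereo a hne,
        invStereo_coe (h.ne_zero hne)]
    have hne : ¬ (((‖(x : E3)‖ + (x : E3) 2 : ℝ) : ℂ) = 0 ∧
        (⟨(x : E3) 0, -(x : E3) 1⟩ : ℂ) = 0) := by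
      intro h0
      have : ‖(x : E3)‖ + (x : E3) 2 = 0 := by exact_mod_cast h0.1
      exact h3 (by linarith)
    have hp := (hR (hn.add (hc 2))).prodMk (contDiffAt_complex_mk (hc 0) (hc 1).neg)
    exact (contDiffAt_invStereoVec ((contDiff_num a).contDiffAt.comp _ hp)
      ((contDiff_den a).contDiffAt.comp _ hp) (h.ne_zero hne)).congr_of_eventuallyEq hev
  · have hev : ext (ratMap a) =ᶠ[𝓝 (x : E3)] fun y =>
        invStereoVec (num a ⟨y 0, y 1⟩ ((‖y‖ - y 2 : ℝ) : ℂ))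
          (den a ⟨y 0, y 1⟩ ((‖y‖ - y 2 : ℝ) : ℂ)) := by
      filter_upwards [isOpen_ne.mem_nhds hx0, hcont.ne_iff_eventually_ne
        hn.continuousAt |>.mp h2] with y hy hy2
      have hne : ¬ ((⟨y 0, y 1⟩ : ℂ) = 0 ∧ ((‖y‖ - y 2 : ℝ) : ℂ) = 0) := by
        intro h0
        have : ‖y‖ - y 2 = 0 := by exact_mod_cast h0.2
        exact hy2 (by linarith)
      rw [ext_eq_toS2 _ y hy, toS2_eq_invStereo hy hy2, ratMap_invStereo a hne,
        invStereo_coe (h.ne_zero hne)]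
    have hne : ¬ ((⟨(x : E3) 0, (x : E3) 1⟩ : ℂ) = 0 ∧
        ((‖(x : E3)‖ - (x : E3) 2 : ℝ) : ℂ) = 0) := by
      intro h0
      have : ‖(x : E3)‖ - (x : E3) 2 = 0 := by exact_mod_cast h0.2
      exact h2 (by linarith)
    have hp := (contDiffAt_complex_mk (hc 0) (hc 1)).prodMk (hR (hn.sub (hc 2)))
    exact (contDiffAt_invStereoVec ((contDiff_num a).contDiffAt.comp _ hp)
      ((contDiff_den a).contDiffAt.comp _ hp) (h.ne_zero hne)).congr_of_eventuallyEq hev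

lemma ext_ratMap_sig {a : Coeff n} (h : IsRat a) :
    (fun z => ext (ratMap a) (sig z)) =
      fun z => invStereoVec ((numPoly a).eval z) ((denPoly a).eval z) := by
  funext z
  rw [ext_coe, sig, ratMap_invStereo a (by simp), invStereo_coe (h.ne_zero (by simp)),
    eval_numPoly, eval_denPoly]

lemma ext_ratMap_sig' {a : Coeff n} (h : IsRat a) :
    (fun z => ext (ratMap a) (sig' z)) =
      fun z => invStereoVec ((numPoly' a).eval z) ((denPoly' a).eval z) := by
  funext z
  rw [ext_coe, sig', ratMap_invStereo a (by simp), invStereo_coe (h.ne_zero (by simp)),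
    eval_numPoly', eval_denPoly']

/-- Rational maps are holomorphic, in the chart `sig` and at the north pole in the chart `sig'`. -/
lemma holAt_ratMap {a : Coeff n} (h : IsRat a) (x : S2) : HolAt 1 (ratMap a) x := by
  rcases sig_or_north x with ⟨z, rfl⟩ | rfl
  · rw [confChart_sig.holAt_iff (smoothAt_ratMap h _), ext_ratMap_sig h]
    refine conf_stereo_hol (Polynomial.hasDerivAt _ _) (Polynomial.hasDerivAt _ _) ?_
    rw [eval_numPoly, eval_denPoly]
    exact h.ne_zero (by simp)
  · rw [north, confChart_sig'.holAt_iff (smoothAt_ratMap h _), ext_ratMap_sig' h]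
    refine conf_stereo_hol (Polynomial.hasDerivAt _ _) (Polynomial.hasDerivAt _ _) ?_
    rw [eval_numPoly', eval_denPoly']
    exact h.ne_zero (by simp)

lemma isHarmonic_ratMap {a : Coeff n} (h : IsRat a) : IsHarmonic (ratMap a) :=
  harmonicAt_of_holAt (smoothAt_ratMap h) (holAt_ratMap h)

/-! ### The degree of a rational map -/

/-- At a multiple root of `β P - α Q` the Jacobian of `P / Q` vanishes. -/
lemma jac_eq_zero_of_double_root {f : S2 → S2} {τ : ℂ → S2} (hτ : ConfChart τ)
    {P Q : Polynomial ℂ} {z α β : ℂ} (hf : SmoothAt f (τ z)) (hol : HolAt 1 f (τ z))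
    (he : (fun z => ext f (τ z)) = fun z => invStereoVec (P.eval z) (Q.eval z))
    (hPQ : ¬ (P.eval z = 0 ∧ Q.eval z = 0)) (hαβ : ¬ (α = 0 ∧ β = 0))
    (h0 : β * P.eval z = α * Q.eval z)
    (h1 : β * P.derivative.eval z = α * Q.derivative.eval z) : jac f (τ z) = 0 := by
  refine hτ.jac_eq_zero hf hol ?_
  obtain ⟨L, hL, hLv⟩ := hasFDerivAt_stereo_hol (P.hasDerivAt z) (Q.hasDerivAt z) hPQ
  rw [he, hL.fderiv, hLv]
  have : P.derivative.eval z * Q.eval z - P.eval z * Q.derivative.eval z = 0 := by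
    by_cases hα : α = 0
    · have hβ : β ≠ 0 := fun h => hαβ ⟨hα, h⟩
      apply mul_left_cancel₀ hβ
      linear_combination Q.eval z * h1 - Q.derivative.eval z * h0
    · apply mul_left_cancel₀ hα
      linear_combination P.derivative.eval z * (-h0) + P.eval z * h1
  rw [this]
  simp

/-- If the Jacobian is nonnegative, the signed count over a regular value is the number of
preimages. -/
lemma finsum_sign_of_nonneg {f : S2 → S2} {y : S2} (hreg : ∀ x, f x = y → jac f x ≠ 0)
    (hpos : ∀ x, 0 ≤ jac f x) (hfin : {x | f x = y}.Finite) :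
    ∑ᶠ x ∈ {x : S2 | f x = y}, ((SignType.sign (jac f x) : SignType) : ℤ) =
      ({x | f x = y}.ncard : ℤ) := by
  rw [finsum_mem_congr rfl (g := fun _ => (1 : ℤ))]
  · rw [finsum_mem_eq_finite_toFinset_sum _ hfin, Set.ncard_eq_toFinset_card _ hfin]
    simp
  · intro x hx
    have : 0 < jac f x := lt_of_le_of_ne (hpos x) (Ne.symm (hreg x hx))
    simp [sign_pos this]

/-- The topological degree of a rational map is `n`: the finite preimages of a regular value with
homogeneous coordinates `(α, β)` are the roots of `β P - α Q`, which are simple, and the north pole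
is a preimage exactly when the degree of this polynomial drops. -/
lemma hasDegree_ratMap {a : Coeff n} (h : IsRat a) : HasDegree (ratMap a) n := by
  refine ⟨smoothAt_ratMap h, fun y hreg => ?_⟩
  have hpos : ∀ x, 0 ≤ jac (ratMap a) x := fun x => by
    rw [(holAt_ratMap h x).jac_eq (by norm_num) (smoothAt_ratMap h x)]
    have := normSqDeriv_nonneg (ratMap a) x
    linarith
  set α := (homog y).1 with hα
  set β := (homog y).2 with hβ
  have hαβ : ¬ (α = 0 ∧ β = 0) := homog_ne y
  have hy : invStereo α β = y := invStereo_homog y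
  set H : Polynomial ℂ := Polynomial.C β * numPoly a - Polynomial.C α * denPoly a with hH
  have hHsum : H = ∑ i : Fin (n + 1), Polynomial.C
      (β * a ⟨i, by omega⟩ - α * a ⟨n + 1 + i, by omega⟩) * Polynomial.X ^ (i : ℕ) := by
    rw [hH, numPoly, denPoly, Finset.mul_sum, Finset.mul_sum, ← Finset.sum_sub_distrib]
    refine Finset.sum_congr rfl fun i _ => ?_
    simp only [map_sub, map_mul]; ring
  have hdeg : H.natDegree ≤ n := by rw [hHsum]; exact natDegree_sum_pow_le _
  have hmem : ∀ z, ratMap a (sig z) = y ↔ H.IsRoot z := by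
    intro z
    rw [sig, ratMap_invStereo a (by simp), ← hy, invStereo_eq_iff (h.ne_zero (by simp)) hαβ,
      Polynomial.IsRoot, hH]
    simp [eval_numPoly, eval_denPoly, sub_eq_zero]
  have hsimple : ∀ z, H.IsRoot z → ¬ H.derivative.IsRoot z := by
    intro z hz hz'
    refine hreg (sig z) ((hmem z).mpr hz) ?_
    refine jac_eq_zero_of_double_root confChart_sig (smoothAt_ratMap h _) (holAt_ratMap h _)
      (ext_ratMap_sig h) ?_ hαβ ?_ ?_
    · rw [eval_numPoly, eval_denPoly]; exact h.ne_zero (by simp)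
    · simpa [hH, sub_eq_zero] using hz
    · simpa [hH, sub_eq_zero] using hz'
  have hH0 : H ≠ 0 := by
    intro h0
    exact hsimple 0 (by simp [h0]) (by simp [h0])
  have hnodup : H.roots.Nodup := by
    rw [Multiset.nodup_iff_count_le_one]
    intro z
    rw [Polynomial.count_roots]
    by_contra hlt
    push Not at hlt
    have := (Polynomial.one_lt_rootMultiplicity_iff_isRoot hH0).mp hlt
    exact hsimple z this.1 this.2
  have hcard : H.roots.toFinset.card = H.natDegree := by
    rw [Multiset.toFinset_card_of_nodup hnodup]
    exact IsAlgClosed.card_roots_eq_natDegree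
  have hnorth : ratMap a north = y ↔ H.coeff n = 0 := by
    have e := coeff_sum_pow (n := n)
      (fun i => β * a ⟨i, by omega⟩ - α * a ⟨n + 1 + i, by omega⟩) (Fin.last n)
    rw [← hHsum] at e
    rw [north, sig', ratMap_invStereo a (by simp), ← hy, invStereo_eq_iff (h.ne_zero (by simp)) hαβ,
      num_one_zero, den_one_zero]
    have e' : H.coeff n = β * a ⟨n, by omega⟩ - α * a ⟨2 * n + 1, by omega⟩ := by
      have i1 : (⟨n + 1 + (Fin.last n : ℕ), by simp; omega⟩ : Fin (2 * n + 1 + 1)) =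
          ⟨2 * n + 1, by omega⟩ := by ext; simp; omega
      refine Eq.trans e ?_
      rw [← i1]
      rfl
    rw [e', sub_eq_zero]
  have himg : (sig '' (H.roots.toFinset : Set ℂ)).ncard = H.natDegree := by
    rw [Set.ncard_image_of_injective _ sig_injective, Set.ncard_coe_finset, hcard]
  by_cases hn : H.coeff n = 0
  · -- the north pole is a preimage, and the degree of the polynomial drops exactly by one
    have hlt : H.natDegree < n := by
      refine lt_of_le_of_ne hdeg fun he => ?_
      rw [← he, Polynomial.coeff_natDegree, Polynomial.leadingCoeff_eq_zero] at hn
      exact hH0 hn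
    have hjn := hreg north (hnorth.mpr hn)
    have hn1 : H.coeff (n - 1) ≠ 0 := by
      intro hc
      apply hjn
      have e1 := coeff_sum_pow (n := n)
        (fun i => β * a ⟨i, by omega⟩ - α * a ⟨n + 1 + i, by omega⟩) ⟨n - 1, by omega⟩
      have e2 := coeff_sum_pow' (n := n)
        (fun i => β * a ⟨i, by omega⟩ - α * a ⟨n + 1 + i, by omega⟩) ⟨n - 1, by omega⟩
      have e3 := coeff_sum_pow' (n := n)
        (fun i => β * a ⟨i, by omega⟩ - α * a ⟨n + 1 + i, by omega⟩) (Fin.last n)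
      have e4 := coeff_sum_pow (n := n)
        (fun i => β * a ⟨i, by omega⟩ - α * a ⟨n + 1 + i, by omega⟩) (Fin.last n)
      have hH'sum : Polynomial.C β * numPoly' a - Polynomial.C α * denPoly' a =
          ∑ i : Fin (n + 1), Polynomial.C
            (β * a ⟨i, by omega⟩ - α * a ⟨n + 1 + i, by omega⟩) *
              Polynomial.X ^ (n - i : ℕ) := by
        rw [numPoly', denPoly', Finset.mul_sum, Finset.mul_sum, ← Finset.sum_sub_distrib]
        refine Finset.sum_congr rfl fun i _ => ?_
        simp only [map_sub, map_mul]; ring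
      rw [← hHsum] at e1 e4
      rw [← hH'sum] at e2 e3
      simp only [Fin.val_last, tsub_self] at e3 e4
      have hs : n - (n - 1) = 1 := by omega
      simp only [hs] at e2
      rw [hc] at e1
      rw [hn] at e4
      rw [← e1] at e2
      rw [← e4, Polynomial.coeff_zero_eq_eval_zero] at e3
      have e5 : (Polynomial.derivative (Polynomial.C β * numPoly' a
          - Polynomial.C α * denPoly' a)).eval 0 = 0 := by
        rw [← Polynomial.coeff_zero_eq_eval_zero, Polynomial.coeff_derivative]
        simp only [zero_add]
        rw [e2]; simp
      refine jac_eq_zero_of_double_root confChart_sig' (smoothAt_ratMap h _) (holAt_ratMap h _)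
        (ext_ratMap_sig' h) ?_ hαβ ?_ ?_
      · rw [eval_numPoly', eval_denPoly']; exact h.ne_zero (by simp)
      · simpa [sub_eq_zero] using e3
      · simpa [sub_eq_zero] using e5
    have hnd : H.natDegree + 1 = n := by
      have := Polynomial.le_natDegree_of_ne_zero hn1
      omega
    have hS : {x | ratMap a x = y} = insert north (sig '' (H.roots.toFinset : Set ℂ)) := by
      ext x
      rcases sig_or_north x with ⟨z, rfl⟩ | rfl
      · simp [hmem, sig_ne_north, sig_injective.eq_iff, hH0]
      · simp [hnorth, hn]
    have hnm : north ∉ sig '' (H.roots.toFinset : Set ℂ) := by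
      rintro ⟨z, -, hz⟩
      exact sig_ne_north z hz
    have hfin : (sig '' (H.roots.toFinset : Set ℂ)).Finite := (Finset.finite_toSet _).image _
    rw [finsum_sign_of_nonneg hreg hpos (by rw [hS]; exact hfin.insert _), hS,
      Set.ncard_insert_of_notMem hnm hfin, himg, hnd]
  · have hnd : H.natDegree = n := le_antisymm hdeg (Polynomial.le_natDegree_of_ne_zero hn)
    have hS : {x | ratMap a x = y} = sig '' (H.roots.toFinset : Set ℂ) := by
      ext x
      rcases sig_or_north x with ⟨z, rfl⟩ | rfl
      · simp [hmem, sig_injective.eq_iff, hH0]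
      · simp [hnorth, hn, sig_ne_north]
    have hfin : (sig '' (H.roots.toFinset : Set ℂ)).Finite := (Finset.finite_toSet _).image _
    rw [finsum_sign_of_nonneg hreg hpos (by rw [hS]; exact hfin), hS, himg, hnd]

end Rational

/-! ### Regular values and uniqueness of the degree -/

/-- The differential of the homogeneous extension `y ↦ ‖y‖ f (y / ‖y‖)` along a ray is the
endomorphism whose determinant defines `jac f`. -/
lemma hasFDerivAt_norm_smul_ext {f : S2 → S2} {x : S2} (hf : SmoothAt f x) {t : ℝ} (ht : 0 < t) :
    HasFDerivAt (fun y => ‖y‖ • ext f y) ((fderiv ℝ (ext f) (x : E3)) +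
      (innerSL ℝ (x : E3)).smulRight ((f x : S2) : E3)) (t • (x : E3)) := by
  have hx1 : ‖(x : E3)‖ = 1 := norm_eq_of_mem_sphere x
  have hn : HasFDerivAt (fun y : E3 => ‖y‖) (innerSL ℝ (x : E3)) (x : E3) := by
    have hd : DifferentiableAt ℝ (fun y : E3 => ‖y‖) (x : E3) :=
      (contDiffAt_norm ℝ (S2.ne_zero x)).differentiableAt one_ne_zero
    refine hd.hasFDerivAt.congr_fderiv ?_
    have h1 := hd.hasFDerivAt.pow 2
    have h3 : HasFDerivAt (fun y : E3 => ‖y‖ ^ 2) (2 • innerSL ℝ (x : E3)) (x : E3) :=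
      (hasStrictFDerivAt_norm_sq (x : E3)).hasFDerivAt
    ext w
    have h4 := congrArg (fun L => L w) (h1.unique h3)
    simpa [hx1] using h4
  have h1 := hn.smul hf.differentiableAt.hasFDerivAt
  rw [hx1, one_smul, ext_coe] at h1
  -- the function is positively homogeneous of degree one
  have h2 : (fun y => ‖y‖ • ext f y) = fun y => t • (fun y => ‖y‖ • ext f y) (t⁻¹ • y) := by
    funext y
    simp only [ext_smul f (inv_pos.mpr ht), norm_smul, smul_smul, norm_inv, Real.norm_eq_abs,
      abs_of_pos ht]
    rw [← mul_assoc, mul_inv_cancel₀ ht.ne', one_mul]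
  rw [h2]
  have h3 : HasFDerivAt (fun y : E3 => t⁻¹ • y) (t⁻¹ • ContinuousLinearMap.id ℝ E3)
      (t • (x : E3)) := (hasFDerivAt_id _).const_smul t⁻¹
  have h1' : HasFDerivAt (fun y => ‖y‖ • ext f y) ((fderiv ℝ (ext f) (x : E3)) +
      (innerSL ℝ (x : E3)).smulRight ((f x : S2) : E3)) (t⁻¹ • t • (x : E3)) := by
    rw [inv_smul_smul₀ ht.ne']; exact h1
  have h4 := (h1'.comp (t • (x : E3)) h3).const_smul t
  refine h4.congr_fderiv ?_
  ext1 v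
  simp [smul_smul, ht.ne']

/-- A smooth map of the sphere has a regular value, by Sard's theorem for the homogeneous map
`y ↦ ‖y‖ f (y / ‖y‖)` of `ℝ³`, whose Jacobian determinant is that of `f`. -/
lemma exists_regular_value {f : S2 → S2} (hf : ∀ x, SmoothAt f x) :
    ∃ y, ∀ x, f x = y → jac f x ≠ 0 := by
  by_contra hcon
  push Not at hcon
  set K : Set E3 := {y | ∃ (t : ℝ) (x : S2), 0 < t ∧ jac f x = 0 ∧ y = t • (x : E3)} with hK
  have hsec : ∀ y : E3, ∃ x : S2, y ∈ K → jac f x = 0 ∧ ∃ t : ℝ, 0 < t ∧ y = t • (x : E3) := by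
    intro y
    by_cases hy : y ∈ K
    · obtain ⟨t, x, ht, hj, e⟩ := hy
      exact ⟨x, fun _ => ⟨hj, t, ht, e⟩⟩
    · exact ⟨north, fun h => absurd h hy⟩
  choose X hX using hsec
  have h0 := addHaar_image_eq_zero_of_det_fderivWithin_eq_zero (volume : Measure E3)
    (f := fun y => ‖y‖ • ext f y) (s := K)
    (f' := fun y => (fderiv ℝ (ext f) (X y : E3)) +
      (innerSL ℝ (X y : E3)).smulRight ((f (X y) : S2) : E3))
    (by
      intro y hy
      obtain ⟨-, t, ht, e⟩ := hX y hy
      have := hasFDerivAt_norm_smul_ext (hf (X y)) ht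
      rw [← e] at this
      exact this.hasFDerivWithinAt)
    (fun y hy => (hX y hy).1)
  have hsub : (univ : Set E3) ⊆ insert 0 ((fun y => ‖y‖ • ext f y) '' K) := by
    intro w _
    by_cases hw : w = 0
    · exact Or.inl hw
    · right
      obtain ⟨x, hx, hj⟩ := hcon (toS2 w hw)
      have hpos : 0 < ‖w‖ := norm_pos_iff.mpr hw
      refine ⟨‖w‖ • (x : E3), ⟨‖w‖, x, hpos, hj, rfl⟩, ?_⟩
      simp only [norm_smul, norm_norm, norm_eq_of_mem_sphere, mul_one, ext_smul f hpos, ext_coe, hx]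
      exact (eq_norm_smul_toS2 w hw).symm
  have h1 : (volume : Measure E3) univ ≤ 0 := by
    refine (measure_mono hsub).trans ?_
    rw [insert_eq]
    refine (measure_union_le _ _).trans ?_
    rw [h0]; simp
  have h2 := isOpen_univ.measure_pos (volume : Measure E3) univ_nonempty
  exact absurd h1 (not_le.mpr h2)

/-- The degree is well defined, because a regular value exists. -/
lemma HasDegree.unique {f : S2 → S2} {d d' : ℤ} (h : HasDegree f d) (h' : HasDegree f d') :
    d = d' := by
  obtain ⟨y, hy⟩ := exists_regular_value h.1
  exact (h.2 y hy).symm.trans (h'.2 y hy)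

/-- A value which is not attained is regular, and computes the degree as zero. -/
lemma HasDegree.surjective {f : S2 → S2} {d : ℤ} (h : HasDegree f d) (hd : d ≠ 0) :
    Function.Surjective f := by
  intro y
  by_contra hcon
  push Not at hcon
  apply hd
  rw [← h.2 y fun x hx => absurd hx (hcon x)]
  have : {x | f x = y} = ∅ := by ext x; simp [hcon x]
  rw [this, finsum_mem_empty]

/-- An antiholomorphic map does not have positive degree. -/
lemma HasDegree.nonpos_of_antiholomorphic {f : S2 → S2} {d : ℤ} (h : HasDegree f d)
    (hol : ∀ x, HolAt (-1) f x) : d ≤ 0 := by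
  obtain ⟨y, hy⟩ := exists_regular_value h.1
  rw [← h.2 y hy]
  refine finsum_mem_induction (fun k : ℤ => k ≤ 0) le_rfl (fun _ _ => add_nonpos) fun x hx => ?_
  have : jac f x ≤ 0 := by
    rw [(hol x).jac_eq (by norm_num) (h.1 x)]
    have := normSqDeriv_nonneg f x
    linarith
  rcases this.lt_or_eq with h1 | h1
  · simp [sign_neg h1]
  · exact absurd h1 (hy x hx)

/-! ### The Hopf differential of a harmonic map -/

lemma fderiv_apply_const {E G : Type*} [NormedAddCommGroup E] [NormedSpace ℝ E]
    [NormedAddCommGroup G] [NormedSpace ℝ G] {F : E → G} {x : E} (h : ContDiffAt ℝ 2 F x) (v : E) :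
    HasFDerivAt (fun y => fderiv ℝ F y v) ((fderiv ℝ (fderiv ℝ F) x).flip v) x := by
  have := (hasFDerivAt_fderiv h).clm_apply (hasFDerivAt_const v x)
  refine this.congr_fderiv ?_
  ext1 w
  simp

/-- By linearity, it suffices to check the condition `Conf` on the vector `1`. -/
lemma conf_of_one {s : ℝ} (hs : s * s = 1) {g : ℂ → E3} {z : ℂ} (hg : inner ℝ (g z) (g z) = 1)
    (hp : inner ℝ (g z) (fderiv ℝ g z 1) = 0)
    (h : fderiv ℝ g z Complex.I = -(s • cr (g z) (fderiv ℝ g z 1))) : Conf s g z := by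
  intro v
  have hv : v = v.re • (1 : ℂ) + v.im • Complex.I := by
    apply Complex.ext <;> simp
  have hIv : Complex.I * v = v.re • Complex.I - v.im • (1 : ℂ) := by
    apply Complex.ext <;> simp
  have hcc := cr_cr_of_perp hg hp
  rw [hIv]
  conv_rhs => rw [hv]
  simp only [map_add, map_sub, map_smul, h, map_neg, hcc, smul_add, smul_neg, neg_neg, neg_add]
  rw [smul_comm s v.re, smul_comm s v.im, smul_smul s s, hs, one_smul]
  abel

namespace ConfChart

variable {τ : ℂ → S2}

/-- A conformal parametrization of the sphere is harmonic: its Laplacian is radial. -/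
lemma laplacian (h : ConfChart τ) (z : ℂ) :
    fderiv ℝ (fderiv ℝ (fun z => (τ z : E3))) z 1 1 +
      fderiv ℝ (fderiv ℝ (fun z => (τ z : E3))) z Complex.I Complex.I =
    (-2 * inner ℝ (fderiv ℝ (fun z => (τ z : E3)) z 1) (fderiv ℝ (fun z => (τ z : E3)) z 1)) •
      (τ z : E3) := by
  set t : ℂ → E3 := fun z => (τ z : E3) with ht
  have h2 : ContDiffAt ℝ 2 t z := (h.smooth.of_le (by norm_cast)).contDiffAt
  have hcr : ∀ v : ℂ, HasFDerivAt (fun y => cr (t y) (fderiv ℝ t y v)) _ z := fun v =>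
    ((cr.hasFDerivAt (x := t z)).comp z (h.differentiableAt z).hasFDerivAt).clm_apply
      (fderiv_apply_const h2 v)
  have c1 : (fun y => fderiv ℝ t y Complex.I) = fun y => -cr (t y) (fderiv ℝ t y 1) := by
    funext y; simpa using h.conf y 1
  have c2 : (fun y => fderiv ℝ t y 1) = fun y => cr (t y) (fderiv ℝ t y Complex.I) := by
    funext y
    have := h.conf y Complex.I
    rw [Complex.I_mul_I, map_neg, neg_inj] at this
    exact this
  have d1 := fderiv_apply_const h2 Complex.I
  rw [c1] at d1
  have e1 := congrArg (fun L => L Complex.I) (d1.unique (hcr 1).neg)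
  have d2 := fderiv_apply_const h2 1
  rw [c2] at d2
  have e2 := congrArg (fun L => L 1) (d2.unique (hcr Complex.I))
  simp at e1 e2
  have sym := fderiv_fderiv_symm h2 1 Complex.I
  have cI : fderiv ℝ t z Complex.I = -cr (t z) (fderiv ℝ t z 1) := congrFun c1 z
  rw [sym] at e2
  have hp : inner ℝ (fderiv ℝ t z 1) (t z) = 0 := by
    rw [real_inner_comm]; exact h.perp z 1
  rw [e1, e2]
  have hsw : cr (fderiv ℝ t z Complex.I) (fderiv ℝ t z 1) =
      -cr (fderiv ℝ t z 1) (fderiv ℝ t z Complex.I) := cr_swap _ _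
  have hv : cr (fderiv ℝ t z 1) (fderiv ℝ t z Complex.I) =
      (-inner ℝ (fderiv ℝ t z 1) (fderiv ℝ t z 1)) • t z := by
    rw [cI, map_neg, cr_cr, hp]; simp
  rw [hsw, hv]
  module

lemma contDiff_comp (h : ConfChart τ) {f : S2 → S2} (hf : ∀ x, SmoothAt f x) :
    ContDiff ℝ ∞ (fun z => ext f (τ z)) := by
  rw [contDiff_iff_contDiffAt]
  intro z
  have : ContDiffAt ℝ ∞ (ext f) ((fun z => (τ z : E3)) z) := hf (τ z)
  exact this.comp z h.smooth.contDiffAt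

/-- The Laplacian of a harmonic map in a conformal chart is normal to the sphere. -/
lemma inner_laplacian_comp (h : ConfChart τ) {f : S2 → S2} (hf : IsHarmonic f) (z v : ℂ) :
    inner ℝ (fderiv ℝ (fderiv ℝ (fun z => ext f (τ z))) z 1 1 +
      fderiv ℝ (fderiv ℝ (fun z => ext f (τ z))) z Complex.I Complex.I)
      (fderiv ℝ (fun z => ext f (τ z)) z v) = 0 := by
  set t : ℂ → E3 := fun z => (τ z : E3) with ht
  have hsm : ∀ x, SmoothAt f x := fun x => (hf x).1
  have h2 : ContDiffAt ℝ 2 t z := (h.smooth.of_le (by norm_cast)).contDiffAt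
  have hg2 : ContDiffAt ℝ 2 (fun z => ext f (τ z)) z :=
    ((h.contDiff_comp hsm).of_le (by norm_cast)).contDiffAt
  have hF2 := (hsm (τ z)).contDiffAt_two
  have hcomp : ∀ v, fderiv ℝ (fderiv ℝ (fun z => ext f (τ z))) z v v =
      fderiv ℝ (fderiv ℝ (ext f)) (τ z) (fderiv ℝ t z v) (fderiv ℝ t z v) +
        fderiv ℝ (ext f) (τ z) (fderiv ℝ (fderiv ℝ t) z v v) := by
    intro v
    have d1 := fderiv_apply_const hg2 v
    have c1 : (fun y => fderiv ℝ (fun z => ext f (τ z)) y v) =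
        fun y => fderiv ℝ (ext f) (τ y) (fderiv ℝ t y v) :=
      funext fun y => h.fderiv_comp (hsm (τ y)) v
    rw [c1] at d1
    have d2 : HasFDerivAt (fun y => fderiv ℝ (ext f) (τ y) (fderiv ℝ t y v)) _ z :=
      ((hasFDerivAt_fderiv hF2).comp z (h.differentiableAt z).hasFDerivAt).clm_apply
        (fderiv_apply_const h2 v)
    have e := congrArg (fun L => L v) (d1.unique d2)
    simp at e
    rw [e, add_comm]
  have hI : fderiv ℝ t z Complex.I = -cr (τ z) (fderiv ℝ t z 1) := by
    simpa using h.conf z 1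
  have htr := frame_trace (ext f) (y := (τ z : E3)) (S2.inner_self (τ z)) (h.perp z 1)
  have hrad := fderiv_ext_radial (hsm (τ z)).differentiableAt
  have hharm := eq_neg_of_add_eq_zero_left (hf (τ z)).2
  have hneg : ∀ u : E3, fderiv ℝ (fderiv ℝ (ext f)) (τ z) (-u) (-u) =
      fderiv ℝ (fderiv ℝ (ext f)) (τ z) u u := fun u => by
    simp only [map_neg, neg_apply, neg_neg]
  rw [hcomp, hcomp, hI, hneg]
  have e : fderiv ℝ (ext f) (τ z) (fderiv ℝ (fderiv ℝ t) z 1 1) +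
      fderiv ℝ (ext f) (τ z) (fderiv ℝ (fderiv ℝ t) z Complex.I Complex.I) = 0 := by
    rw [← map_add, h.laplacian z, map_smul, hrad, smul_zero]
  have e' : ∀ p q r s : E3, p + q + (r + s) = p + r + (q + s) := by intros; abel
  rw [e', e, htr, fderiv_fderiv_ext_radial hF2, hharm, h.fderiv_comp (hsm (τ z))]
  simp [inner_smul_left, inner_fderiv (hsm (τ z))]

end ConfChart

/-- A map of the plane to the sphere whose Laplacian is normal has a holomorphic Hopf differential;
if moreover its differential tends to zero at infinity, it is weakly conformal. -/
lemma hopf_eq_zero {g : ℂ → E3} (hg : ContDiff ℝ ∞ g)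
    (hlap : ∀ z v, inner ℝ (fderiv ℝ (fderiv ℝ g) z 1 1 +
      fderiv ℝ (fderiv ℝ g) z Complex.I Complex.I) (fderiv ℝ g z v) = 0)
    (hdecay : ∀ v, Tendsto (fun z => fderiv ℝ g z v) (cocompact ℂ) (𝓝 0)) (z : ℂ) :
    inner ℝ (fderiv ℝ g z 1) (fderiv ℝ g z 1) =
        inner ℝ (fderiv ℝ g z Complex.I) (fderiv ℝ g z Complex.I) ∧
      inner ℝ (fderiv ℝ g z 1) (fderiv ℝ g z Complex.I) = 0 := by
  set a : ℂ → E3 := fun z => fderiv ℝ g z 1 with ha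
  set b : ℂ → E3 := fun z => fderiv ℝ g z Complex.I with hb
  -- the Hopf differential `|g_x|² - |g_y|² - 2 i ⟨g_x, g_y⟩`
  set H : ℂ → ℂ := fun z => ((inner ℝ (a z) (a z) - inner ℝ (b z) (b z) : ℝ) : ℂ)
    + ((-2 * inner ℝ (a z) (b z) : ℝ) : ℂ) * Complex.I with hH
  have h2 : ∀ z, ContDiffAt ℝ 2 g z := fun z => (hg.of_le (by norm_cast)).contDiffAt
  have hdiff : Differentiable ℂ H := by
    intro z
    have da : HasFDerivAt a _ z := fderiv_apply_const (h2 z) 1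
    have db : HasFDerivAt b _ z := fderiv_apply_const (h2 z) Complex.I
    have du := (da.inner ℝ da).sub (db.inner ℝ db)
    have dv := (da.inner ℝ db).const_mul (-2)
    have dH : HasFDerivAt H _ z := (Complex.ofRealCLM.hasFDerivAt.comp z du).add
      ((Complex.ofRealCLM.hasFDerivAt.comp z dv).mul_const Complex.I)
    rw [differentiableAt_complex_iff_differentiableAt_real]
    refine ⟨dH.differentiableAt, ?_⟩
    rw [dH.fderiv]
    have sym := fderiv_fderiv_symm (h2 z) 1 Complex.I
    have l1 := hlap z 1
    have l2 := hlap z Complex.I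
    rw [inner_add_left] at l1 l2
    have e1 := real_inner_comm (a z) (fderiv ℝ (fderiv ℝ g) z 1 1)
    have e2 := real_inner_comm (b z) (fderiv ℝ (fderiv ℝ g) z 1 1)
    have e3 := real_inner_comm (a z) (fderiv ℝ (fderiv ℝ g) z Complex.I Complex.I)
    have e4 := real_inner_comm (b z) (fderiv ℝ (fderiv ℝ g) z Complex.I Complex.I)
    have e5 := real_inner_comm (a z) (fderiv ℝ (fderiv ℝ g) z Complex.I 1)
    have e6 := real_inner_comm (b z) (fderiv ℝ (fderiv ℝ g) z Complex.I 1)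
    apply Complex.ext
    · simp [sym]
      simp only [ha, hb] at *
      linarith
    · simp [sym]
      simp only [ha, hb] at *
      linarith
  -- an entire function tending to zero at infinity vanishes, by Liouville's theorem
  have hlim : Tendsto H (cocompact ℂ) (𝓝 0) := by
    have t1 := hdecay 1
    have t2 := hdecay Complex.I
    have u1 := ((t1.inner t1 (𝕜 := ℝ)).sub (t2.inner t2 (𝕜 := ℝ)))
    have u2 := (t1.inner t2 (𝕜 := ℝ)).const_mul (-2)
    have w1 := (Complex.continuous_ofReal.tendsto _).comp u1
    have w2 := ((Complex.continuous_ofReal.tendsto _).comp u2).mul_const Complex.I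
    have w := w1.add w2
    simp only [inner_zero_left, sub_self, mul_zero, Complex.ofReal_zero, zero_mul, add_zero] at w
    exact w
  have h0 : H z = 0 := hdiff.apply_eq_of_tendsto_cocompact z hlim
  have hre := congrArg Complex.re h0
  have him := congrArg Complex.im h0
  simp only [hH, Complex.add_re, Complex.add_im, Complex.ofReal_re, Complex.ofReal_im,
    Complex.re_ofReal_mul, Complex.im_ofReal_mul, Complex.I_re, Complex.I_im, mul_zero, mul_one,
    add_zero, zero_add, Complex.zero_re, Complex.zero_im] at hre him
  exact ⟨by linarith, by linarith⟩

/-- The differential of `sig` at `z` has norm `2 / (1 + |z|²)`, so that the coordinate expression of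
a smooth map of the sphere has decaying differential. -/
lemma tendsto_fderiv_sig {f : S2 → S2} (hf : ∀ x, SmoothAt f x) (v : ℂ) :
    Tendsto (fun z => fderiv ℝ (fun z => ext f (sig z)) z v) (cocompact ℂ) (𝓝 0) := by
  have hc : ContinuousOn (fderiv ℝ (ext f)) (Metric.sphere (0 : E3) 1) := by
    intro x hx
    have h2 := (hf ⟨x, hx⟩).contDiffAt_two
    exact ((h2.fderiv_right (m := 1) le_rfl).continuousAt).continuousWithinAt
  obtain ⟨C, hC⟩ := (isCompact_sphere (0 : E3) 1).exists_bound_of_continuousOn hc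
  have hv : Tendsto (fun z => fderiv ℝ (fun z => (sig z : E3)) z v) (cocompact ℂ) (𝓝 0) := by
    have hn : ∀ z : ℂ, ‖fderiv ℝ (fun z => (sig z : E3)) z v‖ = 2 * ‖v‖ * (‖z‖ ^ 2 + 1)⁻¹ := by
      intro z
      obtain ⟨L, hL, hLv⟩ := hasFDerivAt_stereo_hol (hasDerivAt_id z) (hasDerivAt_const z (1 : ℂ))
        (by simp)
      simp only [id] at hL
      rw [sig_coe, hL.fderiv, hLv]
      have h0 : 0 ≤ 2 * ‖v‖ * (‖z‖ ^ 2 + 1)⁻¹ := by positivity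
      rw [← sq_eq_sq₀ (norm_nonneg _) h0, norm_sq_inner, inner_stereoD]
      rw [Complex.mul_conj, Complex.ofReal_re]
      simp only [id, Complex.normSq_eq_norm_sq, norm_one, one_pow, mul_one, mul_zero, sub_zero,
        one_mul, mul_pow, inv_pow]
      ring
    rw [tendsto_zero_iff_norm_tendsto_zero]
    simp_rw [hn]
    have h1 : Tendsto (fun z : ℂ => ‖z‖ ^ 2 + 1) (cocompact ℂ) atTop :=
      tendsto_atTop_add_const_right _ _
        ((tendsto_pow_atTop two_ne_zero).comp (tendsto_norm_cocompact_atTop))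
    simpa using (tendsto_inv_atTop_zero.comp h1).const_mul (2 * ‖v‖)
  rw [tendsto_zero_iff_norm_tendsto_zero] at hv ⊢
  have hv' := hv.const_mul C
  rw [mul_zero] at hv'
  refine squeeze_zero (fun z => norm_nonneg _) (fun z => ?_) hv'
  rw [confChart_sig.fderiv_comp (hf (sig z))]
  exact (ContinuousLinearMap.le_opNorm _ _).trans
    (mul_le_mul_of_nonneg_right (hC _ (sig z).2) (norm_nonneg _))

/-- A harmonic map of the sphere is weakly conformal, because its Hopf differential vanishes. -/
lemma conf_or_conf_of_isHarmonic {f : S2 → S2} (hf : IsHarmonic f) (z : ℂ) :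
    Conf 1 (fun z => ext f (sig z)) z ∨ Conf (-1) (fun z => ext f (sig z)) z := by
  have hsm : ∀ x, SmoothAt f x := fun x => (hf x).1
  obtain ⟨h1, h2⟩ := hopf_eq_zero (confChart_sig.contDiff_comp hsm)
    (confChart_sig.inner_laplacian_comp hf) (tendsto_fderiv_sig hsm) z
  have hg : inner ℝ (ext f (sig z)) (ext f (sig z)) = 1 := inner_ext_self f (S2.ne_zero _)
  have hp : ∀ v, inner ℝ (ext f (sig z)) (fderiv ℝ (fun z => ext f (sig z)) z v) = 0 := by
    intro v
    rw [confChart_sig.fderiv_comp (hsm _)]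
    exact inner_ext_fderiv (S2.ne_zero _) (hsm _).differentiableAt _
  rcases eq_cr_or_eq_neg_cr hg (hp 1) (hp Complex.I) h2 h1 with h | h
  · right
    exact conf_of_one (by norm_num) hg (hp 1) (by rw [h]; simp)
  · left
    exact conf_of_one (by norm_num) hg (hp 1) (by rw [h]; simp)

/-! ### Weakly conformal maps of the plane are holomorphic or antiholomorphic -/

/-- A smooth function on a plane domain which at each point is holomorphic or antiholomorphic is
harmonic, because its Laplacian is `∂` of `∂̄` and `∂̄` of `∂`. Hence `∂` and the conjugate of `∂̄`
are holomorphic, and the identity theorem gives the local alternative. -/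
lemma holomorphic_or_antiholomorphic {W : ℂ → ℂ} {U : Set ℂ} (hU : IsOpen U)
    (hW : ContDiffOn ℝ ∞ W U)
    (hpt : ∀ z ∈ U, fderiv ℝ W z Complex.I = Complex.I * fderiv ℝ W z 1 ∨
      fderiv ℝ W z Complex.I = -(Complex.I * fderiv ℝ W z 1)) {z₀ : ℂ} (hz₀ : z₀ ∈ U) :
    (∀ᶠ z in 𝓝 z₀, fderiv ℝ W z = 0) ∨
      ((∀ᶠ z in 𝓝[≠] z₀, fderiv ℝ W z ≠ 0) ∧
        ((∀ᶠ z in 𝓝 z₀, fderiv ℝ W z Complex.I = Complex.I * fderiv ℝ W z 1) ∨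
          (∀ᶠ z in 𝓝 z₀, fderiv ℝ W z Complex.I = -(Complex.I * fderiv ℝ W z 1)))) := by
  have hI := Complex.I_mul_I
  have hWs : ∀ z ∈ U, ContDiffAt ℝ ∞ W z := fun z hz => hW.contDiffAt (hU.mem_nhds hz)
  have h2 : ∀ z ∈ U, ContDiffAt ℝ 2 W z := fun z hz => (hWs z hz).of_le (by norm_cast)
  -- `A = 2 ∂W` and `B = 2 ∂̄W`, where one of the two vanishes at every point
  set A : ℂ → ℂ := fun z => fderiv ℝ W z 1 - Complex.I * fderiv ℝ W z Complex.I with hA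
  set B : ℂ → ℂ := fun z => fderiv ℝ W z 1 + Complex.I * fderiv ℝ W z Complex.I with hB
  set Δ : ℂ → ℂ := fun z => fderiv ℝ (fderiv ℝ W) z 1 1
    + fderiv ℝ (fderiv ℝ W) z Complex.I Complex.I with hΔ
  have dA : ∀ z ∈ U, HasFDerivAt A ((fderiv ℝ (fderiv ℝ W) z).flip 1 -
      Complex.I • (fderiv ℝ (fderiv ℝ W) z).flip Complex.I) z := fun z hz =>
    (fderiv_apply_const (h2 z hz) 1).sub
      ((fderiv_apply_const (h2 z hz) Complex.I).const_mul Complex.I)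
  have dB : ∀ z ∈ U, HasFDerivAt B ((fderiv ℝ (fderiv ℝ W) z).flip 1 +
      Complex.I • (fderiv ℝ (fderiv ℝ W) z).flip Complex.I) z := fun z hz =>
    (fderiv_apply_const (h2 z hz) 1).add
      ((fderiv_apply_const (h2 z hz) Complex.I).const_mul Complex.I)
  have eA : ∀ z ∈ U, fderiv ℝ A z Complex.I - Complex.I * fderiv ℝ A z 1 =
      -(Complex.I * Δ z) := by
    intro z hz
    have sym := fderiv_fderiv_symm (h2 z hz) 1 Complex.I
    rw [(dA z hz).fderiv]
    simp [hΔ, sym]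
    linear_combination (fderiv ℝ (fderiv ℝ W) z Complex.I 1) * hI
  have eB : ∀ z ∈ U, fderiv ℝ B z Complex.I + Complex.I * fderiv ℝ B z 1 =
      Complex.I * Δ z := by
    intro z hz
    have sym := fderiv_fderiv_symm (h2 z hz) 1 Complex.I
    rw [(dB z hz).fderiv]
    simp [hΔ, sym]
    linear_combination (fderiv ℝ (fderiv ℝ W) z Complex.I 1) * hI
  have hAB : ∀ z ∈ U, A z = 0 ∨ B z = 0 := by
    intro z hz
    rcases hpt z hz with h | h
    · right; simp only [hB, h]; linear_combination fderiv ℝ W z 1 * hI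
    · left; simp only [hA, h]; linear_combination fderiv ℝ W z 1 * hI
  have hΔA : ∀ z ∈ U, (∀ᶠ y in 𝓝 z, A y = 0) → Δ z = 0 := by
    intro z hz h
    have e := eA z hz
    have : fderiv ℝ A z = 0 := by
      rw [Filter.EventuallyEq.fderiv_eq (f := fun _ => (0 : ℂ)) h]; simp
    rw [this] at e
    simpa using e
  have hΔB : ∀ z ∈ U, (∀ᶠ y in 𝓝 z, B y = 0) → Δ z = 0 := by
    intro z hz h
    have e := eB z hz
    have : fderiv ℝ B z = 0 := by
      rw [Filter.EventuallyEq.fderiv_eq (f := fun _ => (0 : ℂ)) h]; simp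
    rw [this] at e
    simpa using e
  have hΔc : ∀ z ∈ U, ContinuousAt Δ z := by
    intro z hz
    have h1 : ContDiffAt ℝ 1 (fderiv ℝ W) z :=
      (hWs z hz).fderiv_right (m := 1) (by norm_cast)
    have h3 : ContinuousAt (fderiv ℝ (fderiv ℝ W)) z :=
      (h1.fderiv_right (m := 0) (by norm_num)).continuousAt
    exact ((h3.clm_apply continuousAt_const).clm_apply continuousAt_const).add
      ((h3.clm_apply continuousAt_const).clm_apply continuousAt_const)
  -- near a point with `Δ ≠ 0` the function `A` would not vanish identically, and where `A ≠ 0`,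
  -- `B` vanishes identically, which forces `Δ = 0`
  have hΔ0 : ∀ z ∈ U, Δ z = 0 := by
    intro z hz
    by_contra hne
    have h1 := (hΔc z hz).eventually_ne hne
    by_cases hAz : ∀ᶠ y in 𝓝 z, A y = 0
    · exact hne (hΔA z hz hAz)
    · obtain ⟨y, hy, hy1, hyU⟩ := ((Filter.not_eventually.mp hAz).and_eventually
        (h1.and (hU.mem_nhds hz))).exists
      refine hy1 (hΔB y hyU ?_)
      have hAc : ContinuousAt A y := (dA y hyU).continuousAt
      filter_upwards [hAc.eventually_ne hy, hU.mem_nhds hyU] with w hw hwU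
      exact (hAB w hwU).resolve_left hw
  have hdA : DifferentiableOn ℂ A U := by
    intro z hz
    refine DifferentiableAt.differentiableWithinAt ?_
    rw [differentiableAt_complex_iff_differentiableAt_real]
    refine ⟨(dA z hz).differentiableAt, ?_⟩
    have e := eA z hz
    rw [hΔ0 z hz, mul_zero, neg_zero, sub_eq_zero] at e
    exact e
  have hdB : DifferentiableOn ℂ (fun z => starRingEnd ℂ (B z)) U := by
    intro z hz
    refine DifferentiableAt.differentiableWithinAt ?_
    rw [differentiableAt_complex_iff_differentiableAt_real]
    have hc : HasFDerivAt (fun z => starRingEnd ℂ (B z)) _ z :=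
      (Complex.conjCLE.toContinuousLinearMap.hasFDerivAt).comp z
        (dB z hz).differentiableAt.hasFDerivAt
    refine ⟨hc.differentiableAt, ?_⟩
    have e := eB z hz
    rw [hΔ0 z hz, mul_zero, add_eq_zero_iff_eq_neg] at e
    rw [hc.fderiv]
    simp [e]
  have zero_iff : ∀ z, A z = 0 → B z = 0 → fderiv ℝ W z = 0 := by
    intro z h1 h3
    have e1 : fderiv ℝ W z 1 = 0 := by linear_combination (h1 + h3) / 2
    have e2 : fderiv ℝ W z Complex.I = 0 := by
      linear_combination Complex.I * (h1 - h3) / 2 + fderiv ℝ W z Complex.I * hI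
    ext v
    have hv : v = v.re • (1 : ℂ) + v.im • Complex.I := by
      apply Complex.ext <;> simp
    rw [hv, map_add, map_smul, map_smul, e1, e2]
    simp
  have anA := (hdA.analyticAt (hU.mem_nhds hz₀)).eventually_eq_zero_or_eventually_ne_zero
  have anB := (hdB.analyticAt (hU.mem_nhds hz₀)).eventually_eq_zero_or_eventually_ne_zero
  simp only [map_eq_zero, ne_eq] at anA anB
  rcases anA with a0 | a1 <;> rcases anB with b0 | b1
  · left
    filter_upwards [a0, b0] with z h1 h3 using zero_iff z h1 h3
  · right
    refine ⟨b1.mono fun z hz h => hz (by simp [hB, h]), Or.inr ?_⟩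
    filter_upwards [a0] with z hz
    simp only [hA] at hz
    linear_combination Complex.I * hz + fderiv ℝ W z Complex.I * hI
  · right
    refine ⟨a1.mono fun z hz h => hz (by simp [hA, h]), Or.inl ?_⟩
    filter_upwards [b0] with z hz
    simp only [hB] at hz
    linear_combination -Complex.I * hz + fderiv ℝ W z Complex.I * hI
  · exfalso
    have hUn : ∀ᶠ z in 𝓝[≠] z₀, z ∈ U := nhdsWithin_le_nhds (hU.mem_nhds hz₀)
    obtain ⟨z, h1, h3, hz⟩ := (a1.and (b1.and hUn)).exists
    rcases hAB z hz with h | h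
    · exact h1 h
    · exact h3 h

/-- The stereographic coordinate of a vector. -/
def coordN (y : E3) : ℂ := (⟨y 0, y 1⟩ : ℂ) / ((1 - y 2 : ℝ) : ℂ)

/-- The inverse of the stereographic coordinate, as a coordinate around the north pole. -/
def coordS (y : E3) : ℂ := (⟨y 0, -y 1⟩ : ℂ) / ((1 + y 2 : ℝ) : ℂ)

lemma invStereoVec_coordN {y : E3} (hy : inner ℝ y y = 1) (h : y 2 ≠ 1) :
    invStereoVec (coordN y) 1 = y := by
  have h' : 1 - y 2 ≠ 0 := fun h0 => h (by linarith)
  have hc : ((1 - y 2 : ℝ) : ℂ) ≠ 0 := Complex.ofReal_ne_zero.mpr h'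
  rw [inner_coord] at hy
  rw [← invStereoVec_smul hc, coordN, mul_div_cancel₀ _ hc, mul_one]
  have e : y 0 * y 0 + y 1 * y 1 + (1 - y 2) * (1 - y 2) = 2 * (1 - y 2) := by linarith
  apply ext3 <;>
    simp only [invStereoVec, Complex.normSq_apply, Complex.ofReal_re, Complex.ofReal_im,
      mul_zero, add_zero, PiLp.smul_apply, smul_eq_mul, Matrix.cons_val_zero, e,
      Matrix.cons_val_one, Matrix.cons_val, Complex.conj_ofReal, Complex.re_mul_ofReal,
      Complex.im_mul_ofReal]
  · field_simp
  · field_simp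
  · field_simp; linarith

lemma invStereoVec_coordS {y : E3} (hy : inner ℝ y y = 1) (h : y 2 ≠ -1) :
    invStereoVec 1 (coordS y) = y := by
  have h' : 1 + y 2 ≠ 0 := fun h0 => h (by linarith)
  have hc : ((1 + y 2 : ℝ) : ℂ) ≠ 0 := Complex.ofReal_ne_zero.mpr h'
  rw [inner_coord] at hy
  rw [← invStereoVec_smul hc, coordS, mul_div_cancel₀ _ hc, mul_one]
  have e : (1 + y 2) * (1 + y 2) + (y 0 * y 0 + y 1 * y 1) = 2 * (1 + y 2) := by linarith
  apply ext3 <;>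
    simp only [invStereoVec, Complex.normSq_apply, Complex.ofReal_re, Complex.ofReal_im,
      mul_zero, add_zero, PiLp.smul_apply, smul_eq_mul, Matrix.cons_val_zero, e,
      Matrix.cons_val_one, Matrix.cons_val, Complex.re_ofReal_mul, neg_mul_neg,
      Complex.im_ofReal_mul, Complex.conj_re, Complex.conj_im, neg_neg]
  · field_simp
  · field_simp
  · field_simp; linarith

lemma contDiffAt_coordN {y : E3} (h : y 2 ≠ 1) : ContDiffAt ℝ ∞ coordN y := by
  have h' : 1 - y 2 ≠ 0 := fun h0 => h (by linarith)
  have hc : ∀ i : Fin 3, ContDiffAt ℝ ∞ (fun y : E3 => y i) y := fun i => by fun_prop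
  have hr : ContDiffAt ℝ ∞ (fun y : E3 => ((1 - y 2 : ℝ) : ℂ)) y :=
    Complex.ofRealCLM.contDiff.contDiffAt.comp _ (contDiffAt_const.sub (hc 2))
  exact (contDiffAt_complex_mk (hc 0) (hc 1)).mul
    (hr.inv (Complex.ofReal_ne_zero.mpr h'))

lemma contDiffAt_coordS {y : E3} (h : y 2 ≠ -1) : ContDiffAt ℝ ∞ coordS y := by
  have h' : 1 + y 2 ≠ 0 := fun h0 => h (by linarith)
  have hc : ∀ i : Fin 3, ContDiffAt ℝ ∞ (fun y : E3 => y i) y := fun i => by fun_prop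
  have hr : ContDiffAt ℝ ∞ (fun y : E3 => ((1 + y 2 : ℝ) : ℂ)) y :=
    Complex.ofRealCLM.contDiff.contDiffAt.comp _ (contDiffAt_const.add (hc 2))
  exact (contDiffAt_complex_mk (hc 0) (hc 1).neg).mul
    (hr.inv (Complex.ofReal_ne_zero.mpr h'))

lemma isOpen_coord_ne {g : ℂ → E3} (hg : Continuous g) (c : ℝ) : IsOpen {z | g z 2 ≠ c} := by
  have : Continuous fun z => g z 2 := by fun_prop
  exact isOpen_ne_fun this continuous_const

/-- The differential of a map to the sphere in terms of its stereographic coordinate. -/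
lemma fderiv_eq_coordN {g : ℂ → E3} (hg : ContDiff ℝ ∞ g) (h1 : ∀ z, inner ℝ (g z) (g z) = 1)
    {z : ℂ} (hz : g z 2 ≠ 1) (v : ℂ) : fderiv ℝ g z v =
      stereoD (coordN (g z)) 1 (1 * fderiv ℝ (fun z => coordN (g z)) z v) := by
  have hW : ContDiffAt ℝ ∞ (fun z => coordN (g z)) z :=
    (contDiffAt_coordN hz).comp z hg.contDiffAt
  have hd := hasFDerivAt_invStereoVec (hW.differentiableAt (by simp)).hasFDerivAt
    (hasFDerivAt_const (1 : ℂ) z) (by simp)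
  have he : g =ᶠ[𝓝 z] fun z => invStereoVec (coordN (g z)) 1 := by
    filter_upwards [(isOpen_coord_ne hg.continuous 1).mem_nhds hz] with y hy
    exact (invStereoVec_coordN (h1 y) hy).symm
  rw [he.fderiv_eq, hd.fderiv]
  simp

/-- The differential of a map to the sphere in terms of the coordinate around the north pole, which
is the second homogeneous coordinate; this is the source of the sign. -/
lemma fderiv_eq_coordS {g : ℂ → E3} (hg : ContDiff ℝ ∞ g) (h1 : ∀ z, inner ℝ (g z) (g z) = 1)
    {z : ℂ} (hz : g z 2 ≠ -1) (v : ℂ) : fderiv ℝ g z v =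
      stereoD 1 (coordS (g z)) (-1 * fderiv ℝ (fun z => coordS (g z)) z v) := by
  have hW : ContDiffAt ℝ ∞ (fun z => coordS (g z)) z :=
    (contDiffAt_coordS hz).comp z hg.contDiffAt
  have hd := hasFDerivAt_invStereoVec (hasFDerivAt_const (1 : ℂ) z)
    (hW.differentiableAt (by simp)).hasFDerivAt (by simp)
  have he : g =ᶠ[𝓝 z] fun z => invStereoVec 1 (coordS (g z)) := by
    filter_upwards [(isOpen_coord_ne hg.continuous (-1)).mem_nhds hz] with y hy
    exact (invStereoVec_coordS (h1 y) hy).symm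
  rw [he.fderiv_eq, hd.fderiv]
  simp

/-- The condition `Conf` in terms of a holomorphic coordinate `W` of the target. -/
lemma conf_iff_of_coord {g : ℂ → E3} {W : ℂ → ℂ} {s : ℝ} (hs : s * s = 1) {z P Q κ : ℂ}
    (hκ : κ ≠ 0) (hPQ : ¬ (P = 0 ∧ Q = 0)) (hgz : g z = invStereoVec P Q)
    (hd : ∀ v, fderiv ℝ g z v = stereoD P Q (κ * fderiv ℝ W z v)) :
    Conf s g z ↔ fderiv ℝ W z Complex.I = s * (Complex.I * fderiv ℝ W z 1) := by
  have key : ∀ w, -(s • cr (g z) (stereoD P Q w)) = stereoD P Q (s * (Complex.I * w)) := by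
    intro w
    rw [← smul_neg, hgz, ← stereoD_I_mul hPQ, ← map_smul, Complex.real_smul]
  constructor
  · intro h
    have h1 := h 1
    rw [mul_one, hd, hd, key, ← sub_eq_zero, ← map_sub, stereoD_eq_zero hPQ] at h1
    apply mul_left_cancel₀ hκ
    linear_combination h1
  · intro h
    refine conf_of_one hs (by rw [hgz, inner_invStereoVec hPQ])
      (by rw [hd, hgz, inner_invStereoVec_stereoD hPQ]) ?_
    rw [hd, hd, key, h]
    congr 1
    ring

/-- The alternative of `holomorphic_or_antiholomorphic`, for a map to the sphere whose values lie in
the domain of a holomorphic coordinate. -/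
lemma conf_alternative_of_coord {g : ℂ → E3} {W P Q : ℂ → ℂ} {κ : ℂ} {U : Set ℂ}
    (hU : IsOpen U) (hW : ContDiffOn ℝ ∞ W U) (hκ : κ ≠ 0)
    (hPQ : ∀ z ∈ U, ¬ (P z = 0 ∧ Q z = 0)) (hgz : ∀ z ∈ U, g z = invStereoVec (P z) (Q z))
    (hd : ∀ z ∈ U, ∀ v, fderiv ℝ g z v = stereoD (P z) (Q z) (κ * fderiv ℝ W z v))
    (hpt : ∀ z, Conf 1 g z ∨ Conf (-1) g z) {z₀ : ℂ} (hz₀ : z₀ ∈ U) :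
    (∀ᶠ z in 𝓝 z₀, fderiv ℝ g z = 0) ∨
      ((∀ᶠ z in 𝓝[≠] z₀, fderiv ℝ g z ≠ 0) ∧
        ((∀ᶠ z in 𝓝 z₀, Conf 1 g z) ∨ (∀ᶠ z in 𝓝 z₀, Conf (-1) g z))) := by
  have c1 := fun z hz => conf_iff_of_coord (g := g) (W := W) (s := 1) (by norm_num) hκ
    (hPQ z hz) (hgz z hz) (hd z hz)
  have c2 := fun z hz => conf_iff_of_coord (g := g) (W := W) (s := -1) (by norm_num) hκ
    (hPQ z hz) (hgz z hz) (hd z hz)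
  simp only [Complex.ofReal_one, one_mul, Complex.ofReal_neg, neg_mul] at c1 c2
  have hzero : ∀ z ∈ U, (fderiv ℝ g z = 0 ↔ fderiv ℝ W z = 0) := by
    intro z hz
    constructor
    · intro h
      ext1 v
      have h1 := hd z hz v
      rw [h, zero_apply, eq_comm, stereoD_eq_zero (hPQ z hz)] at h1
      exact (mul_eq_zero.mp h1).resolve_left hκ
    · intro h
      ext1 v
      rw [hd z hz v, h]
      simp
  have hUn := hU.mem_nhds hz₀
  have hUp : ∀ᶠ z in 𝓝[≠] z₀, z ∈ U := nhdsWithin_le_nhds hUn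
  rcases holomorphic_or_antiholomorphic hU hW (fun z hz => by
    rw [← c1 z hz, ← c2 z hz]; exact hpt z) hz₀ with h | ⟨h, h'⟩
  · left
    filter_upwards [h, hUn] with z h1 hz using (hzero z hz).mpr h1
  · right
    constructor
    · filter_upwards [h, hUp] with z h1 hz using fun h0 => h1 ((hzero z hz).mp h0)
    · rcases h' with h' | h'
      · left; filter_upwards [h', hUn] with z h1 hz using (c1 z hz).mpr h1
      · right; filter_upwards [h', hUn] with z h1 hz using (c2 z hz).mpr h1

/-- The local alternative for a weakly conformal map `g`: near every point it is constant, or has an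
isolated critical point and is holomorphic or antiholomorphic. The coordinate of the target is
`coordS` at the north pole and `coordN` elsewhere. -/
lemma conf_alternative {g : ℂ → E3} (hg : ContDiff ℝ ∞ g) (h1 : ∀ z, inner ℝ (g z) (g z) = 1)
    (hpt : ∀ z, Conf 1 g z ∨ Conf (-1) g z) (z₀ : ℂ) :
    (∀ᶠ z in 𝓝 z₀, fderiv ℝ g z = 0) ∨
      ((∀ᶠ z in 𝓝[≠] z₀, fderiv ℝ g z ≠ 0) ∧
        ((∀ᶠ z in 𝓝 z₀, Conf 1 g z) ∨ (∀ᶠ z in 𝓝 z₀, Conf (-1) g z))) := by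
  by_cases h : g z₀ 2 = 1
  · refine conf_alternative_of_coord (W := fun z => coordS (g z)) (P := fun _ => 1)
      (Q := fun z => coordS (g z)) (κ := -1) (isOpen_coord_ne hg.continuous (-1)) ?_ (by norm_num)
      (by simp) (fun z hz => (invStereoVec_coordS (h1 z) hz).symm)
      (fun z hz v => fderiv_eq_coordS hg h1 hz v) hpt
      (show g z₀ 2 ≠ -1 by rw [h]; norm_num)
    intro z hz
    exact ((contDiffAt_coordS hz).comp z hg.contDiffAt).contDiffWithinAt
  · refine conf_alternative_of_coord (W := fun z => coordN (g z)) (Q := fun _ => 1)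
      (P := fun z => coordN (g z)) (κ := 1) (isOpen_coord_ne hg.continuous 1) ?_ (by norm_num)
      (by simp) (fun z hz => (invStereoVec_coordN (h1 z) hz).symm)
      (fun z hz v => fderiv_eq_coordN hg h1 hz v) hpt h
    intro z hz
    exact ((contDiffAt_coordN hz).comp z hg.contDiffAt).contDiffWithinAt

/-- A weakly conformal map of the plane is constant, holomorphic or antiholomorphic: by the local
alternative, the set where it is locally constant is open and closed, and if this set is empty, so
is the set where it is locally holomorphic. -/
lemma conf_global {g : ℂ → E3} (hg : ContDiff ℝ ∞ g) (h1 : ∀ z, inner ℝ (g z) (g z) = 1)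
    (hpt : ∀ z, Conf 1 g z ∨ Conf (-1) g z) :
    (∀ z, fderiv ℝ g z = 0) ∨ (∀ z, Conf 1 g z) ∨ (∀ z, Conf (-1) g z) := by
  have alt := conf_alternative hg h1 hpt
  have hZ : IsClopen {z | ∀ᶠ y in 𝓝 z, fderiv ℝ g y = 0} := by
    refine ⟨?_, isOpen_setOfPred_eventually_nhds⟩
    rw [← isOpen_compl_iff, isOpen_iff_mem_nhds]
    intro z hz
    have h2 := ((alt z).resolve_left hz).1
    rw [eventually_nhdsWithin_iff] at h2
    filter_upwards [h2] with y hy hy0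
    by_cases hyz : y = z
    · exact hz (hyz ▸ hy0)
    · exact hy hyz hy0.self_of_nhds
  rcases isClopen_iff.mp hZ with hZ | hZ
  · right
    have hnot : ∀ z, ¬ ∀ᶠ y in 𝓝 z, fderiv ℝ g y = 0 := fun z hz => by
      have : z ∈ {z | ∀ᶠ y in 𝓝 z, fderiv ℝ g y = 0} := hz
      rw [hZ] at this
      exact this
    -- a map which is both holomorphic and antiholomorphic is constant
    have hdisj : ∀ z, (∀ᶠ y in 𝓝 z, Conf 1 g y) → ¬ (∀ᶠ y in 𝓝 z, Conf (-1) g y) := by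
      intro z ha hb
      apply hnot z
      filter_upwards [ha, hb] with y h3 h4
      ext1 v
      have e3 := h3 (-(Complex.I * v))
      have e4 := h4 (-(Complex.I * v))
      have e5 : Complex.I * (-(Complex.I * v)) = v := by
        linear_combination -v * Complex.I_mul_I
      rw [e5] at e3 e4
      rw [zero_apply]
      have : fderiv ℝ g y v + fderiv ℝ g y v = 0 := by
        nth_rewrite 1 [e3]; rw [e4]; simp
      rw [← two_smul ℝ] at this
      exact (smul_eq_zero.mp this).resolve_left two_ne_zero
    have hcl : IsClopen {z | ∀ᶠ y in 𝓝 z, Conf 1 g y} := by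
      refine ⟨?_, isOpen_setOfPred_eventually_nhds⟩
      have : {z | ∀ᶠ y in 𝓝 z, Conf 1 g y}ᶜ = {z | ∀ᶠ y in 𝓝 z, Conf (-1) g y} := by
        ext z
        constructor
        · intro h
          exact ((alt z).resolve_left (hnot z)).2.resolve_left h
        · intro h h'
          exact hdisj z h' h
      rw [← isOpen_compl_iff, this]
      exact isOpen_setOfPred_eventually_nhds
    rcases isClopen_iff.mp hcl with hc | hc
    · right
      intro z
      have hz : z ∉ {z | ∀ᶠ y in 𝓝 z, Conf 1 g y} := by rw [hc]; simp
      exact (((alt z).resolve_left (hnot z)).2.resolve_left hz).self_of_nhds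
    · left
      intro z
      have hz : z ∈ {z | ∀ᶠ y in 𝓝 z, Conf 1 g y} := by rw [hc]; trivial
      exact Filter.Eventually.self_of_nhds hz
  · left
    intro z
    have hz : z ∈ {z | ∀ᶠ y in 𝓝 z, fderiv ℝ g y = 0} := by rw [hZ]; trivial
    exact (show ∀ᶠ y in 𝓝 z, fderiv ℝ g y = 0 from hz).self_of_nhds

/-! ### Meromorphic functions on the Riemann sphere are rational -/

open Polynomial in
/-- The rational function with prescribed divisor, as a quotient of coprime polynomials; with
Mathlib's conventions for division by zero the equality holds also at the zeros and poles. -/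
lemma prod_zpow_eq_div (s : Finset ℂ) (D : ℂ → ℤ) :
    ∃ p q : ℂ[X], IsCoprime p q ∧ (∀ z, q.eval z = 0 → z ∈ s) ∧
      (∀ z, p.eval z = 0 → z ∈ s) ∧
      ∀ z, ∏ u ∈ s, (z - u) ^ D u = p.eval z / q.eval z := by
  refine ⟨∏ u ∈ s, (X - C u) ^ (D u).toNat, ∏ u ∈ s, (X - C u) ^ (-D u).toNat, ?_, ?_, ?_, ?_⟩
  · refine IsCoprime.prod_left fun u _ => IsCoprime.prod_right fun v _ => ?_
    by_cases h : u = v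
    · subst h
      rcases le_total 0 (D u) with h0 | h0
      · rw [show (-D u).toNat = 0 by omega, pow_zero]
        exact isCoprime_one_right
      · rw [show (D u).toNat = 0 by omega, pow_zero]
        exact isCoprime_one_left
    · exact (pairwise_coprime_X_sub_C (Function.injective_id) h).pow
  · intro z hz
    rw [eval_prod, Finset.prod_eq_zero_iff] at hz
    obtain ⟨u, hu, h⟩ := hz
    rw [eval_pow, eval_sub, eval_X, eval_C] at h
    rwa [sub_eq_zero.mp (eq_zero_of_pow_eq_zero h)]
  · intro z hz
    rw [eval_prod, Finset.prod_eq_zero_iff] at hz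
    obtain ⟨u, hu, h⟩ := hz
    rw [eval_pow, eval_sub, eval_X, eval_C] at h
    rwa [sub_eq_zero.mp (eq_zero_of_pow_eq_zero h)]
  · intro z
    rw [eval_prod, eval_prod, ← Finset.prod_div_distrib]
    refine Finset.prod_congr rfl fun u _ => ?_
    rw [eval_pow, eval_pow, eval_sub, eval_X, eval_C]
    rcases le_total 0 (D u) with h0 | h0
    · rw [show (-D u).toNat = 0 by omega, pow_zero, div_one, ← zpow_natCast, Int.toNat_of_nonneg h0]
    · rw [show (D u).toNat = 0 by omega, pow_zero, ← zpow_natCast, Int.toNat_of_nonneg (by omega),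
        zpow_neg, one_div, inv_inv]

/-- A zero-free entire function which is meromorphic at infinity is constant. -/
lemma eq_const_of_meromorphicAt_inv {h : ℂ → ℂ} (hd : Differentiable ℂ h) (h0 : ∀ z, h z ≠ 0)
    (hm : MeromorphicAt (fun w => h w⁻¹) 0) : ∃ c, c ≠ 0 ∧ ∀ z, h z = c := by
  have hinv : Tendsto (fun z : ℂ => z⁻¹) (cocompact ℂ) (𝓝[≠] 0) := by
    rw [← Metric.cobounded_eq_cocompact]
    exact tendsto_inv₀_cobounded'
  suffices ∃ c, ∀ z, h z = c by
    obtain ⟨c, hc⟩ := this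
    exact ⟨c, hc 0 ▸ h0 0, hc⟩
  rcases le_or_gt 0 (meromorphicOrderAt (fun w => h w⁻¹) 0) with ho | ho
  · obtain ⟨c, hc⟩ := tendsto_nhds_of_meromorphicOrderAt_nonneg hm ho
    have := hc.comp hinv
    simp only [Function.comp_def, inv_inv] at this
    exact ⟨c, fun z => hd.apply_eq_of_tendsto_cocompact z this⟩
  · have h1 := (tendsto_inv₀_cobounded.comp (tendsto_cobounded_of_meromorphicOrderAt_neg ho)).comp
      hinv
    simp only [Function.comp_def, inv_inv] at h1
    exact absurd ((hd.inv h0).apply_eq_of_tendsto_cocompact 0 h1) (inv_ne_zero (h0 0))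

/-- A meromorphic function on the Riemann sphere is rational: it has finitely many zeros and poles,
and dividing them out leaves a zero-free entire function which is meromorphic at infinity, hence
constant. The function takes the value zero at its poles, so that the equality is asserted only
where `W` does not vanish, which is a dense set. -/
lemma exists_rational_of_meromorphic {W : ℂ → ℂ} (hW : ∀ z, MeromorphicAt W z)
    (hW' : MeromorphicAt (fun w => W w⁻¹) 0) (hA : ∀ z, W z ≠ 0 → AnalyticAt ℂ W z)
    (hne : ∃ z, W z ≠ 0) :
    ∃ p q : Polynomial ℂ, IsCoprime p q ∧ (∀ z, ∀ᶠ y in 𝓝[≠] z, W y ≠ 0) ∧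
      ∀ z, W z ≠ 0 → q.eval z ≠ 0 ∧ W z = p.eval z / q.eval z := by
  have hmer : Meromorphic W := hW
  have hord0 : ∀ z, W z ≠ 0 → meromorphicOrderAt W z = 0 := fun z hz =>
    (tendsto_ne_zero_iff_meromorphicOrderAt_eq_zero (hW z)).mp
      ⟨W z, hz, (hA z hz).continuousAt.tendsto.mono_left nhdsWithin_le_nhds⟩
  have hord : ∀ z, meromorphicOrderAt W z ≠ ⊤ := by
    rw [← hmer.exists_meromorphicOrderAt_ne_top_iff_forall]
    obtain ⟨z, hz⟩ := hne
    exact ⟨z, by rw [hord0 z hz]; exact WithTop.zero_ne_top⟩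
  have hnz : ∀ z, ∀ᶠ y in 𝓝[≠] z, W y ≠ 0 := fun z =>
    (meromorphicOrderAt_ne_top_iff_eventually_ne_zero (hW z)).mp (hord z)
  -- `W` has no zeros near infinity: otherwise it would vanish there on an open set
  have hinf : ∀ᶠ w in 𝓝[≠] (0 : ℂ), W w⁻¹ ≠ 0 := by
    refine hW'.eventually_eq_zero_or_eventually_ne_zero.resolve_left fun h => ?_
    have h1 : ∀ᶠ z in Bornology.cobounded ℂ, W z = 0 := by
      have := tendsto_inv₀_cobounded'.eventually h
      simpa only [inv_inv] using this
    obtain ⟨z, hz⟩ : ∃ z : ℂ, ∀ᶠ y in 𝓝 z, W y = 0 := by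
      obtain ⟨R, -, hR⟩ := (Metric.hasBasis_cobounded_compl_closedBall (0 : ℂ)).eventually_iff.mp h1
      refine ⟨((|R| + 1 : ℝ) : ℂ), ?_⟩
      have hlt : R < ‖((|R| + 1 : ℝ) : ℂ)‖ := by
        rw [Complex.norm_real, Real.norm_eq_abs, abs_of_pos (by positivity)]
        linarith [le_abs_self R]
      have hmem : ((|R| + 1 : ℝ) : ℂ) ∈ (Metric.closedBall (0 : ℂ) R)ᶜ := by
        rw [mem_compl_iff, mem_closedBall_zero_iff, not_le]
        exact hlt
      filter_upwards [Metric.isClosed_closedBall.isOpen_compl.mem_nhds hmem] with y hy using hR hy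
    have h2 := (hnz z).and (hz.filter_mono nhdsWithin_le_nhds)
    obtain ⟨y, hy⟩ := h2.exists
    exact hy.1 hy.2
  have hmo : MeromorphicOn W univ := fun z _ => hW z
  set D := MeromorphicOn.divisor W univ with hD
  have hDz : ∀ z, D z ≠ 0 → W z = 0 := by
    intro z hz
    by_contra hWz
    apply hz
    rw [hD, MeromorphicOn.divisor_apply hmo (mem_univ z), hord0 z hWz]
    rfl
  -- the divisor is supported in a disc, hence finite
  have hfin : (D : ℂ → ℤ).support.Finite := by
    have h1 : ∀ᶠ z in Bornology.cobounded ℂ, W z ≠ 0 := by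
      have := tendsto_inv₀_cobounded'.eventually hinf
      simpa only [inv_inv] using this
    obtain ⟨R, -, hR⟩ := (Metric.hasBasis_cobounded_compl_closedBall (0 : ℂ)).eventually_iff.mp h1
    have h3 : (D : ℂ → ℤ).support ⊆ Metric.closedBall 0 R := fun z hz => by
      by_contra hzR
      exact hR hzR (hDz z hz)
    refine ((MeromorphicOn.divisor W (Metric.closedBall 0 R)).finiteSupport
      (isCompact_closedBall 0 R)).subset fun z hz => ?_
    rw [Function.mem_support, MeromorphicOn.divisor_apply (fun y _ => hW y) (h3 hz)]
    rwa [Function.mem_support, hD, MeromorphicOn.divisor_apply hmo (mem_univ z)] at hz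
  obtain ⟨h, han, h0, heq⟩ := hmo.extract_zeros_poles (fun u => hord u) hfin
  -- the finite product as a pointwise product, and then as a quotient `p / q`
  have hR : (∏ᶠ u, (· - u) ^ D u) = fun z => ∏ u ∈ hfin.toFinset, (z - u) ^ D u := by
    rw [Function.FactorizedRational.finprod_eq_fun hfin]
    funext z
    refine finprod_eq_prod_of_mulSupport_subset _ fun u hu => ?_
    rw [Finite.coe_toFinset]
    intro h0
    exact hu (by simp [h0])
  obtain ⟨p, q, hpq, hqs, hps, hprod⟩ := prod_zpow_eq_div hfin.toFinset D
  have hqz : ∀ z, W z ≠ 0 → q.eval z ≠ 0 := fun z hz hq => by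
    have := hqs z hq
    rw [Finite.mem_toFinset] at this
    exact hz (hDz z this)
  have hpz : ∀ z, W z ≠ 0 → p.eval z ≠ 0 := fun z hz hp => by
    have := hps z hp
    rw [Finite.mem_toFinset] at this
    exact hz (hDz z this)
  have heqz : ∀ z, W z ≠ 0 → W z = p.eval z / q.eval z * h z := by
    intro z hz
    have h1 : ∀ᶠ y in 𝓝[≠] z, W y = p.eval y / q.eval y * h y := by
      have h2 := mem_codiscreteWithin_iff_forall_mem_nhdsNE.mp heq z (mem_univ z)
      rw [compl_univ, union_empty] at h2
      filter_upwards [h2] with y hy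
      rw [← hprod, ← congrFun hR y]
      exact hy
    have hc : ContinuousAt (fun y => p.eval y / q.eval y * h y) z :=
      ((p.continuous.continuousAt).div q.continuous.continuousAt (hqz z hz)).mul
        (han z (mem_univ z)).continuousAt
    exact tendsto_nhds_unique ((hA z hz).continuousAt.tendsto.mono_left nhdsWithin_le_nhds)
      ((hc.tendsto.mono_left nhdsWithin_le_nhds).congr' (by
        filter_upwards [h1] with y hy using hy.symm))
  have hhd : Differentiable ℂ h := fun z => (han z (mem_univ z)).differentiableAt
  have hpm : ∀ r : Polynomial ℂ, MeromorphicAt (fun w : ℂ => r.eval w⁻¹) 0 := by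
    intro r
    have : (fun w : ℂ => r.eval w⁻¹) = fun w => ∑ i ∈ Finset.range (r.natDegree + 1),
        r.coeff i * (w⁻¹) ^ i := funext fun w => Polynomial.eval_eq_sum_range _
    rw [this]
    fun_prop
  obtain ⟨c, hc0, hc⟩ := eq_const_of_meromorphicAt_inv hhd (fun z => h0 ⟨z, mem_univ z⟩) (by
    refine (hW'.mul ((hpm q).mul (hpm p).inv)).congr ?_
    filter_upwards [hinf] with w hw
    have h1 := heqz _ hw
    have h2 := hpz _ hw
    have h3 := hqz _ hw
    simp only [Pi.mul_apply, Pi.inv_apply]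
    rw [h1]
    generalize w⁻¹ = y at h2 h3 ⊢
    field_simp)
  refine ⟨Polynomial.C c * p, q, ?_, hnz, fun z hz => ⟨hqz z hz, ?_⟩⟩
  · exact (isCoprime_mul_unit_left_left (Polynomial.isUnit_C.mpr hc0.isUnit) p q).mpr hpq
  · rw [heqz z hz, hc, Polynomial.eval_mul, Polynomial.eval_C]
    ring

/-! ### Harmonic maps of positive degree are rational maps -/

/-- The condition `Conf` is closed, which extends it to the north pole. -/
lemma isClosed_conf {g : ℂ → E3} (hg : ContDiff ℝ ∞ g) (s : ℝ) : IsClosed {z | Conf s g z} := by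
  have hd : Continuous (fderiv ℝ g) := hg.continuous_fderiv (by simp)
  have hc := hg.continuous
  simp only [Conf, ofPred_forall]
  refine isClosed_iInter fun v => isClosed_eq (by fun_prop) ?_
  exact (((cr.continuous.comp hc).clm_apply (hd.clm_apply continuous_const)).const_smul s).neg

/-- A smooth map of the sphere which is (anti)holomorphic in the stereographic chart is so at the
north pole too. -/
lemma holAt_of_conf {f : S2 → S2} (hf : ∀ x, SmoothAt f x) {s : ℝ}
    (h : ∀ z, Conf s (fun z => ext f (sig z)) z) (x : S2) : HolAt s f x := by
  have hσ : ∀ z, HolAt s f (sig z) := fun z => (confChart_sig.holAt_iff (hf _)).mpr (h z)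
  rcases sig_or_north x with ⟨z, rfl⟩ | rfl
  · exact hσ z
  · refine (confChart_sig'.holAt_iff (hf _)).mpr ?_
    have hcl := isClosed_conf (confChart_sig'.contDiff_comp hf) s
    have hdense : closure {z : ℂ | z ≠ 0} = univ := dense_compl_singleton (0 : ℂ) |>.closure_eq
    have : closure {z : ℂ | z ≠ 0} ⊆ {z | Conf s (fun z => ext f (sig' z)) z} := by
      refine closure_minimal (fun z hz => ?_) hcl
      refine (confChart_sig'.holAt_iff (hf _)).mp ?_
      rw [sig'_eq_sig hz]
      exact hσ _
    rw [hdense] at this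
    exact this (mem_univ 0)

/-- A harmonic map of positive degree is holomorphic: a constant map is not surjective, and an
antiholomorphic one has nonpositive degree. -/
lemma holAt_of_mem_M {n : ℕ} (hn : n ≠ 0) {f : S2 → S2} (hf : f ∈ M n) (x : S2) :
    HolAt 1 f x := by
  obtain ⟨hh, hdeg⟩ := hf
  have hsm : ∀ x, SmoothAt f x := fun x => (hh x).1
  have hn' : (n : ℤ) ≠ 0 := by exact_mod_cast hn
  rcases conf_global (confChart_sig.contDiff_comp hsm)
    (fun z => inner_ext_self _ (S2.ne_zero _)) (conf_or_conf_of_isHarmonic hh) with h | h | h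
  · exfalso
    have hconst : ∀ z, f (sig z) = f (sig 0) := fun z => by
      have := is_const_of_fderiv_eq_zero
        ((confChart_sig.contDiff_comp hsm).differentiable (by simp)) h z 0
      simp only [ext_coe] at this
      exact Subtype.ext this
    have hne : ∀ y, y ≠ f north → y = f (sig 0) := fun y hy => by
      obtain ⟨x, rfl⟩ := hdeg.surjective hn' y
      rcases sig_or_north x with ⟨z, rfl⟩ | rfl
      · exact hconst z
      · exact absurd rfl hy
    -- a map which is constant off the north pole has at most two values, but the sphere has three
    -- points
    obtain ⟨c, hc⟩ : ∃ c : Fin 3 → ℂ, Function.Injective c :=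
      ⟨fun i => (i : ℂ), fun i j h => by simpa [Fin.val_inj] using h⟩
    have key : ∀ i j k : Fin 3, i ≠ j → i ≠ k → j ≠ k → False := by
      intro i j k hij hik hjk
      have inj : ∀ {i j}, sig (c i) = sig (c j) → i = j := fun h => hc (sig_injective h)
      by_cases hi : sig (c i) = f north
      · have hj := hne (sig (c j)) fun h => hij (inj (hi.trans h.symm))
        have hk := hne (sig (c k)) fun h => hik (inj (hi.trans h.symm))
        exact hjk (inj (hj.trans hk.symm))
      · by_cases hj : sig (c j) = f north
        · have hk := hne (sig (c k)) fun h => hjk (inj (hj.trans h.symm))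
          exact hik (inj ((hne _ hi).trans hk.symm))
        · exact hij (inj ((hne _ hi).trans (hne _ hj).symm))
    exact key 0 1 2 (by decide) (by decide) (by decide)
  · exact holAt_of_conf hsm h x
  · have := hdeg.nonpos_of_antiholomorphic (holAt_of_conf hsm h)
    omega

/-- At the two poles both sides are zero, by the convention for division by zero. -/
lemma coordS_eq_inv {y : E3} (hy : inner ℝ y y = 1) : coordS y = (coordN y)⁻¹ := by
  rw [inner_coord] at hy
  by_cases h1 : y 2 = 1
  · have h0 : y 0 = 0 := by nlinarith [sq_nonneg (y 0), sq_nonneg (y 1)]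
    have h0' : y 1 = 0 := by nlinarith [sq_nonneg (y 0), sq_nonneg (y 1)]
    have e : (⟨0, 0⟩ : ℂ) = 0 := rfl
    simp [coordS, coordN, h0, h0', h1, e]
  by_cases h2 : y 2 = -1
  · have h0 : y 0 = 0 := by nlinarith [sq_nonneg (y 0), sq_nonneg (y 1)]
    have h0' : y 1 = 0 := by nlinarith [sq_nonneg (y 0), sq_nonneg (y 1)]
    have e : (⟨0, 0⟩ : ℂ) = 0 := rfl
    simp [coordS, coordN, h0, h0', h2, e]
  have h1' : ((1 - y 2 : ℝ) : ℂ) ≠ 0 :=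
    Complex.ofReal_ne_zero.mpr fun h => h1 (by linarith)
  have h2' : ((1 + y 2 : ℝ) : ℂ) ≠ 0 :=
    Complex.ofReal_ne_zero.mpr fun h => h2 (by linarith)
  have hmul : (⟨y 0, -y 1⟩ : ℂ) * ⟨y 0, y 1⟩ = ((1 + y 2 : ℝ) : ℂ) * ((1 - y 2 : ℝ) : ℂ) := by
    apply Complex.ext <;> simp only [Complex.mul_re, Complex.mul_im, Complex.ofReal_re,
      Complex.ofReal_im] <;> linarith
  have hne : (⟨y 0, y 1⟩ : ℂ) ≠ 0 := fun h => by
    rw [h, mul_zero] at hmul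
    exact mul_ne_zero h2' h1' hmul.symm
  rw [coordS, coordN, inv_div, div_eq_div_iff h2' hne, hmul, mul_comm]

lemma ne_one_of_coordN_ne_zero {y : E3} (h : coordN y ≠ 0) : y 2 ≠ 1 :=
  fun h1 => h (by simp [coordN, h1])

lemma coordN_ne_zero {y : E3} (hy : inner ℝ y y = 1) (h1 : y 2 ≠ 1) (h2 : y 2 ≠ -1) :
    coordN y ≠ 0 := by
  intro h0
  rw [inner_coord] at hy
  have h1' : ((1 - y 2 : ℝ) : ℂ) ≠ 0 :=
    Complex.ofReal_ne_zero.mpr fun h => h1 (by linarith)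
  rw [coordN, div_eq_zero_iff] at h0
  have h3 := h0.resolve_right h1'
  have ha : y 0 = 0 := congrArg Complex.re h3
  have hb : y 1 = 0 := congrArg Complex.im h3
  rw [ha, hb] at hy
  have : (1 - y 2) * (1 + y 2) = 0 := by linarith
  rcases mul_eq_zero.mp this with h | h
  · exact h1 (by linarith)
  · exact h2 (by linarith)

lemma analyticAt_of_cauchyRiemann {W : ℂ → ℂ} {U : Set ℂ} (hU : IsOpen U)
    (hW : ∀ z ∈ U, DifferentiableAt ℝ W z)
    (hcr : ∀ z ∈ U, fderiv ℝ W z Complex.I = Complex.I * fderiv ℝ W z 1) {z : ℂ} (hz : z ∈ U) :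
    AnalyticAt ℂ W z := by
  refine DifferentiableOn.analyticAt (s := U) (fun y hy => ?_) (hU.mem_nhds hz)
  refine DifferentiableAt.differentiableWithinAt ?_
  rw [differentiableAt_complex_iff_differentiableAt_real]
  exact ⟨hW y hy, by simpa using hcr y hy⟩

section

variable {g : ℂ → E3}

lemma analyticAt_coordN (hg : ContDiff ℝ ∞ g) (h1 : ∀ z, inner ℝ (g z) (g z) = 1)
    (hc : ∀ z, Conf 1 g z) {z : ℂ} (hz : g z 2 ≠ 1) : AnalyticAt ℂ (fun z => coordN (g z)) z := by
  refine analyticAt_of_cauchyRiemann (isOpen_coord_ne hg.continuous 1) (fun y hy => ?_)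
    (fun y hy => ?_) hz
  · exact (((contDiffAt_coordN hy).comp y hg.contDiffAt).differentiableAt (by simp))
  · have := (conf_iff_of_coord (g := g) (W := fun z => coordN (g z)) (s := 1) (by norm_num)
      one_ne_zero (by simp) (invStereoVec_coordN (h1 y) hy).symm (fderiv_eq_coordN hg h1 hy)).mp
      (hc y)
    simpa using this

lemma analyticAt_coordS (hg : ContDiff ℝ ∞ g) (h1 : ∀ z, inner ℝ (g z) (g z) = 1)
    (hc : ∀ z, Conf 1 g z) {z : ℂ} (hz : g z 2 ≠ -1) : AnalyticAt ℂ (fun z => coordS (g z)) z := by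
  refine analyticAt_of_cauchyRiemann (isOpen_coord_ne hg.continuous (-1)) (fun y hy => ?_)
    (fun y hy => ?_) hz
  · exact (((contDiffAt_coordS hy).comp y hg.contDiffAt).differentiableAt (by simp))
  · have := (conf_iff_of_coord (g := g) (W := fun z => coordS (g z)) (s := 1) (by norm_num)
      (κ := -1) (by norm_num) (by simp) (invStereoVec_coordS (h1 y) hy).symm
      (fderiv_eq_coordS hg h1 hy)).mp (hc y)
    simpa using this

/-- The stereographic coordinate of a holomorphic map is meromorphic: around its poles it is the
inverse of the holomorphic function `coordS`. -/
lemma meromorphicAt_coordN (hg : ContDiff ℝ ∞ g) (h1 : ∀ z, inner ℝ (g z) (g z) = 1)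
    (hc : ∀ z, Conf 1 g z) (z : ℂ) : MeromorphicAt (fun z => coordN (g z)) z := by
  by_cases hz : g z 2 = 1
  · have h2 := (analyticAt_coordS hg h1 hc (z := z) (by rw [hz]; norm_num)).meromorphicAt.inv
    have e : (fun z => coordS (g z))⁻¹ = fun z => coordN (g z) := by
      funext y
      rw [Pi.inv_apply, coordS_eq_inv (h1 y), inv_inv]
    rwa [e] at h2
  · exact (analyticAt_coordN hg h1 hc hz).meromorphicAt

end

/-- A quotient of coprime polynomials is a rational map of degree the larger of the two degrees. -/
lemma exists_isRat_of_coprime {p q : Polynomial ℂ} (h : IsCoprime p q) :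
    ∃ (m : ℕ) (a : Coeff m), IsRat a ∧ numPoly a = p ∧ denPoly a = q := by
  set m := max p.natDegree q.natDegree with hm
  have hp : p.natDegree ≤ m := le_max_left _ _
  have hq : q.natDegree ≤ m := le_max_right _ _
  refine ⟨m, fun i => if (i : ℕ) ≤ m then p.coeff i else q.coeff (i - (m + 1)), ?_⟩
  have key : ∀ r : Polynomial ℂ, r.natDegree ≤ m →
      ∑ i : Fin (m + 1), Polynomial.C (r.coeff i) * Polynomial.X ^ (i : ℕ) = r := by
    intro r hr
    rw [Fin.sum_univ_eq_sum_range (fun i => Polynomial.C (r.coeff i) * Polynomial.X ^ i) (m + 1)]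
    exact (r.as_sum_range_C_mul_X_pow' (by omega)).symm
  have hn : numPoly (n := m)
      (fun i => if (i : ℕ) ≤ m then p.coeff i else q.coeff (i - (m + 1))) = p := by
    rw [numPoly, ← key p hp]
    refine Finset.sum_congr rfl fun i _ => ?_
    have : (i : ℕ) ≤ m := by omega
    simp [this, key p hp]
  have hd : denPoly (n := m)
      (fun i => if (i : ℕ) ≤ m then p.coeff i else q.coeff (i - (m + 1))) = q := by
    rw [denPoly, ← key q hq]
    refine Finset.sum_congr rfl fun i _ => ?_
    have : ¬ (m + 1 + (i : ℕ) ≤ m) := by omega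
    simp [this, key q hq]
  refine ⟨⟨?_, fun z hz => ?_⟩, hn, hd⟩
  · have e1 : ¬ (2 * m + 1 ≤ m) := by omega
    have e2 : 2 * m + 1 - (m + 1) = m := by omega
    simp only [le_refl, if_true, e1, if_false, e2]
    by_contra hcon
    push Not at hcon
    rcases le_total p.natDegree q.natDegree with hle | hle
    · have : m = q.natDegree := by omega
      rw [this] at hcon
      have hq0 : q = 0 := Polynomial.leadingCoeff_eq_zero.mp hcon.2
      rw [hq0] at hle
      have hp0 : p = 0 := by
        rw [Polynomial.eq_C_of_natDegree_le_zero (p := p) (by simpa using hle)]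
        have := hcon.1
        rw [hq0] at this
        simpa using this
      rw [hp0, hq0, isCoprime_zero_left] at h
      exact not_isUnit_zero h
    · have : m = p.natDegree := by omega
      rw [this] at hcon
      have hp0 : p = 0 := Polynomial.leadingCoeff_eq_zero.mp hcon.1
      rw [hp0] at hle
      have hq0 : q = 0 := by
        rw [Polynomial.eq_C_of_natDegree_le_zero (p := q) (by simpa using hle)]
        have := hcon.2
        rw [hp0] at this
        simpa using this
      rw [hp0, hq0, isCoprime_zero_left] at h
      exact not_isUnit_zero h
  · rw [← eval_numPoly, ← eval_denPoly, hn, hd] at hz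
    obtain ⟨u, v, huv⟩ := h
    have := congrArg (Polynomial.eval z) huv
    simp [hz.1, hz.2] at this

lemma continuous_of_smoothAt {f : S2 → S2} (h : ∀ x, SmoothAt f x) : Continuous f := by
  have : Continuous fun x : S2 => ext f (x : E3) := continuous_iff_continuousAt.mpr fun x =>
    ContinuousAt.comp (g := ext f) (h x).continuousAt continuous_subtype_val.continuousAt
  simp only [ext_coe] at this
  exact continuous_induced_rng.mpr this

/-- Continuous maps which agree on a dense subset of the stereographic chart are equal. -/
lemma eq_of_eq_sig {f f' : S2 → S2} (hf : Continuous f) (hf' : Continuous f')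
    {S : Set ℂ} (hS : ∀ z, ∀ᶠ y in 𝓝[≠] z, y ∈ S) (h : ∀ z ∈ S, f (sig z) = f' (sig z)) :
    f = f' := by
  have hcs := confChart_sig.continuous
  have hcs' := confChart_sig'.continuous
  have hz : ∀ z, f (sig z) = f' (sig z) := fun z =>
    tendsto_nhds_unique (((hf.comp hcs).tendsto z).mono_left nhdsWithin_le_nhds)
      ((((hf'.comp hcs).tendsto z).mono_left nhdsWithin_le_nhds).congr' (by
        filter_upwards [hS z] with y hy using (h y hy).symm))
  funext x
  rcases sig_or_north x with ⟨z, rfl⟩ | rfl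
  · exact hz z
  · refine tendsto_nhds_unique (l := 𝓝[≠] (0 : ℂ)) (f := fun z => f (sig' z))
      (((hf.comp hcs').tendsto 0).mono_left nhdsWithin_le_nhds)
      ((((hf'.comp hcs').tendsto 0).mono_left nhdsWithin_le_nhds).congr' ?_)
    filter_upwards [self_mem_nhdsWithin] with y hy
    simp only [Function.comp_apply]
    rw [sig'_eq_sig hy, hz]

/-- The classification: the stereographic coordinate of `f` is a meromorphic function on the Riemann
sphere, hence a rational function, and its algebraic degree equals the topological one. -/
lemma exists_ratMap_of_mem_M {n : ℕ} (hn : n ≠ 0) {f : S2 → S2} (hf : f ∈ M n) :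
    ∃ a : Coeff n, IsRat a ∧ ratMap a = f := by
  have hhol := holAt_of_mem_M hn hf
  obtain ⟨hh, hdeg⟩ := hf
  have hsm : ∀ x, SmoothAt f x := fun x => (hh x).1
  have hn' : (n : ℤ) ≠ 0 := by exact_mod_cast hn
  have hg := confChart_sig.contDiff_comp hsm
  have hg' := confChart_sig'.contDiff_comp hsm
  have h1 : ∀ z, inner ℝ (ext f (sig z)) (ext f (sig z)) = 1 :=
    fun z => inner_ext_self _ (S2.ne_zero _)
  have h1' : ∀ z, inner ℝ (ext f (sig' z)) (ext f (sig' z)) = 1 :=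
    fun z => inner_ext_self _ (S2.ne_zero _)
  have hc : ∀ z, Conf 1 (fun z => ext f (sig z)) z := fun z =>
    (confChart_sig.holAt_iff (hsm _)).mp (hhol _)
  have hc' : ∀ z, Conf 1 (fun z => ext f (sig' z)) z := fun z =>
    (confChart_sig'.holAt_iff (hsm _)).mp (hhol _)
  -- two points of the equator have preimages, and one of these is not the north pole
  have hne : ∃ z, coordN (ext f (sig z)) ≠ 0 := by
    have eq : ∀ y : S2, (y : E3) 2 = 0 → y ≠ f north → ∃ z, coordN (ext f (sig z)) ≠ 0 := by
      intro y hy hyn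
      obtain ⟨x, rfl⟩ := hdeg.surjective hn' y
      rcases sig_or_north x with ⟨z, rfl⟩ | rfl
      · refine ⟨z, coordN_ne_zero (h1 z) ?_ ?_⟩ <;> rw [ext_coe, hy] <;> norm_num
      · exact absurd rfl hyn
    have e : ∀ c : ℂ, Complex.normSq c = 1 → ((sig c : S2) : E3) 2 = 0 := by
      intro c hc
      rw [congrFun sig_coe c]
      simp [invStereoVec, hc]
    by_cases h : sig 1 = f north
    · refine eq (sig (-1)) (e _ (by simp)) fun h' => ?_
      have := sig_injective (h.trans h'.symm)
      norm_num at this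
    · exact eq (sig 1) (e _ (by simp)) h
  obtain ⟨p, q, hpq, hnz, hW⟩ := exists_rational_of_meromorphic
    (W := fun z => coordN (ext f (sig z))) (meromorphicAt_coordN hg h1 hc)
    ((meromorphicAt_coordN hg' h1' hc' 0).congr (by
      filter_upwards [self_mem_nhdsWithin] with w hw
      rw [sig'_eq_sig hw]))
    (fun z hz => analyticAt_coordN hg h1 hc (ne_one_of_coordN_ne_zero hz)) hne
  obtain ⟨m, a, ha, rfl, rfl⟩ := exists_isRat_of_coprime hpq
  have hfa : f = ratMap a := by
    refine eq_of_eq_sig (continuous_of_smoothAt hsm)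
      (continuous_of_smoothAt (smoothAt_ratMap ha)) hnz fun z hz => ?_
    obtain ⟨hq, hWz⟩ := hW z hz
    apply Subtype.ext
    have h2 := congrFun (ext_ratMap_sig ha) z
    simp only [ext_coe] at h2
    rw [h2]
    have h3 := invStereoVec_coordN (h1 z) (ne_one_of_coordN_ne_zero hz)
    rw [hWz, ← invStereoVec_smul hq, mul_div_cancel₀ _ hq, mul_one, ext_coe] at h3
    exact h3.symm
  have hdm := hasDegree_ratMap ha
  rw [← hfa] at hdm
  have hmn : m = n := by exact_mod_cast hdm.unique hdeg
  subst hmn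
  exact ⟨a, ha, hfa.symm⟩

lemma M_eq_image_ratMap {n : ℕ} (hn : n ≠ 0) : M n = ratMap '' {a : Coeff n | IsRat a} := by
  ext f
  constructor
  · intro hf
    obtain ⟨a, ha, rfl⟩ := exists_ratMap_of_mem_M hn hf
    exact ⟨a, ha, rfl⟩
  · rintro ⟨a, ha, rfl⟩
    exact ⟨isHarmonic_ratMap ha, hasDegree_ratMap ha⟩

lemma ratMap_mem_M {n : ℕ} {a : Coeff n} (ha : IsRat a) : ratMap a ∈ M n :=
  ⟨isHarmonic_ratMap ha, hasDegree_ratMap ha⟩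

/-! ### Coefficient vectors as homogeneous coordinates -/

variable {n : ℕ}

lemma isCoprime_numPoly_denPoly {a : Coeff n} (ha : IsRat a) :
    IsCoprime (numPoly a) (denPoly a) := by
  refine isCoprime_of_irreducible_dvd ?_ ?_
  · rintro ⟨h1, h2⟩
    refine ha.2 0 ?_
    rw [← eval_numPoly, ← eval_denPoly, h1, h2]
    simp
  · intro r hr h1 h2
    obtain ⟨z, hz⟩ := IsAlgClosed.exists_root r (Polynomial.degree_pos_of_irreducible hr).ne'
    refine ha.2 z ?_
    rw [← eval_numPoly, ← eval_denPoly]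
    exact ⟨Polynomial.eval_eq_zero_of_dvd_of_eval_eq_zero h1 hz,
      Polynomial.eval_eq_zero_of_dvd_of_eval_eq_zero h2 hz⟩

lemma coeff_numPoly (a : Coeff n) (i : Fin (n + 1)) : (numPoly a).coeff i = a ⟨i, by omega⟩ :=
  coeff_sum_pow (fun i : Fin (n + 1) => a ⟨i, by omega⟩) i

lemma coeff_denPoly (a : Coeff n) (i : Fin (n + 1)) :
    (denPoly a).coeff i = a ⟨n + 1 + i, by omega⟩ :=
  coeff_sum_pow (fun i : Fin (n + 1) => a ⟨n + 1 + i, by omega⟩) i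

lemma coeff_ext {a a' : Coeff n} (h1 : numPoly a = numPoly a') (h2 : denPoly a = denPoly a') :
    a = a' := by
  funext i
  by_cases hi : (i : ℕ) < n + 1
  · have := congrArg (fun p => Polynomial.coeff p i) h1
    rwa [coeff_numPoly a ⟨i, hi⟩, coeff_numPoly a' ⟨i, hi⟩] at this
  · have hi' : (i : ℕ) - (n + 1) < n + 1 := by omega
    have := congrArg (fun p => Polynomial.coeff p (i - (n + 1) : ℕ)) h2
    rw [coeff_denPoly a ⟨i - (n + 1), hi'⟩, coeff_denPoly a' ⟨i - (n + 1), hi'⟩] at this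
    have e : (⟨n + 1 + (i - (n + 1)), by omega⟩ : Fin (2 * n + 1 + 1)) = i :=
      Fin.ext (by simp only; omega)
    simp only [e] at this
    exact this

lemma num_const_smul (c : ℂ) (a : Coeff n) (z w : ℂ) : num (c • a) z w = c * num a z w := by
  simp [num, Finset.mul_sum, mul_assoc]

lemma den_const_smul (c : ℂ) (a : Coeff n) (z w : ℂ) : den (c • a) z w = c * den a z w := by
  simp [den, Finset.mul_sum, mul_assoc]

lemma ratMap_smul {c : ℂ} (hc : c ≠ 0) (a : Coeff n) : ratMap (c • a) = ratMap a := by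
  funext x
  rw [ratMap, num_const_smul, den_const_smul, invStereo_smul hc, ratMap]

lemma IsRat.smul {a : Coeff n} (ha : IsRat a) {c : ℂ} (hc : c ≠ 0) : IsRat (c • a) := by
  refine isRat_of_ne_zero fun z w hzw => ?_
  rw [num_const_smul, den_const_smul]
  simpa [hc] using ha.ne_zero hzw

lemma exists_mul_eq_of_coprime {R : Type*} [CommRing R] {p q p' q' : R} (h : IsCoprime p q)
    (e : p * q' = p' * q) : ∃ r, p' = r * p ∧ q' = r * q := by
  obtain ⟨α, β, hab⟩ := h
  exact ⟨α * p' + β * q', by linear_combination (-p') * hab - β * e,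
    by linear_combination (-q') * hab + α * e⟩

/-- The ratio of two numerators and denominators that define the same fraction is a polynomial `r`,
as `a` is in lowest terms, and `r` is constant because one of the leading coefficients of `a` is not
zero. The vector `a'` need not satisfy `IsRat`, which permits to apply the lemma to tangent vectors.
-/
lemma eq_smul_of_mul_eq {a a' : Coeff n} (ha : IsRat a)
    (e : numPoly a * denPoly a' = numPoly a' * denPoly a) : ∃ c : ℂ, a' = c • a := by
  obtain ⟨r, h1, h2⟩ := exists_mul_eq_of_coprime (isCoprime_numPoly_denPoly ha) e
  suffices hr : r.natDegree = 0 by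
    obtain ⟨c, rfl⟩ := Polynomial.natDegree_eq_zero.mp hr
    refine ⟨c, coeff_ext ?_ ?_⟩
    · rw [h1]
      refine Polynomial.funext fun z => ?_
      rw [Polynomial.eval_mul, Polynomial.eval_C, eval_numPoly, eval_numPoly, num_const_smul]
    · rw [h2]
      refine Polynomial.funext fun z => ?_
      rw [Polynomial.eval_mul, Polynomial.eval_C, eval_denPoly, eval_denPoly, den_const_smul]
  by_contra hr
  have hr0 : r ≠ 0 := fun h => hr (by rw [h, Polynomial.natDegree_zero])
  have key : ∀ p p' : Polynomial ℂ, p' = r * p → p'.natDegree ≤ n → p.coeff n = 0 := by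
    intro p p' hp hd
    by_cases hp0 : p = 0
    · rw [hp0, Polynomial.coeff_zero]
    rw [hp, Polynomial.natDegree_mul hr0 hp0] at hd
    exact Polynomial.coeff_eq_zero_of_natDegree_lt (by omega)
  have k1 := key _ _ h1 (natDegree_sum_pow_le _)
  have k2 := key _ _ h2 (natDegree_sum_pow_le _)
  have k1' := (coeff_numPoly a (Fin.last n)).symm.trans k1
  have k2' := (coeff_denPoly a (Fin.last n)).symm.trans k2
  rcases ha.1 with h | h
  · exact h k1'
  · refine h (Eq.trans (congrArg a (Fin.ext ?_)) k2')
    simp only [Fin.val_last]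
    omega

lemma ratMap_eq_iff {a a' : Coeff n} (ha : IsRat a) (ha' : IsRat a') :
    ratMap a = ratMap a' ↔ ∃ ξ : ℂ, ξ ≠ 0 ∧ a' = ξ • a := by
  constructor
  · intro h
    have e : numPoly a * denPoly a' = numPoly a' * denPoly a := by
      refine Polynomial.funext fun z => ?_
      have hz := congrFun h (sig z)
      rw [sig, ratMap_invStereo a (by simp), ratMap_invStereo a' (by simp),
        invStereo_eq_iff (ha.ne_zero (by simp)) (ha'.ne_zero (by simp))] at hz
      rw [Polynomial.eval_mul, Polynomial.eval_mul, eval_numPoly, eval_numPoly, eval_denPoly,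
        eval_denPoly, mul_comm, hz]
    obtain ⟨c, rfl⟩ := eq_smul_of_mul_eq ha e
    refine ⟨c, ?_, rfl⟩
    rintro rfl
    simpa using ha'.1
  · rintro ⟨c, hc, rfl⟩
    exact (ratMap_smul hc a).symm

/-- A common zero of numerator and denominator may be sought on the unit sphere of `ℂ²`, which is
compact. -/
lemma isOpen_isRat : IsOpen {a : Coeff n | IsRat a} := by
  rw [isOpen_iff_mem_nhds]
  intro a ha
  have hK : IsCompact (Metric.sphere (0 : ℂ × ℂ) 1) := isCompact_sphere _ _
  have hcn : Continuous fun p : Coeff n × (ℂ × ℂ) => num p.1 p.2.1 p.2.2 := by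
    unfold num
    fun_prop
  have hcd : Continuous fun p : Coeff n × (ℂ × ℂ) => den p.1 p.2.1 p.2.2 := by
    unfold den
    fun_prop
  have h1 := hK.eventually_forall_of_forall_eventually (x₀ := a)
    (P := fun a ξ => ¬ (num a ξ.1 ξ.2 = 0 ∧ den a ξ.1 ξ.2 = 0)) fun ξ hξ => by
      have hne : ¬ (ξ.1 = 0 ∧ ξ.2 = 0) := fun h => by
        have : ξ = 0 := Prod.ext h.1 h.2
        simp [this] at hξ
      have ho : IsOpen {p : Coeff n × (ℂ × ℂ) |
          ¬ (num p.1 p.2.1 p.2.2 = 0 ∧ den p.1 p.2.1 p.2.2 = 0)} :=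
        ((isClosed_eq hcn continuous_const).inter (isClosed_eq hcd continuous_const)).isOpen_compl
      exact ho.mem_nhds (x := (a, ξ)) (ha.ne_zero hne)
  filter_upwards [h1] with b hb
  refine isRat_of_ne_zero fun z w hzw h0 => ?_
  have hpos : ‖(z, w)‖ ≠ 0 := norm_ne_zero_iff.mpr fun h => hzw ⟨congrArg Prod.fst h,
    congrArg Prod.snd h⟩
  set c : ℂ := ((‖(z, w)‖⁻¹ : ℝ) : ℂ) with hcdef
  refine hb (c * z, c * w) ?_ ?_
  · have e : (c * z, c * w) = c • (z, w) := rfl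
    rw [mem_sphere_zero_iff_norm, e, norm_smul, hcdef, Complex.norm_real, norm_inv, norm_norm,
      inv_mul_cancel₀ hpos]
  · rw [num_smul, den_smul, h0.1, h0.2]
    simp

lemma isOpenInProjectiveSpace (hn : n ≠ 0) : IsOpenInProjectiveSpace n :=
  ⟨isOpen_isRat, M_eq_image_ratMap hn, fun _ _ => ratMap_eq_iff⟩

/-! ### Affine coordinates -/

lemma affine_same (k : Fin (2 * n + 1 + 1)) (b : Model n) : affine k b k = 1 :=
  Fin.insertNth_apply_same _ _ _

lemma affine_succAbove (k : Fin (2 * n + 1 + 1)) (b : Model n) (i : Fin (2 * n + 1)) :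
    affine k b (k.succAbove i) = b i :=
  Fin.insertNth_apply_succAbove _ _ _ _

lemma affine_eq_of {k : Fin (2 * n + 1 + 1)} {a : Coeff n} (h : a k = 1) :
    affine k (fun i => a (k.succAbove i)) = a := by
  funext j
  rcases Fin.eq_self_or_eq_succAbove k j with rfl | ⟨i, rfl⟩
  · rw [affine_same, h]
  · rw [affine_succAbove]

/-- The linear part of the affine map `affine k`. -/
def affineL (k : Fin (2 * n + 1 + 1)) : Model n →L[ℂ] Coeff n :=
  ContinuousLinearMap.pi
    (Fin.insertNth (α := fun _ => Model n →L[ℂ] ℂ) k 0 fun i => ContinuousLinearMap.proj i)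

lemma affineL_same (k : Fin (2 * n + 1 + 1)) (b : Model n) : affineL k b k = 0 := by
  simp [affineL]

lemma affineL_succAbove (k : Fin (2 * n + 1 + 1)) (b : Model n) (i : Fin (2 * n + 1)) :
    affineL k b (k.succAbove i) = b i := by
  simp [affineL]

lemma affine_eq (k : Fin (2 * n + 1 + 1)) (b : Model n) :
    affine k b = affine k 0 + affineL k b := by
  funext j
  rcases Fin.eq_self_or_eq_succAbove k j with rfl | ⟨i, rfl⟩
  · simp [affine_same, affineL_same]
  · simp [affine_succAbove, affineL_succAbove]

lemma contDiff_affine (k : Fin (2 * n + 1 + 1)) {m : WithTop ℕ∞} :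
    ContDiff ℂ m (affine (n := n) k) := by
  have : affine (n := n) k = fun b => affine k 0 + affineL k b := funext (affine_eq k)
  rw [this]
  exact contDiff_const.add (affineL k).contDiff

lemma hasFDerivAt_affine (k : Fin (2 * n + 1 + 1)) (b : Model n) :
    HasFDerivAt (affine (n := n) k) (affineL k) b := by
  have : affine (n := n) k = fun b => affine k 0 + affineL k b := funext (affine_eq k)
  rw [this]
  exact (affineL k).hasFDerivAt.const_add _

lemma isOpen_dom (k : Fin (2 * n + 1 + 1)) : IsOpen (dom n k) :=
  isOpen_isRat.preimage (contDiff_affine (m := 0) k).continuous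

lemma param_mem_M {k : Fin (2 * n + 1 + 1)} {b : Model n} (hb : b ∈ dom n k) : param k b ∈ M n :=
  ratMap_mem_M hb

lemma param_injective {k : Fin (2 * n + 1 + 1)} {b b' : Model n} (hb : b ∈ dom n k)
    (hb' : b' ∈ dom n k) (h : param k b = param k b') : b = b' := by
  obtain ⟨c, hc, e⟩ := (ratMap_eq_iff hb hb').mp h
  have h1 := congrFun e k
  rw [Pi.smul_apply, affine_same, affine_same, smul_eq_mul, mul_one] at h1
  funext i
  have h2 := congrFun e (k.succAbove i)
  rw [Pi.smul_apply, affine_succAbove, affine_succAbove, ← h1, one_smul] at h2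
  exact h2.symm

/-- Passage to affine coordinates of a vector of homogeneous coordinates. -/
lemma param_div {j : Fin (2 * n + 1 + 1)} {a : Coeff n} (ha : IsRat a) (h : a j ≠ 0) :
    (fun i => a (j.succAbove i) / a j) ∈ dom n j ∧
      param j (fun i => a (j.succAbove i) / a j) = ratMap a := by
  have e : affine j (fun i => a (j.succAbove i) / a j) = (a j)⁻¹ • a := by
    rw [← affine_eq_of (k := j) (a := (a j)⁻¹ • a) (by simp [h])]
    congr 1
    funext i
    simp [div_eq_inv_mul]
  constructor
  · change IsRat _
    rw [e]
    exact ha.smul (inv_ne_zero h)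
  · rw [param, e, ratMap_smul (inv_ne_zero h)]

/-! ### Smoothness of parametric integrals over a compact family -/

section ParametricIntegral

variable {E Y X F : Type} [NormedAddCommGroup E] [NormedSpace ℝ E]
  [NormedAddCommGroup Y] [NormedSpace ℝ Y]
  [MeasurableSpace X] {μ : Measure X}
  [NormedAddCommGroup F] [NormedSpace ℝ F]
  {K : Set Y} {U : Set E} {η : X → K} {G : E × Y → F}

/-- The partial derivative with respect to the first variable. -/
def pderiv (G : E × Y → F) (p : E × Y) : E →L[ℝ] F :=
  fderiv ℝ G p ∘L ContinuousLinearMap.inl ℝ E Y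

lemma contDiffAt_pderiv {p : E × Y} (h : ContDiffAt ℝ ∞ G p) : ContDiffAt ℝ ∞ (pderiv G) p :=
  (h.fderiv_right (m := ∞) (by simp)).clm_comp contDiffAt_const

lemma hasFDerivAt_pderiv {b : E} {ξ : Y} (h : ContDiffAt ℝ ∞ G (b, ξ)) :
    HasFDerivAt (fun b => G (b, ξ)) (pderiv G (b, ξ)) b :=
  (h.differentiableAt (by simp)).hasFDerivAt.comp b (hasFDerivAt_prodMk_left b ξ)

lemma pderiv_apply {b : E} {ξ : Y} (h : ContDiffAt ℝ ∞ G (b, ξ)) (u : E) :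
    pderiv G (b, ξ) u = fderiv ℝ (fun b => G (b, ξ)) b u := by
  rw [(hasFDerivAt_pderiv h).fderiv]

lemma pderiv_pderiv_symm {p : E × Y} (h : ContDiffAt ℝ ∞ G p) (u v : E) :
    pderiv (pderiv G) p u v = pderiv (pderiv G) p v u := by
  have hd : HasFDerivAt (fderiv ℝ G) (fderiv ℝ (fderiv ℝ G) p) p :=
    ((h.fderiv_right (m := ∞) (by simp)).differentiableAt (by simp)).hasFDerivAt
  have e : ∀ u v, pderiv (pderiv G) p u v = fderiv ℝ (fderiv ℝ G) p (u, 0) (v, 0) := by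
    intro u v
    have h2 : HasFDerivAt (pderiv G) _ p :=
      hd.clm_comp (hasFDerivAt_const (ContinuousLinearMap.inl ℝ E Y) p)
    rw [pderiv, h2.fderiv]
    simp
  rw [e, e]
  exact (h.isSymmSndFDerivAt (by simp; exact WithTop.coe_le_coe.mpr le_top)).eq _ _

/-- A local bound that is uniform in the second variable serves as the dominating function. -/
lemma exists_bound_of_contDiffAt [FiniteDimensional ℝ E] (hK : IsCompact K) (hU : IsOpen U)
    (hG : ∀ b ∈ U, ∀ ξ ∈ K, ContDiffAt ℝ ∞ G (b, ξ)) {b : E} (hb : b ∈ U) :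
    ∃ s ∈ 𝓝 b, s ⊆ U ∧ ∃ C, ∀ b' ∈ s, ∀ ξ ∈ K, ‖G (b', ξ)‖ ≤ C := by
  obtain ⟨ε, hε, hsub⟩ := Metric.nhds_basis_closedBall.mem_iff.mp (hU.mem_nhds hb)
  refine ⟨Metric.closedBall b ε, Metric.closedBall_mem_nhds b hε, hsub, ?_⟩
  have := ((isCompact_closedBall b ε).prod hK).exists_bound_of_continuousOn (f := G)
    fun p hp => (hG p.1 (hsub hp.1) p.2 hp.2).continuousAt.continuousWithinAt
  obtain ⟨C, hC⟩ := this
  exact ⟨C, fun b' hb' ξ hξ => hC (b', ξ) ⟨hb', hξ⟩⟩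

variable [MeasurableSpace Y] [BorelSpace Y] [SecondCountableTopology Y]

lemma aestronglyMeasurable_comp_family (hη : Measurable η)
    (hG : ∀ b ∈ U, ∀ ξ ∈ K, ContDiffAt ℝ ∞ G (b, ξ)) {b : E} (hb : b ∈ U) :
    AEStronglyMeasurable (fun x => G (b, η x)) μ := by
  have hc : Continuous fun ξ : K => G (b, ξ) := continuous_iff_continuousAt.mpr fun ξ =>
    ContinuousAt.comp (f := fun ξ : K => (b, (ξ : Y))) (hG b hb ξ ξ.2).continuousAt
      (by fun_prop)
  exact (hc.stronglyMeasurable.comp_measurable hη).aestronglyMeasurable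

variable [FiniteDimensional ℝ E] [IsFiniteMeasure μ]

lemma integrable_comp_family (hK : IsCompact K) (hU : IsOpen U) (hη : Measurable η)
    (hG : ∀ b ∈ U, ∀ ξ ∈ K, ContDiffAt ℝ ∞ G (b, ξ)) {b : E} (hb : b ∈ U) :
    Integrable (fun x => G (b, η x)) μ := by
  obtain ⟨s, hs, -, C, hC⟩ := exists_bound_of_contDiffAt hK hU hG hb
  exact Integrable.of_bound (aestronglyMeasurable_comp_family hη hG hb) C
    (ae_of_all _ fun x => hC b (mem_of_mem_nhds hs) _ (η x).2)

/-- Differentiation under the integral sign. The parameter `η` of the integrand is only measurable,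
but takes its values in a compact set on which `G` is smooth. -/
lemma hasFDerivAt_integral_family (hK : IsCompact K) (hU : IsOpen U) (hη : Measurable η)
    (hG : ∀ b ∈ U, ∀ ξ ∈ K, ContDiffAt ℝ ∞ G (b, ξ)) {b : E} (hb : b ∈ U) :
    HasFDerivAt (fun b => ∫ x, G (b, η x) ∂μ) (∫ x, pderiv G (b, η x) ∂μ) b := by
  have hG' : ∀ b ∈ U, ∀ ξ ∈ K, ContDiffAt ℝ ∞ (pderiv G) (b, ξ) :=
    fun b hb ξ hξ => contDiffAt_pderiv (hG b hb ξ hξ)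
  obtain ⟨s, hs, hsU, C, hC⟩ := exists_bound_of_contDiffAt hK hU hG' hb
  refine hasFDerivAt_integral_of_dominated_of_fderiv_le (bound := fun _ => C) hs ?_
    (integrable_comp_family hK hU hη hG hb) (aestronglyMeasurable_comp_family hη hG' hb)
    (ae_of_all _ fun x b' hb' => hC b' hb' _ (η x).2) (integrable_const C)
    (ae_of_all _ fun x b' hb' => hasFDerivAt_pderiv (hG b' (hsU hb') _ (η x).2))
  filter_upwards [hU.mem_nhds hb] with b' hb'
  exact aestronglyMeasurable_comp_family hη hG hb'

/-- Smoothness of the integral, by induction on the order: the derivative is again such an integral.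
-/
lemma contDiffOn_integral_family (hK : IsCompact K) (hU : IsOpen U) (hη : Measurable η)
    (hG : ∀ b ∈ U, ∀ ξ ∈ K, ContDiffAt ℝ ∞ G (b, ξ)) :
    ContDiffOn ℝ ∞ (fun b => ∫ x, G (b, η x) ∂μ) U := by
  rw [contDiffOn_infty]
  intro m
  induction m generalizing F with
  | zero =>
    rw [Nat.cast_zero, contDiffOn_zero]
    exact fun b hb =>
      (hasFDerivAt_integral_family hK hU hη hG hb).continuousAt.continuousWithinAt
  | succ m ih =>
    rw [Nat.cast_succ, contDiffOn_succ_iff_fderiv_of_isOpen hU]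
    refine ⟨fun b hb => (hasFDerivAt_integral_family hK hU hη hG
      hb).differentiableAt.differentiableWithinAt, fun h => by simp at h, ?_⟩
    refine (ih (G := pderiv G) fun b hb ξ hξ => contDiffAt_pderiv (hG b hb ξ hξ)).congr
      fun b hb => (hasFDerivAt_integral_family hK hU hη hG hb).fderiv

end ParametricIntegral

/-! ### Variations of rational maps -/

/-- The numerator, as a linear function of the coefficients. -/
def numL (z w : ℂ) : Coeff n →L[ℂ] ℂ :=
  LinearMap.toContinuousLinearMap
    { toFun := fun a => num a z w
      map_add' := fun a a' => by simp [num, add_mul, Finset.sum_add_distrib]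
      map_smul' := fun c a => num_const_smul c a z w }

/-- The denominator, as a linear function of the coefficients. -/
def denL (z w : ℂ) : Coeff n →L[ℂ] ℂ :=
  LinearMap.toContinuousLinearMap
    { toFun := fun a => den a z w
      map_add' := fun a a' => by simp [den, add_mul, Finset.sum_add_distrib]
      map_smul' := fun c a => den_const_smul c a z w }

/-- The family of maps in the `k`-th chart, in homogeneous coordinates on the sphere. Unlike
`param k b x`, it is jointly smooth in `b` and these coordinates. -/
def family (k : Fin (2 * n + 1 + 1)) (p : Model n × (ℂ × ℂ)) : E3 :=
  invStereoVec (num (affine k p.1) p.2.1 p.2.2) (den (affine k p.1) p.2.1 p.2.2)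

lemma contDiffAt_family {k : Fin (2 * n + 1 + 1)} {b : Model n} (hb : b ∈ dom n k) {ξ : ℂ × ℂ}
    (hξ : ¬ (ξ.1 = 0 ∧ ξ.2 = 0)) : ContDiffAt ℝ ∞ (family k) (b, ξ) := by
  have ha : ∀ i, ContDiff ℝ ∞ fun p : Model n × (ℂ × ℂ) => affine k p.1 i := fun i =>
    (contDiff_pi.mp ((contDiff_affine (m := ∞) k).restrict_scalars ℝ) i).comp contDiff_fst
  refine contDiffAt_invStereoVec ?_ ?_ (IsRat.ne_zero hb hξ)
  · unfold num
    refine ContDiff.contDiffAt (ContDiff.sum fun i _ => ?_)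
    exact ((ha _).mul (contDiff_snd.fst.pow _)).mul (contDiff_snd.snd.pow _)
  · unfold den
    refine ContDiff.contDiffAt (ContDiff.sum fun i _ => ?_)
    exact ((ha _).mul (contDiff_snd.fst.pow _)).mul (contDiff_snd.snd.pow _)

/-- By the linearity of numerator and denominator in the coefficients, the variation of a rational
map `P / Q` in the direction `(P', Q')` is the image of `Q P' - P Q'`. -/
lemma pderiv_family {k : Fin (2 * n + 1 + 1)} {b : Model n} (hb : b ∈ dom n k) {ξ : ℂ × ℂ}
    (hξ : ¬ (ξ.1 = 0 ∧ ξ.2 = 0)) (u : Model n) : pderiv (family k) (b, ξ) u =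
      stereoD (num (affine k b) ξ.1 ξ.2) (den (affine k b) ξ.1 ξ.2)
        (den (affine k b) ξ.1 ξ.2 * num (affineL k u) ξ.1 ξ.2 -
          num (affine k b) ξ.1 ξ.2 * den (affineL k u) ξ.1 ξ.2) := by
  rw [pderiv_apply (contDiffAt_family hb hξ)]
  have hN := (((numL ξ.1 ξ.2).hasFDerivAt.comp b (hasFDerivAt_affine k b)).restrictScalars ℝ)
  have hD := (((denL ξ.1 ξ.2).hasFDerivAt.comp b (hasFDerivAt_affine k b)).restrictScalars ℝ)
  exact congrArg (fun L => L u)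
    (hasFDerivAt_invStereoVec hN hD (IsRat.ne_zero (a := affine k b) hb hξ)).fderiv

lemma inner_family {k : Fin (2 * n + 1 + 1)} {b : Model n} (hb : b ∈ dom n k) {ξ : ℂ × ℂ}
    (hξ : ¬ (ξ.1 = 0 ∧ ξ.2 = 0)) : inner ℝ (family k (b, ξ)) (family k (b, ξ)) = 1 :=
  inner_invStereoVec (IsRat.ne_zero hb hξ)

lemma inner_family_pderiv {k : Fin (2 * n + 1 + 1)} {b : Model n} (hb : b ∈ dom n k) {ξ : ℂ × ℂ}
    (hξ : ¬ (ξ.1 = 0 ∧ ξ.2 = 0)) (u : Model n) :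
    inner ℝ (family k (b, ξ)) (pderiv (family k) (b, ξ) u) = 0 := by
  rw [pderiv_family hb hξ]
  exact inner_invStereoVec_stereoD (IsRat.ne_zero hb hξ) _

/-- The complex structure rotates variations by a right angle in the tangent planes of the
target. -/
lemma pderiv_family_I_smul {k : Fin (2 * n + 1 + 1)} {b : Model n} (hb : b ∈ dom n k)
    {ξ : ℂ × ℂ} (hξ : ¬ (ξ.1 = 0 ∧ ξ.2 = 0)) (u : Model n) :
    pderiv (family k) (b, ξ) (Complex.I • u) =
      -cr (family k (b, ξ)) (pderiv (family k) (b, ξ) u) := by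
  rw [pderiv_family hb hξ, pderiv_family hb hξ, map_smul, num_const_smul, den_const_smul, family,
    ← stereoD_I_mul (IsRat.ne_zero (a := affine k b) hb hξ)]
  congr 1
  ring

/-- The unit sphere of `ℂ²` (for the maximum norm). -/
abbrev Sph : Set (ℂ × ℂ) := Metric.sphere (0 : ℂ × ℂ) 1

lemma Sph.ne {ξ : ℂ × ℂ} (hξ : ξ ∈ Sph) : ¬ (ξ.1 = 0 ∧ ξ.2 = 0) := fun h => by
  have : ξ = 0 := Prod.ext h.1 h.2
  simp [Sph, this] at hξ

lemma homog_ne_zero (x : S2) : homog x ≠ 0 := fun h => homog_ne x ⟨congrArg Prod.fst h,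
  congrArg Prod.snd h⟩

/-- Homogeneous coordinates of a point of the sphere, normalized to norm one. They are measurable
(but not continuous at the north pole) and lie in a compact set. -/
def unitHomog (x : S2) : Sph :=
  ⟨((‖homog x‖⁻¹ : ℝ) : ℂ) • homog x, by
    rw [Sph, mem_sphere_zero_iff_norm, norm_smul, Complex.norm_real, norm_inv, norm_norm,
      inv_mul_cancel₀ (norm_ne_zero_iff.mpr (homog_ne_zero x))]⟩

lemma unitHomog_sig (z : ℂ) : ∃ t : ℂ, t ≠ 0 ∧ (unitHomog (sig z) : ℂ × ℂ).1 = t * z ∧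
    (unitHomog (sig z) : ℂ × ℂ).2 = t * 1 := by
  obtain ⟨d, hd, h1, h2⟩ := homog_invStereo (p := z) (q := 1) (by simp)
  have hc : ((‖homog (sig z)‖⁻¹ : ℝ) : ℂ) ≠ 0 := by
    rw [Complex.ofReal_ne_zero]
    exact inv_ne_zero (norm_ne_zero_iff.mpr (homog_ne_zero _))
  refine ⟨_ * d, mul_ne_zero hc hd, ?_, ?_⟩
  · rw [mul_assoc, ← h1]
    rfl
  · rw [mul_assoc, ← h2]
    rfl

lemma measurable_homog : Measurable homog := by
  have hc : ∀ i : Fin 3, Measurable fun x : S2 => (x : E3) i := fun i =>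
    (by fun_prop : Continuous fun x : S2 => (x : E3) i).measurable
  unfold homog
  refine Measurable.ite (measurableSet_eq_fun (hc 2) measurable_const) measurable_const ?_
  refine Measurable.prodMk ?_ (Complex.measurable_ofReal.comp (measurable_const.sub (hc 2)))
  exact Complex.measurableEquivRealProd.symm.measurable.comp ((hc 0).prodMk (hc 1))

lemma measurable_unitHomog : Measurable unitHomog := by
  refine Measurable.subtype_mk ?_
  exact (Complex.measurable_ofReal.comp measurable_homog.norm.inv).smul measurable_homog

/-- The family is homogeneous of degree zero, so that any homogeneous coordinates may be inserted.
-/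
lemma param_eq_family {k : Fin (2 * n + 1 + 1)} {b : Model n} (hb : b ∈ dom n k) (x : S2) :
    ((param k b x : S2) : E3) = family k (b, unitHomog x) := by
  have hc : ((‖homog x‖⁻¹ : ℝ) : ℂ) ≠ 0 := by
    rw [Complex.ofReal_ne_zero]
    exact inv_ne_zero (norm_ne_zero_iff.mpr (homog_ne_zero x))
  rw [param, ratMap, invStereo_coe (IsRat.ne_zero hb (homog_ne x)), family]
  simp only [unitHomog, Prod.smul_fst, Prod.smul_snd, smul_eq_mul]
  rw [num_smul, den_smul, invStereoVec_smul (pow_ne_zero n hc)]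

lemma hasFDerivAt_param {k : Fin (2 * n + 1 + 1)} {b : Model n} (hb : b ∈ dom n k) (x : S2) :
    HasFDerivAt (fun b' : Model n => ((param k b' x : S2) : E3))
      (pderiv (family k) (b, unitHomog x)) b :=
  (hasFDerivAt_pderiv (contDiffAt_family hb (Sph.ne (unitHomog x).2))).congr_of_eventuallyEq (by
    filter_upwards [(isOpen_dom k).mem_nhds hb] with b' hb' using param_eq_family hb' x)

lemma variation_eq {k : Fin (2 * n + 1 + 1)} {b : Model n} (hb : b ∈ dom n k) (u : Model n)
    (x : S2) : variation k b u x = pderiv (family k) (b, unitHomog x) u := by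
  rw [variation, (hasFDerivAt_param hb x).fderiv]

/-! ### The `L²` metric -/

/-- The integrand of the `L²` metric. -/
def density (k : Fin (2 * n + 1 + 1)) (u v : Model n) (p : Model n × (ℂ × ℂ)) : ℝ :=
  inner ℝ (pderiv (family k) p u) (pderiv (family k) p v)

lemma contDiffAt_density {k : Fin (2 * n + 1 + 1)} (u v : Model n) :
    ∀ b ∈ dom n k, ∀ ξ ∈ Sph, ContDiffAt ℝ ∞ (density k u v) (b, ξ) := by
  intro b hb ξ hξ
  have h := contDiffAt_pderiv (contDiffAt_family hb (Sph.ne hξ))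
  exact (h.clm_apply contDiffAt_const).inner ℝ (h.clm_apply contDiffAt_const)

lemma gam_eq {k : Fin (2 * n + 1 + 1)} {b : Model n} (hb : b ∈ dom n k) (u v : Model n) :
    gam k b u v = ∫ x : S2, density k u v (b, unitHomog x) ∂((volume : Measure E3).toSphere) := by
  simp only [gam, variation_eq hb, density]

lemma integrable_variation {k : Fin (2 * n + 1 + 1)} {b : Model n} (hb : b ∈ dom n k)
    (u v : Model n) : Integrable (fun x : S2 => inner ℝ (variation k b u x) (variation k b v x))
      ((volume : Measure E3).toSphere) := by
  simp only [variation_eq hb]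
  exact integrable_comp_family (isCompact_sphere _ _) (isOpen_dom k) measurable_unitHomog
    (contDiffAt_density u v) hb

lemma contDiffOn_gam (k : Fin (2 * n + 1 + 1)) (u v : Model n) :
    ContDiffOn ℝ ∞ (fun b => gam k b u v) (dom n k) :=
  (contDiffOn_integral_family (isCompact_sphere _ _) (isOpen_dom k) measurable_unitHomog
    (contDiffAt_density u v)).congr fun _ hb => gam_eq hb u v

lemma hasFDerivAt_gam {k : Fin (2 * n + 1 + 1)} {b : Model n} (hb : b ∈ dom n k) (u v : Model n) :
    HasFDerivAt (fun y => gam k y u v)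
      (∫ x : S2, pderiv (density k u v) (b, unitHomog x) ∂((volume : Measure E3).toSphere)) b :=
  (hasFDerivAt_integral_family (isCompact_sphere _ _) (isOpen_dom k) measurable_unitHomog
    (contDiffAt_density u v) hb).congr_of_eventuallyEq (by
    filter_upwards [(isOpen_dom k).mem_nhds hb] with y hy using gam_eq hy u v)

lemma fderiv_gam {k : Fin (2 * n + 1 + 1)} {b : Model n} (hb : b ∈ dom n k) (u v w : Model n) :
    fderiv ℝ (fun y => gam k y u v) b w =
      ∫ x : S2, pderiv (density k u v) (b, unitHomog x) w ∂((volume : Measure E3).toSphere) := by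
  rw [(hasFDerivAt_gam hb u v).fderiv, ContinuousLinearMap.integral_apply]
  exact integrable_comp_family (isCompact_sphere _ _) (isOpen_dom k) measurable_unitHomog
    (fun b hb ξ hξ => contDiffAt_pderiv (contDiffAt_density u v b hb ξ hξ)) hb

lemma gam_comm (k : Fin (2 * n + 1 + 1)) (b u v : Model n) : gam k b u v = gam k b v u := by
  simp only [gam, real_inner_comm]

lemma gam_add_left {k : Fin (2 * n + 1 + 1)} {b : Model n} (hb : b ∈ dom n k) (u u' v : Model n) :
    gam k b (u + u') v = gam k b u v + gam k b u' v := by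
  rw [gam, gam, gam, ← integral_add (integrable_variation hb _ _) (integrable_variation hb _ _)]
  simp only [variation, map_add, inner_add_left]

lemma gam_smul_left (k : Fin (2 * n + 1 + 1)) (b : Model n) (c : ℝ) (u v : Model n) :
    gam k b (c • u) v = c * gam k b u v := by
  rw [gam, gam, ← integral_const_mul]
  simp only [variation, map_smul, real_inner_smul_left]

/-- The metric is Hermitian, because rotations are isometric. -/
lemma gam_I_smul {k : Fin (2 * n + 1 + 1)} {b : Model n} (hb : b ∈ dom n k) (u v : Model n) :
    gam k b (Complex.I • u) (Complex.I • v) = gam k b u v := by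
  rw [gam_eq hb, gam_eq hb]
  refine integral_congr_ae (ae_of_all _ fun x => ?_)
  have hξ := Sph.ne (unitHomog x).2
  simp only [density]
  rw [pderiv_family_I_smul hb hξ, pderiv_family_I_smul hb hξ, inner_neg_neg, inner_cr_cr,
    inner_family hb hξ, inner_family_pderiv hb hξ]
  ring

/-- If the integrand of `γ(u, u)` vanishes almost everywhere, the polynomial `Q P' - P Q'`
describing the variation has infinitely many roots; hence it is zero, and `(P', Q')` is proportional
to `(P, Q)`. This is impossible for the tangent vectors of an affine chart, whose `k`-th entry is
zero. -/
lemma gam_pos {k : Fin (2 * n + 1 + 1)} {b : Model n} (hb : b ∈ dom n k) {u : Model n}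
    (hu : u ≠ 0) : 0 < gam k b u u := by
  have hnn : ∀ x, 0 ≤ inner ℝ (variation k b u x) (variation k b u x) :=
    fun x => real_inner_self_nonneg
  refine lt_of_le_of_ne (integral_nonneg hnn) fun h0 => hu ?_
  have hae := (integral_eq_zero_iff_of_nonneg hnn (integrable_variation hb u u)).mp h0.symm
  set R : Polynomial ℂ := denPoly (affine k b) * numPoly (affineL k u) -
    numPoly (affine k b) * denPoly (affineL k u) with hR
  have hzero : ∀ z, variation k b u (sig z) = 0 → R.eval z = 0 := by
    intro z hz
    obtain ⟨t, ht, h1, h2⟩ := unitHomog_sig z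
    rw [variation_eq hb, pderiv_family hb (Sph.ne (unitHomog _).2),
      stereoD_eq_zero (IsRat.ne_zero (a := affine k b) hb (Sph.ne (unitHomog _).2)), h1, h2,
      num_smul, num_smul, den_smul, den_smul] at hz
    rw [hR, Polynomial.eval_sub, Polynomial.eval_mul, Polynomial.eval_mul, eval_numPoly,
      eval_numPoly, eval_denPoly, eval_denPoly]
    have h3 : t ^ n * t ^ n ≠ 0 := mul_ne_zero (pow_ne_zero n ht) (pow_ne_zero n ht)
    refine (mul_eq_zero.mp ?_).resolve_left h3
    linear_combination hz
  have hR0 : R = 0 := by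
    by_contra hR0
    have hfin : (sig '' {z | R.IsRoot z} ∪ {north}).Finite :=
      ((Polynomial.finite_setOfPred_isRoot hR0).image _).union (finite_singleton _)
    have hnull : ((volume : Measure E3).toSphere) (sig '' {z | R.IsRoot z} ∪ {north})ᶜ = 0 := by
      refine measure_mono_null (fun x hx => ?_) hae
      intro hx0
      apply hx
      rcases sig_or_north x with ⟨z, rfl⟩ | rfl
      · exact Or.inl ⟨z, hzero z (inner_self_eq_zero.mp hx0), rfl⟩
      · exact Or.inr rfl
    have hinf : (range sig).Infinite := infinite_range_of_injective sig_injective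
    obtain ⟨x, -, hx⟩ := hinf.exists_notMem_finite hfin
    exact (hfin.isClosed.isOpen_compl.measure_pos _ ⟨x, hx⟩).ne' hnull
  obtain ⟨c, hc⟩ := eq_smul_of_mul_eq (a := affine k b) (a' := affineL k u) hb (by
    linear_combination -hR0 + hR)
  have hc0 := congrFun hc k
  rw [affineL_same, Pi.smul_apply, affine_same, smul_eq_mul, mul_one] at hc0
  funext i
  have hi := congrFun hc (k.succAbove i)
  rw [affineL_succAbove, ← hc0, zero_smul] at hi
  exact hi

/-! ### The Kähler form is closed -/

/-- The derivative of the integrand of `Ω(v, w) = γ(i v, w)` in the direction `u`. The integrand is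
minus the determinant of the map and its derivatives in the directions `v` and `w`; the term in
which the map itself is differentiated is the determinant of three tangent vectors. -/
lemma pderiv_density {k : Fin (2 * n + 1 + 1)} {b : Model n} (hb : b ∈ dom n k) {ξ : ℂ × ℂ}
    (hξS : ξ ∈ Sph) (u v w : Model n) :
    pderiv (density k (Complex.I • v) w) (b, ξ) u =
      -(inner ℝ (cr (family k (b, ξ)) (pderiv (pderiv (family k)) (b, ξ) u v))
          (pderiv (family k) (b, ξ) w) +
        inner ℝ (cr (family k (b, ξ)) (pderiv (family k) (b, ξ) v))
          (pderiv (pderiv (family k)) (b, ξ) u w)) := by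
  have hξ := Sph.ne hξS
  have hsm := contDiffAt_family hb hξ
  have h0 := hasFDerivAt_pderiv hsm
  have h1 := hasFDerivAt_pderiv (contDiffAt_pderiv hsm)
  have hv := h1.clm_apply (hasFDerivAt_const v b)
  have hw := h1.clm_apply (hasFDerivAt_const w b)
  have hd := ((cr.hasFDerivAt_of_bilinear h0 hv).inner ℝ hw).neg
  have he : (fun b => density k (Complex.I • v) w (b, ξ)) =ᶠ[𝓝 b] fun b =>
      -inner ℝ (cr (family k (b, ξ)) (pderiv (family k) (b, ξ) v))
        (pderiv (family k) (b, ξ) w) := by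
    filter_upwards [(isOpen_dom k).mem_nhds hb] with y hy
    rw [density, pderiv_family_I_smul hy hξ, inner_neg_left]
  -- three vectors in the tangent plane of the sphere have zero determinant
  have hz : inner ℝ (cr (pderiv (family k) (b, ξ) u) (pderiv (family k) (b, ξ) v))
      (pderiv (family k) (b, ξ) w) = 0 := by
    rw [real_inner_comm]
    exact inner_cr_eq_zero_of_perp (inner_family hb hξ) (inner_family_pderiv hb hξ w)
      (inner_family_pderiv hb hξ u) (inner_family_pderiv hb hξ v)
  rw [pderiv_apply (contDiffAt_density _ _ b hb ξ hξS), he.fderiv_eq]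
  erw [hd.fderiv]
  simp [inner_add_left, hz]
  ring

/-- The integrand of `dΩ` vanishes pointwise: in the cyclic sum the second derivatives of the family
cancel by their symmetry. -/
lemma kahlerForm_closed {k : Fin (2 * n + 1 + 1)} {b : Model n} (hb : b ∈ dom n k)
    (u v w : Model n) :
    fderiv ℝ (fun y => kahlerForm k y v w) b u + fderiv ℝ (fun y => kahlerForm k y w u) b v +
        fderiv ℝ (fun y => kahlerForm k y u v) b w = 0 := by
  simp only [kahlerForm]
  have hint : ∀ u v w : Model n, Integrable
      (fun x : S2 => pderiv (density k (Complex.I • v) w) (b, unitHomog x) u)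
      ((volume : Measure E3).toSphere) := fun u v w =>
    (integrable_comp_family (isCompact_sphere _ _) (isOpen_dom k) measurable_unitHomog
      (fun b hb ξ hξ => contDiffAt_pderiv (contDiffAt_density (Complex.I • v) w b hb ξ hξ))
      hb).apply_continuousLinearMap u
  rw [fderiv_gam hb, fderiv_gam hb, fderiv_gam hb, ← integral_add (hint _ _ _) (hint _ _ _)]
  refine (integral_add ((hint u v w).add (hint v w u)) (hint w u v)).symm.trans ?_
  refine integral_eq_zero_of_ae (ae_of_all _ fun x => ?_)
  have hξ := (unitHomog x).2
  have hsm := contDiffAt_family hb (Sph.ne hξ)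
  simp only [Pi.zero_apply, Pi.add_apply]
  rw [pderiv_density hb hξ, pderiv_density hb hξ, pderiv_density hb hξ,
    pderiv_pderiv_symm hsm v u, pderiv_pderiv_symm hsm w u, pderiv_pderiv_symm hsm w v]
  simp only [inner_coord, cr_zero', cr_one', cr_two']
  ring

lemma isKahler (n : ℕ) : IsKahler n := fun k =>
  ⟨fun _ hb => integrable_variation hb, contDiffOn_gam k, fun _ hb _ => gam_pos hb,
    fun _ hb => gam_I_smul hb, fun _ hb => kahlerForm_closed hb⟩

/-! ### Conjugation by the antipodal map -/

/-- In the stereographic coordinate, the antipodal map is `z ↦ -1 / z̄`. -/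
lemma neg_invStereo {p q : ℂ} (h : ¬ (p = 0 ∧ q = 0)) :
    -invStereo p q = invStereo (-starRingEnd ℂ q) (starRingEnd ℂ p) := by
  have h' : ¬ (-starRingEnd ℂ q = 0 ∧ starRingEnd ℂ p = 0) := by
    simpa [and_comm] using h
  apply Subtype.ext
  rw [coe_neg_sphere, invStereo_coe h, invStereo_coe h']
  apply ext3 <;>
    simp only [invStereoVec, PiLp.neg_apply, PiLp.smul_apply, smul_eq_mul, Matrix.cons_val_zero,
      Matrix.cons_val_one, Matrix.cons_val, Complex.normSq_neg, Complex.normSq_conj,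
      Complex.mul_re, Complex.mul_im, Complex.neg_re, Complex.neg_im, Complex.conj_re,
      Complex.conj_im] <;> ring

/-- The sign with which the `i`-th coefficient is multiplied in the conjugation by the antipodal
map, for odd `n`. -/
def coeffSign (n : ℕ) (i : Fin (2 * n + 1 + 1)) : ℂ :=
  if (i : ℕ) ≤ n then (-1) ^ (i : ℕ) else -(-1) ^ (i : ℕ)

lemma coeffSign_mul_self (i : Fin (2 * n + 1 + 1)) : coeffSign n i * coeffSign n i = 1 := by
  unfold coeffSign
  split_ifs <;> simp [← pow_add, ← two_mul]

lemma star_coeffSign (i : Fin (2 * n + 1 + 1)) :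
    starRingEnd ℂ (coeffSign n i) = coeffSign n i := by
  unfold coeffSign
  split_ifs <;> simp

/-- The signs are symmetric under reversal of the order of the coefficients, which makes `antiCoeff`
an involution. -/
lemma coeffSign_rev (i : Fin (2 * n + 1 + 1)) : coeffSign n i.rev = coeffSign n i := by
  have hi := i.isLt
  have hr : (i.rev : ℕ) = 2 * n + 1 - i := by rw [Fin.val_rev]; omega
  unfold coeffSign
  rw [hr]
  rcases Nat.even_or_odd (i : ℕ) with he | ho
  · have h1 : Odd (2 * n + 1 - (i : ℕ)) := by
      obtain ⟨m, hm⟩ := he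
      exact ⟨n - m, by omega⟩
    rw [he.neg_one_pow, h1.neg_one_pow]
    split_ifs <;> first | omega | simp
  · have h1 : Even (2 * n + 1 - (i : ℕ)) := by
      obtain ⟨m, hm⟩ := ho
      exact ⟨n - m, by omega⟩
    rw [ho.neg_one_pow, h1.neg_one_pow]
    split_ifs <;> first | omega | simp

/-- The antilinear involution of the space of coefficient vectors which induces
`f ↦ p ∘ f ∘ p`. -/
def antiCoeff : Coeff n →L[ℝ] Coeff n :=
  LinearMap.toContinuousLinearMap
    { toFun := fun a i => coeffSign n i * starRingEnd ℂ (a i.rev)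
      map_add' := fun a a' => by funext i; simp [mul_add]
      map_smul' := fun c a => by funext i; simp; ring }

lemma antiCoeff_apply (a : Coeff n) (i : Fin (2 * n + 1 + 1)) :
    antiCoeff a i = coeffSign n i * starRingEnd ℂ (a i.rev) := rfl

lemma antiCoeff_antiCoeff (a : Coeff n) : antiCoeff (antiCoeff a) = a := by
  funext i
  rw [antiCoeff_apply, antiCoeff_apply, map_mul, star_coeffSign, coeffSign_rev, Fin.rev_rev,
    Complex.conj_conj, ← mul_assoc, coeffSign_mul_self, one_mul]

/-- For odd `n` the numerator of the conjugate map at `z` is, up to the factor `zⁿ`, minus the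
complex conjugate of `Q (-1 / z̄)`. -/
lemma num_antiCoeff (hn : Odd n) (a : Coeff n) (z w : ℂ) : num (antiCoeff a) z w =
    -starRingEnd ℂ (den a (-starRingEnd ℂ w) (starRingEnd ℂ z)) := by
  unfold num den
  rw [map_sum, ← Finset.sum_neg_distrib, ← Equiv.sum_comp Fin.revPerm]
  refine Finset.sum_congr rfl fun i _ => ?_
  have hi := i.isLt
  have e1 : ((Fin.revPerm i : Fin (n + 1)) : ℕ) = n - i := by
    rw [Fin.revPerm_apply, Fin.val_rev]; omega
  have e2 : n - (n - (i : ℕ)) = i := by omega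
  rw [antiCoeff_apply]
  have e3 : (⟨(Fin.revPerm i : Fin (n + 1)), by omega⟩ : Fin (2 * n + 1 + 1)).rev =
      ⟨n + 1 + i, by omega⟩ := by
    apply Fin.ext
    rw [Fin.val_rev]
    simp only [e1]
    omega
  rw [e3, coeffSign]
  simp only [e1, e2, map_mul, map_pow, map_neg, Complex.conj_conj]
  rw [if_pos (by omega), neg_pow w]
  have : (-1 : ℂ) ^ (n - (i : ℕ)) = -(-1) ^ (i : ℕ) := by
    have h2 : (-1 : ℂ) ^ (n - (i : ℕ)) * (-1) ^ (i : ℕ) = -1 := by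
      rw [← pow_add, Nat.sub_add_cancel (by omega), hn.neg_one_pow]
    have h3 : (-1 : ℂ) ^ (i : ℕ) * (-1) ^ (i : ℕ) = 1 := by
      rw [← pow_add, ← two_mul, pow_mul]; simp
    linear_combination (-1 : ℂ) ^ (i : ℕ) * h2 - (-1 : ℂ) ^ (n - (i : ℕ)) * h3
  rw [this]
  ring

lemma den_antiCoeff (hn : Odd n) (a : Coeff n) (z w : ℂ) : den (antiCoeff a) z w =
    starRingEnd ℂ (num a (-starRingEnd ℂ w) (starRingEnd ℂ z)) := by
  have h := num_antiCoeff hn (antiCoeff a) (-starRingEnd ℂ w) (starRingEnd ℂ z)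
  rw [antiCoeff_antiCoeff] at h
  simp only [h, map_neg, Complex.conj_conj]
  have h2 : den (antiCoeff a) (-z) (-w) = (-1) ^ n * den (antiCoeff a) z w := by
    rw [← den_smul, neg_one_mul, neg_one_mul]
  rw [h2, hn.neg_one_pow]
  ring

lemma IsRat.antiCoeff (hn : Odd n) {a : Coeff n} (ha : IsRat a) : IsRat (antiCoeff a) := by
  refine isRat_of_ne_zero fun z w hzw => ?_
  rw [num_antiCoeff hn, den_antiCoeff hn]
  have := ha.ne_zero (z := -starRingEnd ℂ w) (w := starRingEnd ℂ z) (by simpa [and_comm] using hzw)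
  simpa [and_comm] using this

/-- On coefficient vectors, the conjugation by the antipodal map is the antilinear map `antiCoeff`.
-/
lemma conjAntipodal_ratMap (hn : Odd n) {a : Coeff n} (ha : IsRat a) :
    conjAntipodal (ratMap a) = ratMap (antiCoeff a) := by
  funext x
  have hx := homog_ne x
  rw [conjAntipodal, ← invStereo_homog x, neg_invStereo hx,
    ratMap_invStereo a (by simpa [and_comm] using hx), ratMap_invStereo (antiCoeff a) hx,
    num_antiCoeff hn, den_antiCoeff hn]
  exact neg_invStereo (ha.ne_zero (by simpa [and_comm] using hx))

lemma conjAntipodal_conjAntipodal (f : S2 → S2) : conjAntipodal (conjAntipodal f) = f := by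
  funext x
  simp [conjAntipodal]

lemma bijOn_conjAntipodal (hn : Odd n) : BijOn conjAntipodal (M n) (M n) := by
  have hm : MapsTo conjAntipodal (M n) (M n) := by
    rw [M_eq_image_ratMap hn.pos.ne']
    rintro _ ⟨a, ha, rfl⟩
    exact ⟨antiCoeff a, ha.antiCoeff hn, (conjAntipodal_ratMap hn ha).symm⟩
  exact InvOn.bijOn (f' := conjAntipodal) ⟨fun f _ => conjAntipodal_conjAntipodal f,
    fun f _ => conjAntipodal_conjAntipodal f⟩ hm hm

/-- The coordinate expression of `f ↦ p ∘ f ∘ p` from the `k`-th to the `j`-th chart. -/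
def antiMap (k j : Fin (2 * n + 1 + 1)) (y : Model n) : Model n :=
  fun i => antiCoeff (affine k y) (j.succAbove i) / antiCoeff (affine k y) j

/-- The part of the `k`-th chart which `f ↦ p ∘ f ∘ p` maps to the `j`-th chart. -/
def antiDom (k j : Fin (2 * n + 1 + 1)) : Set (Model n) :=
  {y | y ∈ dom n k ∧ antiCoeff (affine k y) j ≠ 0}

lemma isOpen_antiDom (k j : Fin (2 * n + 1 + 1)) : IsOpen (antiDom k j) := by
  refine (isOpen_dom k).inter (isOpen_ne_fun ?_ continuous_const)
  exact (continuous_apply j).comp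
    (antiCoeff.continuous.comp (contDiff_affine (m := 0) k).continuous)

lemma antiMap_mem (hn : Odd n) {k j : Fin (2 * n + 1 + 1)} {y : Model n} (hy : y ∈ antiDom k j) :
    antiMap k j y ∈ dom n j ∧ param j (antiMap k j y) = conjAntipodal (param k y) := by
  have := param_div (IsRat.antiCoeff hn hy.1) hy.2
  refine ⟨this.1, this.2.trans ?_⟩
  rw [param, conjAntipodal_ratMap hn hy.1]

/-- Any two charts around a map and its conjugate may be used to express the conjugation. -/
lemma mem_antiDom (hn : Odd n) {k j : Fin (2 * n + 1 + 1)} {b b' : Model n} (hb : b ∈ dom n k)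
    (hb' : b' ∈ dom n j) (h : param j b' = conjAntipodal (param k b)) :
    b ∈ antiDom k j ∧ antiMap k j b = b' := by
  have hb2 : b ∈ antiDom k j := by
    refine ⟨hb, ?_⟩
    rw [param, param, conjAntipodal_ratMap hn hb] at h
    obtain ⟨c, hc, e⟩ := (ratMap_eq_iff hb' (IsRat.antiCoeff hn hb)).mp h
    rw [e, Pi.smul_apply, affine_same, smul_eq_mul, mul_one]
    exact hc
  exact ⟨hb2, param_injective (antiMap_mem hn hb2).1 hb' ((antiMap_mem hn hb2).2.trans h.symm)⟩

lemma contDiffAt_antiMap {k j : Fin (2 * n + 1 + 1)} {y : Model n} (hy : y ∈ antiDom k j) :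
    ContDiffAt ℝ ∞ (antiMap k j) y := by
  have h : ContDiff ℝ ∞ fun y : Model n => antiCoeff (affine k y) :=
    antiCoeff.contDiff.comp ((contDiff_affine k).restrict_scalars ℝ)
  rw [contDiff_pi] at h
  refine contDiffAt_pi.mpr fun i => ?_
  simp only [antiMap, div_eq_mul_inv]
  exact (h (j.succAbove i)).contDiffAt.mul ((h j).contDiffAt.inv hy.2)

/-- The conjugation is antiholomorphic, as it is a quotient of antilinear functions. -/
lemma differentiableAt_star_antiMap {k j : Fin (2 * n + 1 + 1)} {y : Model n}
    (hy : y ∈ antiDom k j) : DifferentiableAt ℂ (fun y' => star (antiMap k j y')) y := by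
  have h : ∀ i, DifferentiableAt ℂ (fun y : Model n => affine k y i) y := fun i =>
    (contDiff_pi.mp (contDiff_affine (m := 1) k) i).differentiable (by simp) y
  refine differentiableAt_pi.mpr fun i => ?_
  have e : (fun y' => star (antiMap k j y') i) = fun y' =>
      (coeffSign n (j.succAbove i) * affine k y' (j.succAbove i).rev) /
        (coeffSign n j * affine k y' j.rev) := by
    funext y'
    simp only [Pi.star_apply, antiMap, antiCoeff_apply, RCLike.star_def, map_div₀, map_mul,
      star_coeffSign, Complex.conj_conj]
  rw [e]
  have hne : coeffSign n j * affine k y j.rev ≠ 0 := fun h0 => hy.2 (by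
    rw [antiCoeff_apply]
    simpa using h0)
  simp only [div_eq_mul_inv]
  exact ((h (j.succAbove i).rev).const_mul _).fun_mul (((h j.rev).const_mul _).fun_inv hne)

/-- The antipodal map preserves the area, since it extends to `y ↦ -y`, which preserves the volume.
-/
lemma measurePreserving_neg :
    MeasurePreserving (fun x : S2 => -x) ((volume : Measure E3).toSphere)
      ((volume : Measure E3).toSphere) := by
  refine ⟨continuous_neg.measurable, ?_⟩
  ext s hs
  rw [Measure.map_apply continuous_neg.measurable hs, Measure.toSphere_apply' _ hs,
    Measure.toSphere_apply' _ (continuous_neg.measurable hs)]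
  congr 1
  rw [← Measure.measure_neg]
  congr 1
  ext y
  simp only [Set.mem_neg, Set.mem_smul, mem_image, mem_preimage]
  constructor
  · rintro ⟨r, hr, _, ⟨x, hx, rfl⟩, h⟩
    exact ⟨r, hr, _, ⟨-x, hx, rfl⟩, by rw [coe_neg_sphere, smul_neg, h, neg_neg]⟩
  · rintro ⟨r, hr, _, ⟨x, hx, rfl⟩, rfl⟩
    exact ⟨r, hr, _, ⟨-x, by simpa using hx, rfl⟩, by rw [coe_neg_sphere, smul_neg]⟩

/-- The differential of the conjugation acts on vector fields along maps by `X ↦ -X ∘ p`. -/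
lemma variation_antiMap (hn : Odd n) {k j : Fin (2 * n + 1 + 1)} {y : Model n}
    (hy : y ∈ antiDom k j) (u : Model n) (x : S2) :
    variation j (antiMap k j y) (fderiv ℝ (antiMap k j) y u) x = -variation k y u (-x) := by
  have h1 := ((hasFDerivAt_param (antiMap_mem hn hy).1 x).comp y
    ((contDiffAt_antiMap hy).differentiableAt (by simp)).hasFDerivAt)
  have h2 := (hasFDerivAt_param hy.1 (-x)).neg
  have e : (fun y' => -((param k y' (-x) : S2) : E3)) =ᶠ[𝓝 y]
      (fun b' => ((param j b' x : S2) : E3)) ∘ antiMap k j := by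
    filter_upwards [(isOpen_antiDom k j).mem_nhds hy] with y' hy'
    simp only [Function.comp_apply]
    rw [(antiMap_mem hn hy').2]
    simp [conjAntipodal]
  have h3 := (h2.congr_of_eventuallyEq e.symm).unique h1
  have h4 := congrArg (fun L => L u) h3
  rw [variation_eq (antiMap_mem hn hy).1, variation_eq hy.1]
  exact h4.symm

lemma gam_antiMap (hn : Odd n) {k j : Fin (2 * n + 1 + 1)} {y : Model n}
    (hy : y ∈ antiDom k j) (u v : Model n) :
    gam j (antiMap k j y) (fderiv ℝ (antiMap k j) y u) (fderiv ℝ (antiMap k j) y v) =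
      gam k y u v := by
  simp only [gam, variation_antiMap hn hy, inner_neg_neg]
  exact measurePreserving_neg.integral_comp (Homeomorph.neg S2).measurableEmbedding
    (fun x => inner ℝ (variation k y u x) (variation k y v x))

lemma isAntiholomorphicIsometry (hn : Odd n) : IsAntiholomorphicIsometry n conjAntipodal := by
  refine ⟨bijOn_conjAntipodal hn, fun k j b hb b' hb' h => ?_⟩
  obtain ⟨hbd, hbe⟩ := mem_antiDom hn hb hb' h
  refine ⟨antiMap k j, hbe, ?_⟩
  filter_upwards [(isOpen_antiDom k j).mem_nhds hbd] with y hy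
  exact ⟨(antiMap_mem hn hy).1, (antiMap_mem hn hy).2, differentiableAt_star_antiMap hy,
    gam_antiMap hn hy⟩

/-! ### Fixed points of smooth involutions -/

/-- A smooth involution `F` of an open subset `V` of a normed space. -/
structure LocalInvolution {E : Type} [NormedAddCommGroup E] [NormedSpace ℝ E] (V : Set E)
    (F : E → E) : Prop where
  isOpen : IsOpen V
  smooth : ∀ y ∈ V, ContDiffAt ℝ ∞ F y
  mapsTo : MapsTo F V V
  invol : ∀ y ∈ V, F (F y) = y

namespace LocalInvolution

variable {E : Type} [NormedAddCommGroup E] [NormedSpace ℝ E] {V : Set E} {F : E → E}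

/-- The fixed-point set. -/
def fixed (V : Set E) (F : E → E) : Set E := {y | y ∈ V ∧ F y = y}

lemma hasFDerivAt (h : LocalInvolution V F) {y : E} (hy : y ∈ V) :
    HasFDerivAt F (fderiv ℝ F y) y :=
  ((h.smooth y hy).differentiableAt (by simp)).hasFDerivAt

lemma fderiv_fderiv_apply (h : LocalInvolution V F) {y : E} (hy : y ∈ V) (v : E) :
    fderiv ℝ F (F y) (fderiv ℝ F y v) = v := by
  have h1 := (h.hasFDerivAt (h.mapsTo hy)).comp y (h.hasFDerivAt hy)
  have h2 : HasFDerivAt (F ∘ F) (ContinuousLinearMap.id ℝ E) y :=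
    (hasFDerivAt_id y).congr_of_eventuallyEq (by
      filter_upwards [h.isOpen.mem_nhds hy] with z hz using h.invol z hz)
  exact congrArg (fun L => L v) (h1.unique h2)

lemma fderiv_fderiv_of_fixed (h : LocalInvolution V F) {b : E} (hb : b ∈ fixed V F) (v : E) :
    fderiv ℝ F b (fderiv ℝ F b v) = v := by
  have := h.fderiv_fderiv_apply hb.1 v
  rwa [hb.2] at this

/-- A chart which linearizes the involution `F` at its fixed point `b`: the mean of `y ↦ y` and its
conjugate under the involution and its differential. -/
def lin (F : E → E) (b y : E) : E := (2⁻¹ : ℝ) • (y + fderiv ℝ F b (F y))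

/-- In the chart `lin F b` the involution is its differential at `b`. -/
lemma lin_comp (h : LocalInvolution V F) {b : E} (hb : b ∈ fixed V F) {y : E} (hy : y ∈ V) :
    lin F b (F y) = fderiv ℝ F b (lin F b y) := by
  simp only [lin, map_smul, map_add, h.invol y hy, h.fderiv_fderiv_of_fixed hb]
  rw [add_comm]

lemma contDiffAt_lin (h : LocalInvolution V F) (b : E) {y : E} (hy : y ∈ V) :
    ContDiffAt ℝ ∞ (lin F b) y :=
  (contDiffAt_id.add ((fderiv ℝ F b).contDiff.contDiffAt.comp y (h.smooth y hy))).const_smul _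

lemma hasFDerivAt_lin (h : LocalInvolution V F) {b : E} (hb : b ∈ fixed V F) :
    HasFDerivAt (lin F b) (ContinuousLinearMap.id ℝ E) b := by
  have h1 := ((hasFDerivAt_id (𝕜 := ℝ) b).add
    ((fderiv ℝ F b).hasFDerivAt.comp b (h.hasFDerivAt hb.1))).const_smul (2⁻¹ : ℝ)
  refine h1.congr_fderiv (ContinuousLinearMap.ext fun v => ?_)
  change (2⁻¹ : ℝ) • (v + fderiv ℝ F b (fderiv ℝ F b v)) = v
  rw [h.fderiv_fderiv_of_fixed hb]
  module

lemma exists_injOn_lin [CompleteSpace E] (h : LocalInvolution V F) {b : E} (hb : b ∈ fixed V F) :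
    ∃ s ∈ 𝓝 b, InjOn (lin F b) s := by
  have h1 : HasStrictFDerivAt (lin F b) (ContinuousLinearMap.id ℝ E) b :=
    (h.contDiffAt_lin b hb.1).hasStrictFDerivAt' (h.hasFDerivAt_lin hb) (by simp)
  have h2 : HasStrictFDerivAt (lin F b) ((ContinuousLinearEquiv.refl ℝ E : E ≃L[ℝ] E) : E →L[ℝ] E)
    b := h1
  exact ⟨_, (h2.toOpenPartialHomeomorph (lin F b)).open_source.mem_nhds
    h2.mem_toOpenPartialHomeomorph_source, (h2.toOpenPartialHomeomorph (lin F b)).injOn⟩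

/-- Near a fixed point, the fixed points are the points with `lin F b y` fixed by the linear
involution `fderiv ℝ F b`. -/
lemma eventually_fixed_iff [CompleteSpace E] (h : LocalInvolution V F) {b : E}
    (hb : b ∈ fixed V F) :
    ∀ᶠ y in 𝓝 b, (F y = y ↔ fderiv ℝ F b (lin F b y) = lin F b y) := by
  obtain ⟨s, hs, hinj⟩ := h.exists_injOn_lin hb
  have hF : ContinuousAt F b := (h.smooth b hb.1).continuousAt
  have hs' : ∀ᶠ y in 𝓝 b, F y ∈ s := hF (by rw [hb.2]; exact hs)
  filter_upwards [hs, hs', h.isOpen.mem_nhds hb.1] with y hy hFy hyV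
  rw [← h.lin_comp hb hyV]
  exact ⟨fun e => by rw [e], fun e => hinj hFy hy e⟩

/-- The tangent vectors to the fixed-point set are the vectors fixed by the differential. A curve
with a given fixed velocity is the preimage of a line in the chart `lin F b`. -/
lemma tangent_fixed [CompleteSpace E] (h : LocalInvolution V F) {b : E} (hb : b ∈ fixed V F) :
    tangent (fixed V F) b = {v | fderiv ℝ F b v = v} := by
  ext v
  constructor
  · rintro ⟨c, hc, hc0, hmem, rfl⟩
    have hd : HasDerivAt c (deriv c 0) 0 := (hc.differentiableAt (by simp)).hasDerivAt
    have hb' : HasFDerivAt F (fderiv ℝ F b) (c 0) := by rw [hc0]; exact h.hasFDerivAt hb.1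
    have h1 := hb'.comp_hasDerivAt (0 : ℝ) hd
    refine h1.unique (hd.congr_of_eventuallyEq ?_)
    filter_upwards [hmem] with t ht using ht.2
  · intro hv
    have hc := h.contDiffAt_lin b hb.1
    have hd : HasFDerivAt (lin F b) ((ContinuousLinearEquiv.refl ℝ E : E ≃L[ℝ] E) : E →L[ℝ] E) b :=
      h.hasFDerivAt_lin hb
    set g := hc.localInverse hd (by simp) with hg
    have hgc : ContDiffAt ℝ ∞ g (lin F b b) := hc.to_localInverse hd (by simp)
    have hg0 : g (lin F b b) = b := hc.localInverse_apply_image hd (by simp)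
    have hright : ∀ᶠ z in 𝓝 (lin F b b), lin F b (g z) = z :=
      (hc.hasStrictFDerivAt' hd (by simp)).eventually_right_inverse
    have hline : HasDerivAt (fun t : ℝ => lin F b b + t • v) v 0 := by
      simpa using ((hasDerivAt_id (0 : ℝ)).smul_const v).const_add (lin F b b)
    have hline0 : lin F b b + (0 : ℝ) • v = lin F b b := by simp
    have hlc : ContDiff ℝ ∞ (fun t : ℝ => lin F b b + t • v) := by fun_prop
    have hct : ContDiffAt ℝ ∞ (fun t : ℝ => g (lin F b b + t • v)) 0 :=
      ContDiffAt.comp (g := g) (0 : ℝ) (by rw [hline0]; exact hgc) hlc.contDiffAt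
    have htend : Tendsto (fun t : ℝ => lin F b b + t • v) (𝓝 0) (𝓝 (lin F b b)) := by
      have := hlc.continuous.tendsto 0
      rwa [hline0] at this
    have htend' : Tendsto (fun t : ℝ => g (lin F b b + t • v)) (𝓝 0) (𝓝 b) := by
      have := hct.continuousAt.tendsto
      simp only [hline0, hg0] at this
      exact this
    have hLb : fderiv ℝ F b (lin F b b) = lin F b b := by
      rw [← h.lin_comp hb hb.1, hb.2]
    have hlg := htend.eventually hright
    refine ⟨fun t => g (lin F b b + t • v), hct, by simp only [hline0, hg0], ?_, ?_⟩
    · filter_upwards [hlg, htend'.eventually (h.eventually_fixed_iff hb),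
        htend'.eventually (h.isOpen.mem_nhds hb.1)] with t h1 h2 h3
      refine ⟨h3, h2.mpr ?_⟩
      rw [h1, map_add, map_smul, hLb, hv]
    · have hd1 : HasDerivAt (fun t : ℝ => g (lin F b b + t • v))
          (deriv (fun t : ℝ => g (lin F b b + t • v)) 0) 0 :=
        (hct.differentiableAt (by simp)).hasDerivAt
      have hd' : HasFDerivAt (lin F b) (ContinuousLinearMap.id ℝ E)
          (g (lin F b b + (0 : ℝ) • v)) := by
        rw [hline0, hg0]
        exact hd
      have h1 := hd'.comp_hasDerivAt (0 : ℝ) hd1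
      exact h1.unique (hline.congr_of_eventuallyEq hlg)

lemma mem_tangent [CompleteSpace E] (h : LocalInvolution V F) {b : E} (hb : b ∈ fixed V F) {v : E} :
    v ∈ tangent (fixed V F) b ↔ fderiv ℝ F b v = v := by
  rw [h.tangent_fixed hb]
  rfl

/-- Near a fixed point `b` the fixed-point set is the zero set of `(dF_b - 1) ∘ lin F b`, a
submersion onto the range of `dF_b - 1`. -/
lemma isSubmanifold_fixed [FiniteDimensional ℝ E] (h : LocalInvolution V F) {d : ℕ}
    (hd : ∀ b ∈ fixed V F, Module.finrank ℝ
      (LinearMap.ker ((fderiv ℝ F b : E →ₗ[ℝ] E) - LinearMap.id)) = d) :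
    IsSubmanifold d (fixed V F) := by
  intro b hb
  have := FiniteDimensional.complete ℝ E
  set T : E →ₗ[ℝ] E := (fderiv ℝ F b : E →ₗ[ℝ] E) - LinearMap.id with hT
  set R := LinearMap.range T
  have hR := Module.finBasis ℝ R
  set e : R ≃ₗ[ℝ] (Fin (Module.finrank ℝ R) → ℝ) := hR.equivFun
  set π : E →L[ℝ] (Fin (Module.finrank ℝ R) → ℝ) :=
    LinearMap.toContinuousLinearMap (e.toLinearMap ∘ₗ T.rangeRestrict) with hπ
  have hπ0 : ∀ v, π v = 0 ↔ T v = 0 := by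
    intro v
    rw [hπ, LinearMap.coe_toContinuousLinearMap', LinearMap.comp_apply, LinearEquiv.coe_coe,
      LinearEquiv.map_eq_zero_iff, ← Submodule.coe_eq_zero]
    rfl
  set G : E → (Fin (Module.finrank ℝ R) → ℝ) := fun y => π (lin F b y) with hG
  have hGs : ∀ y ∈ V, ContDiffAt ℝ ∞ G y := fun y hy =>
    π.contDiff.contDiffAt.comp y (h.contDiffAt_lin b hy)
  have hGb : fderiv ℝ G b = π := by
    have h1 := (π.hasFDerivAt.comp b (h.hasFDerivAt_lin hb)).fderiv
    simpa [hG, Function.comp_def] using h1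
  have hsurj : Function.Surjective π := by
    rw [hπ, LinearMap.coe_toContinuousLinearMap', LinearMap.coe_comp, LinearEquiv.coe_toLinearMap]
    exact e.surjective.comp (LinearMap.surjective_rangeRestrict T)
  -- surjectivity is an open condition: the composite with a right inverse at `b` stays invertible
  have hopen : ∀ᶠ y in 𝓝 b, Function.Surjective (fderiv ℝ G y) := by
    have hcont : ContinuousAt (fderiv ℝ G) b :=
      ((hGs b hb.1).fderiv_right (m := 0) (by simp)).continuousAt
    have hr : LinearMap.range (π : E →ₗ[ℝ] (Fin (Module.finrank ℝ R) → ℝ)) = ⊤ :=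
      LinearMap.range_eq_top.mpr hsurj
    obtain ⟨S, hS⟩ := LinearMap.exists_rightInverse_of_surjective _ hr
    have hcont' : ContinuousAt (fun y => (fderiv ℝ G y).comp (LinearMap.toContinuousLinearMap S))
        b := hcont.clm_comp continuousAt_const
    have hb1 : (fderiv ℝ G b).comp (LinearMap.toContinuousLinearMap S) = 1 := by
      rw [hGb]
      ext1 v
      exact congrArg (fun L => L v) hS
    have hu1 : IsUnit ((fderiv ℝ G b).comp (LinearMap.toContinuousLinearMap S)) :=
      hb1 ▸ isUnit_one
    have hunit := hcont' (Units.isOpen.mem_nhds hu1)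
    filter_upwards [hunit] with y hy
    obtain ⟨r, hr⟩ := hy.exists_right_inv
    exact fun v => ⟨S (r v), congrArg (fun L => L v) hr⟩
  have hev := ((h.eventually_fixed_iff hb).and hopen).and (h.isOpen.mem_nhds hb.1)
  obtain ⟨U, hU, hUo, hbU⟩ := eventually_nhds_iff.mp hev
  refine ⟨U, Module.finrank ℝ R, G, hUo, hbU, ?_,
    fun y hy => (hGs y (hU y hy).2).contDiffWithinAt, fun y hy => (hU y hy).1.2, ?_⟩
  · rw [← hd b hb]
    exact LinearMap.finrank_range_add_finrank_ker T
  · ext y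
    constructor
    · rintro ⟨⟨-, hfy⟩, hyU⟩
      refine ⟨hyU, (hπ0 _).mpr ?_⟩
      have := (hU y hyU).1.1.mp hfy
      simp only [hT, LinearMap.sub_apply, LinearMap.id_apply, ContinuousLinearMap.coe_coe, this,
        sub_self]
    · rintro ⟨hyU, hGy⟩
      refine ⟨⟨(hU y hyU).2, (hU y hyU).1.1.mpr ?_⟩, hyU⟩
      have := (hπ0 _).mp hGy
      simpa only [hT, LinearMap.sub_apply, LinearMap.id_apply, ContinuousLinearMap.coe_coe,
        sub_eq_zero] using this

/-- The dimension of the fixed space of a linear involution which anticommutes with a complex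
structure `J` is half the dimension of the whole space. -/
lemma two_mul_finrank_fixed [FiniteDimensional ℝ E] {L J : E →ₗ[ℝ] E} (hL : ∀ v, L (L v) = v)
    (hJ : ∀ v, J (J v) = -v) (hLJ : ∀ v, L (J v) = -J (L v)) :
    2 * Module.finrank ℝ (LinearMap.ker (L - LinearMap.id)) = Module.finrank ℝ E := by
  have hm : ∀ {v}, v ∈ LinearMap.ker (L - LinearMap.id) ↔ L v = v := by
    intro v
    rw [LinearMap.mem_ker, LinearMap.sub_apply, LinearMap.id_apply, sub_eq_zero]
  have hm' : ∀ {v}, v ∈ LinearMap.ker (L + LinearMap.id) ↔ L v = -v := by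
    intro v
    rw [LinearMap.mem_ker, LinearMap.add_apply, LinearMap.id_apply, add_eq_zero_iff_eq_neg]
  have hJi : Function.Injective J := fun v w h => by
    have := hJ v
    rw [h, hJ] at this
    exact (neg_injective this).symm
  have h1 : Module.finrank ℝ (LinearMap.ker (L - LinearMap.id)) =
      Module.finrank ℝ (LinearMap.ker (L + LinearMap.id)) := by
    apply le_antisymm
    · refine LinearMap.finrank_le_finrank_of_injective (f := J.restrict fun v hv => ?_) ?_
      · rw [hm] at hv
        rw [hm', hLJ, hv]
      · exact fun v w h => Subtype.ext (hJi (congrArg Subtype.val h))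
    · refine LinearMap.finrank_le_finrank_of_injective (f := J.restrict fun v hv => ?_) ?_
      · rw [hm'] at hv
        rw [hm, hLJ, hv, map_neg, neg_neg]
      · exact fun v w h => Subtype.ext (hJi (congrArg Subtype.val h))
  have hc : IsCompl (LinearMap.ker (L - LinearMap.id)) (LinearMap.ker (L + LinearMap.id)) := by
    constructor
    · rw [Submodule.disjoint_def]
      intro v h h'
      rw [hm] at h
      rw [hm', h] at h'
      have h2 : (2 : ℝ) • v = 0 := by
        rw [two_smul]
        nth_rewrite 2 [h']
        exact add_neg_cancel v
      exact (smul_eq_zero.mp h2).resolve_left two_ne_zero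
    · rw [codisjoint_iff, Submodule.eq_top_iff']
      intro v
      refine Submodule.mem_sup.mpr ⟨(2⁻¹ : ℝ) • (v + L v), hm.mpr ?_, (2⁻¹ : ℝ) • (v - L v),
        hm'.mpr ?_, ?_⟩
      · rw [map_smul, map_add, hL, add_comm]
      · rw [map_smul, map_sub, hL]
        module
      · module
  have h2 := Submodule.finrank_add_eq_of_isCompl hc
  omega

set_option maxSynthPendingDepth 3 in
/-- The fixed-point set of an isometric involution is totally geodesic: as the Levi-Civita
connection is natural under isometries, the covariant derivative of a tangential field in a
tangential direction is fixed by the differential of the involution. The Christoffel symbols of the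
first kind are those of the field `g` of bilinear forms. -/
lemma exists_covDeriv_mem_tangent [FiniteDimensional ℝ E] (h : LocalInvolution V F)
    {g : E → E →L[ℝ] E →L[ℝ] ℝ} {b : E} (hb : b ∈ fixed V F) (hg : DifferentiableAt ℝ g b)
    (hsymm : ∀ y ∈ V, ∀ u v, g y u v = g y v u)
    (hiso : ∀ y ∈ V, ∀ u v, g (F y) (fderiv ℝ F y u) (fderiv ℝ F y v) = g y u v)
    (hpos : ∀ u, u ≠ 0 → 0 < g b u u) {u : E} (hu : u ∈ tangent (fixed V F) b) {Y : E → E}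
    (hY : ContDiffAt ℝ ∞ Y b)
    (hYt : ∀ᶠ y in 𝓝 b, y ∈ fixed V F → Y y ∈ tangent (fixed V F) y) :
    ∃ A ∈ tangent (fixed V F) b, ∀ w, g b A w = g b (fderiv ℝ Y b u) w +
      (fderiv ℝ g b u (Y b) w + fderiv ℝ g b (Y b) u w - fderiv ℝ g b w u (Y b)) / 2 := by
  have := FiniteDimensional.complete ℝ E
  set L := fderiv ℝ F b with hL
  set B := fderiv ℝ (fderiv ℝ F) b with hB
  set D := fderiv ℝ g b with hD
  have hLu : L u = u := (h.mem_tangent hb).mp hu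
  have hLv : L (Y b) = Y b := (h.mem_tangent hb).mp (hYt.self_of_nhds hb)
  have hLL : ∀ v, L (L v) = v := h.fderiv_fderiv_of_fixed hb
  have hgb : HasFDerivAt g D b := hg.hasFDerivAt
  have hLi : ∀ v w, g b (L v) (L w) = g b v w := fun v w => by
    have := hiso b hb.1 v w
    rwa [hb.2] at this
  have hBd : HasFDerivAt (fderiv ℝ F) B b :=
    (((h.smooth b hb.1).fderiv_right (m := ∞) (by simp)).differentiableAt (by simp)).hasFDerivAt
  have hBs : ∀ v w, B v w = B w v := fderiv_fderiv_symm
    ((h.smooth b hb.1).of_le (WithTop.coe_le_coe.mpr le_top))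
  have hDs : ∀ u v w, D u v w = D u w v := by
    intro u v w
    have h1 := (hgb.clm_apply (hasFDerivAt_const v b)).clm_apply (hasFDerivAt_const w b)
    have h2 := (hgb.clm_apply (hasFDerivAt_const w b)).clm_apply (hasFDerivAt_const v b)
    have h3 := h1.unique (h2.congr_of_eventuallyEq (by
      filter_upwards [h.isOpen.mem_nhds hb.1] with y hy using hsymm y hy v w))
    simpa using congrArg (fun L => L u) h3
  -- the derivative of the isometry equation at the fixed point
  have hD1 : ∀ x v w, D (L x) (L v) (L w) + g b (B x v) (L w) + g b (L v) (B x w) = D x v w := by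
    intro x v w
    have hFb : HasFDerivAt g D (F b) := by rw [hb.2]; exact hgb
    have hgF : HasFDerivAt (fun y => g (F y)) (D ∘L L) b := hFb.comp b (h.hasFDerivAt hb.1)
    have h1 := (hgF.clm_apply
      (hBd.clm_apply (hasFDerivAt_const v b))).clm_apply (hBd.clm_apply (hasFDerivAt_const w b))
    have h2 := (hgb.clm_apply (hasFDerivAt_const v b)).clm_apply (hasFDerivAt_const w b)
    have h3 := h1.unique (h2.congr_of_eventuallyEq (by
      filter_upwards [h.isOpen.mem_nhds hb.1] with y hy using hiso y hy v w))
    have h4 := congrArg (fun L => L x) h3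
    simp [hb.2] at h4
    rw [← h4]
    ring
  -- the derivative of `F_* Y = Y` along a curve in the fixed-point set
  have hBu : B u (Y b) + L (fderiv ℝ Y b u) = fderiv ℝ Y b u := by
    obtain ⟨c, hc, hc0, hmem, hcu⟩ := hu
    have hd : HasDerivAt c u 0 := hcu ▸ (hc.differentiableAt (by simp)).hasDerivAt
    have hYd : HasFDerivAt Y (fderiv ℝ Y b) (c 0) := by
      rw [hc0]; exact (hY.differentiableAt (by simp)).hasFDerivAt
    have hBd' : HasFDerivAt (fderiv ℝ F) B (c 0) := by rw [hc0]; exact hBd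
    have h1 := hYd.comp_hasDerivAt (0 : ℝ) hd
    have h2 := (hBd'.comp_hasDerivAt (0 : ℝ) hd).clm_apply h1
    have hcc : Tendsto c (𝓝 0) (𝓝 b) := hc0 ▸ hc.continuousAt.tendsto
    have h3 := h2.unique (h1.congr_of_eventuallyEq (by
      filter_upwards [hmem, hcc.eventually hYt] with t ht hYt'
      exact (h.mem_tangent ht).mp (hYt' ht)))
    simpa [hc0] using h3
  -- existence of the covariant derivative, by nondegeneracy of the metric
  obtain ⟨A, hA⟩ : ∃ A, ∀ w, g b A w = g b (fderiv ℝ Y b u) w +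
      (D u (Y b) w + D (Y b) u w - D w u (Y b)) / 2 := by
    set T : E →ₗ[ℝ] Module.Dual ℝ E := (ContinuousLinearMap.coeLM ℝ).comp (g b : E →ₗ[ℝ] E →L[ℝ] ℝ)
    have hT : Function.Injective T := by
      rw [← LinearMap.ker_eq_bot, LinearMap.ker_eq_bot']
      intro v hv
      by_contra hv0
      exact (hpos v hv0).ne' (congrArg (fun l => l v) hv)
    have hTs : Function.Surjective T :=
      (LinearMap.injective_iff_surjective_of_finrank_eq_finrank
        (Subspace.dual_finrank_eq).symm).mp hT
    obtain ⟨A, hA⟩ := hTs ((g b (fderiv ℝ Y b u) +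
      (2⁻¹ : ℝ) • (D u (Y b) + D (Y b) u - ((D.flip u).flip (Y b))) : E →L[ℝ] ℝ) : E →ₗ[ℝ] ℝ)
    refine ⟨A, fun w => (congrArg (fun l => l w) hA).trans ?_⟩
    simp
    ring
  refine ⟨A, (h.mem_tangent hb).mpr ?_, hA⟩
  -- naturality: the equations defining `A` are invariant under `L`, so that `L A = A`
  have hsub : ∀ w, g b (L A - A) w = 0 := by
    intro w
    rw [map_sub, sub_apply, sub_eq_zero]
    have e1 : g b (L A) w = g b A (L w) := by rw [← hLi A, hLL]
    have e2 : g b (fderiv ℝ Y b u) (L w) = g b (L (fderiv ℝ Y b u)) w := by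
      rw [← hLi (fderiv ℝ Y b u), hLL]
    have e3 : L (fderiv ℝ Y b u) = fderiv ℝ Y b u - B u (Y b) :=
      eq_sub_iff_add_eq'.mpr hBu
    have e4 : g b (B u (Y b)) (L w) = -g b (B u (Y b)) w := by
      have : L (B u (Y b)) = -B u (Y b) := by
        have h5 : B u (Y b) = fderiv ℝ Y b u - L (fderiv ℝ Y b u) := by rw [e3]; abel
        rw [h5, map_sub, hLL]; abel
      rw [← hLi (B u (Y b)), hLL, this, map_neg, neg_apply]
    have d1 := hD1 u (Y b) w
    have d2 := hD1 (Y b) u w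
    have d3 := hD1 w u (Y b)
    rw [hLu, hLv] at d1 d2 d3
    rw [hBs (Y b) u, hsymm b hb.1 u] at d2
    rw [hBs w u, hsymm b hb.1 _ (Y b)] at d3
    rw [hsymm b hb.1 u] at d3
    have s1 := hsymm b hb.1 (Y b) (B u w)
    rw [hBs (Y b) w] at d2
    have s2 := hsymm b hb.1 u (B w (Y b))
    rw [e1, hA, hA, e2, e3, map_sub, sub_apply]
    linarith
  by_contra hne
  exact (hpos _ (sub_ne_zero.mpr hne)).ne' (hsub _)

end LocalInvolution

/-! ### The fixed-point set of the antipodal conjugation -/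

/-- The degree `n` maps that commute with the antipodal map. -/
def equivariant (n : ℕ) : Set (S2 → S2) := {f | f ∈ M n ∧ conjAntipodal f = f}

/-- In the `k`-th chart the conjugation is a smooth involution of the part that it maps to the
chart. -/
lemma localInvolution (hn : Odd n) (k : Fin (2 * n + 1 + 1)) :
    LocalInvolution (antiDom k k) (antiMap k k) := by
  have key : ∀ y ∈ antiDom k k, antiMap k k y ∈ antiDom k k ∧ antiMap k k (antiMap k k y) = y := by
    intro y hy
    obtain ⟨h1, h2⟩ := antiMap_mem hn hy
    refine mem_antiDom hn h1 hy.1 ?_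
    rw [h2, conjAntipodal_conjAntipodal]
  exact ⟨isOpen_antiDom k k, fun y hy => contDiffAt_antiMap hy, fun y hy => (key y hy).1,
    fun y hy => (key y hy).2⟩

/-- A chart that contains a map fixed by the conjugation contains its conjugate, so that the fixed
points in the chart are those of the local involution. -/
lemma inChart_equivariant (hn : Odd n) (k : Fin (2 * n + 1 + 1)) :
    inChart k (equivariant n) = LocalInvolution.fixed (antiDom k k) (antiMap k k) := by
  ext b
  constructor
  · rintro ⟨hb, -, h⟩
    exact mem_antiDom hn hb hb h.symm
  · rintro ⟨hb, h⟩
    refine ⟨hb.1, param_mem_M hb.1, ?_⟩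
    rw [← (antiMap_mem hn hb).2, h]

lemma fderiv_antiMap_I_smul {k j : Fin (2 * n + 1 + 1)} {y : Model n} (hy : y ∈ antiDom k j)
    (u : Model n) : fderiv ℝ (antiMap k j) y (Complex.I • u) =
      -(Complex.I • fderiv ℝ (antiMap k j) y u) := by
  have h1 := ((differentiableAt_star_antiMap hy).hasFDerivAt.restrictScalars ℝ)
  have h2 := ((starL' ℝ : Model n ≃L[ℝ] Model n) : Model n →L[ℝ] Model n).hasFDerivAt.comp y
    ((contDiffAt_antiMap hy).differentiableAt (by simp)).hasFDerivAt
  have h3 := h1.unique h2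
  have e : ∀ v, fderiv ℝ (antiMap k j) y v =
      star (fderiv ℂ (fun y' => star (antiMap k j y')) y v) := fun v => by
    have h4 := congrArg (fun L => star (L v)) h3
    exact (h4.trans (star_star _)).symm
  rw [e, e, map_smul, star_smul]
  simp

lemma finrank_model (n : ℕ) : Module.finrank ℝ (Model n) = 2 * (2 * n + 1) := by
  rw [finrank_real_of_complex]
  simp

lemma finrank_fixed (hn : Odd n) {k : Fin (2 * n + 1 + 1)} {b : Model n}
    (hb : b ∈ LocalInvolution.fixed (antiDom k k) (antiMap k k)) : Module.finrank ℝ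
      (LinearMap.ker ((fderiv ℝ (antiMap k k) b : Model n →ₗ[ℝ] Model n) - LinearMap.id)) =
        2 * n + 1 := by
  have h := LocalInvolution.two_mul_finrank_fixed
    (L := (fderiv ℝ (antiMap k k) b : Model n →ₗ[ℝ] Model n))
    (J := (LinearMap.lsmul ℂ (Model n) Complex.I).restrictScalars ℝ)
    ((localInvolution hn k).fderiv_fderiv_of_fixed hb)
    (fun v => by simp [smul_smul]) (fun v => fderiv_antiMap_I_smul hb.1 v)
  rw [finrank_model] at h
  omega

lemma isSubmanifoldOfM_equivariant (hn : Odd n) :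
    IsSubmanifoldOfM n (2 * n + 1) (equivariant n) := by
  refine ⟨fun f hf => hf.1, fun k => ?_⟩
  rw [inChart_equivariant hn]
  exact (localInvolution hn k).isSubmanifold_fixed fun b hb => finrank_fixed hn hb

/-- The conjugation by the antipodal map is isometric and antiholomorphic, so that on vectors fixed
by its differential `Ω` is equal to its own negative. -/
lemma isLagrangian_equivariant (hn : Odd n) : IsLagrangian n (equivariant n) := by
  refine ⟨⟨2 * n + 1, isSubmanifoldOfM_equivariant hn, (finrank_model n).symm⟩, ?_⟩
  intro k b hb u hu v hv
  rw [inChart_equivariant hn] at hb hu hv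
  rw [(localInvolution hn k).mem_tangent hb] at hu hv
  have h := gam_antiMap hn hb.1 (Complex.I • u) v
  rw [fderiv_antiMap_I_smul hb.1, hb.2, hu, hv, ← neg_one_smul ℝ, gam_smul_left] at h
  rw [kahlerForm]
  linarith

open Classical in
/-- The `L²` metric as a field of continuous bilinear forms on the `k`-th chart. -/
def metric (k : Fin (2 * n + 1 + 1)) (b : Model n) : Model n →L[ℝ] Model n →L[ℝ] ℝ :=
  if hb : b ∈ dom n k then
    LinearMap.toContinuousBilinearMap (LinearMap.mk₂ ℝ (gam k b) (gam_add_left hb)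
      (gam_smul_left k b)
      (fun u v v' => by rw [gam_comm, gam_add_left hb, gam_comm k b v, gam_comm k b v'])
      (fun c u v => by rw [gam_comm, gam_smul_left, gam_comm k b v, smul_eq_mul]))
  else 0

lemma metric_apply {k : Fin (2 * n + 1 + 1)} {b : Model n} (hb : b ∈ dom n k) (u v : Model n) :
    metric k b u v = gam k b u v := by
  rw [metric, dif_pos hb]
  rfl

/-- A map to bilinear forms on a finite-dimensional space is smooth if its values on all pairs of
vectors are. -/
lemma contDiffOn_metric (k : Fin (2 * n + 1 + 1)) :
    ContDiffOn ℝ ∞ (metric (n := n) k) (dom n k) := by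
  rw [contDiffOn_clm_apply]
  intro u
  rw [contDiffOn_clm_apply]
  intro v
  exact (contDiffOn_gam k u v).congr fun b hb => metric_apply hb u v

lemma differentiableAt_metric {k : Fin (2 * n + 1 + 1)} {b : Model n} (hb : b ∈ dom n k) :
    DifferentiableAt ℝ (metric k) b :=
  ((contDiffOn_metric k).contDiffAt ((isOpen_dom k).mem_nhds hb)).differentiableAt (by simp)

set_option maxSynthPendingDepth 3 in
lemma fderiv_metric {k : Fin (2 * n + 1 + 1)} {b : Model n} (hb : b ∈ dom n k) (u v w : Model n) :
    fderiv ℝ (metric k) b u v w = dGam k b u v w := by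
  have h1 := ((differentiableAt_metric hb).hasFDerivAt.clm_apply (hasFDerivAt_const v b)).clm_apply
    (hasFDerivAt_const w b)
  have e : (fun y => gam k y v w) =ᶠ[𝓝 b] fun y => metric k y v w := by
    filter_upwards [(isOpen_dom k).mem_nhds hb] with y hy using (metric_apply hy v w).symm
  rw [dGam, e.fderiv_eq, h1.fderiv]
  simp

lemma isTotallyGeodesic_equivariant (hn : Odd n) : IsTotallyGeodesic n (equivariant n) := by
  intro k b hb u hu Y hY hYt
  rw [inChart_equivariant hn] at hb hu hYt ⊢
  have hinv := localInvolution hn k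
  obtain ⟨A, hA, h⟩ := hinv.exists_covDeriv_mem_tangent hb (differentiableAt_metric hb.1.1)
    (fun y hy u v => by rw [metric_apply hy.1, metric_apply hy.1, gam_comm])
    (fun y hy u v => by
      rw [metric_apply hy.1, metric_apply (hinv.mapsTo hy).1, gam_antiMap hn hy])
    (fun u hu => by rw [metric_apply hb.1.1]; exact gam_pos hb.1.1 hu) hu hY hYt
  refine ⟨A, hA, fun w => ?_⟩
  have h1 := h w
  rw [metric_apply hb.1.1, metric_apply hb.1.1, fderiv_metric hb.1.1, fderiv_metric hb.1.1,
    fderiv_metric hb.1.1] at h1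
  exact h1

/-! ### Lifts of maps of the projective plane -/

/-- The fibres of the covering projection are pairs of antipodal points. -/
lemma proj_eq_iff {x y : S2} : proj x = proj y ↔ x = y ∨ x = -y := by
  rw [proj, proj, Projectivization.mk_eq_mk_iff']
  constructor
  · rintro ⟨c, hc⟩
    have h1 : ‖c • (y : E3)‖ = 1 := by rw [hc]; exact norm_eq_of_mem_sphere x
    rw [norm_smul, norm_eq_of_mem_sphere y, mul_one, Real.norm_eq_abs] at h1
    rcases eq_or_eq_neg_of_abs_eq h1 with rfl | rfl
    · left
      exact Subtype.ext (by rw [← hc, one_smul])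
    · right
      exact Subtype.ext (by rw [← hc, neg_one_smul, coe_neg_sphere])
  · rintro (rfl | rfl)
    · exact ⟨1, one_smul _ _⟩
    · exact ⟨-1, by rw [neg_one_smul, coe_neg_sphere]⟩

lemma proj_neg (x : S2) : proj (-x) = proj x := proj_eq_iff.mpr (Or.inr rfl)

lemma proj_surjective : Function.Surjective proj := by
  intro l
  induction l using Projectivization.ind with
  | h v hv =>
    refine ⟨toS2 v hv, ?_⟩
    rw [proj, Projectivization.mk_eq_mk_iff']
    exact ⟨‖v‖⁻¹, rfl⟩

lemma ne_neg_self (x : S2) : x ≠ -x := by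
  intro h
  have h1 : (x : E3) = -(x : E3) := by
    rw [← coe_neg_sphere]
    exact congrArg Subtype.val h
  have h2 := congrArg (inner ℝ (x : E3)) h1
  rw [inner_neg_right, S2.inner_self] at h2
  norm_num at h2

/-- Two continuous lifts of the same map agree up to a global sign. -/
lemma eq_or_eq_neg_of_proj_eq {f f' : S2 → S2} (hf : Continuous f) (hf' : Continuous f')
    (h : ∀ x, proj (f x) = proj (f' x)) : (∀ x, f x = f' x) ∨ (∀ x, f x = -f' x) := by
  have hpc : PreconnectedSpace S2 := by
    refine isPreconnected_iff_preconnectedSpace.mp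
      (isPreconnected_sphere ?_ (0 : E3) 1)
    rw [← Module.finrank_eq_rank]
    simp
  have hcl : IsClopen {x | f x = f' x} := by
    refine ⟨isClosed_eq hf hf', ?_⟩
    have : {x | f x = f' x} = {x | f x = -f' x}ᶜ := by
      ext x
      simp only [mem_ofPred_eq, mem_compl_iff]
      constructor
      · intro e e'
        exact ne_neg_self (f' x) (e.symm.trans e')
      · intro hne
        exact (proj_eq_iff.mp (h x)).resolve_right hne
    rw [this]
    exact (isClosed_eq hf hf'.neg).isOpen_compl
  rcases isClopen_iff.mp hcl with h0 | h1
  · right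
    intro x
    refine (proj_eq_iff.mp (h x)).resolve_left fun e => ?_
    have : x ∈ {x | f x = f' x} := e
    rw [h0] at this
    exact this
  · left
    intro x
    have : x ∈ {x | f x = f' x} := by rw [h1]; trivial
    exact this

lemma ext_neg (f : S2 → S2) : ext (fun x => -f x) = -ext f := by
  funext y
  by_cases hy : y ≠ 0
  · simp only [ext, Pi.neg_apply, dif_pos hy, coe_neg_sphere]
  · simp only [ext, Pi.neg_apply, dif_neg hy, neg_zero]

lemma SmoothAt.neg {f : S2 → S2} {x : S2} (h : SmoothAt f x) : SmoothAt (fun x => -f x) x := by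
  rw [SmoothAt, ext_neg]
  exact ContDiffAt.neg h

lemma HarmonicAt.neg {f : S2 → S2} {x : S2} (h : HarmonicAt f x) :
    HarmonicAt (fun x => -f x) x := by
  refine ⟨h.1.neg, ?_⟩
  have e1 : normSqDeriv (fun x => -f x) x = normSqDeriv f x := by
    simp [normSqDeriv, ext_neg, fderiv_neg]
  have e2 : Laplacian.laplacian (ext fun x => -f x) (x : E3) =
      -Laplacian.laplacian (ext f) (x : E3) := by
    rw [ext_neg, ← neg_one_smul ℝ, InnerProductSpace.laplacian_smul _ h.1.contDiffAt_two,
      neg_one_smul]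
  rw [e1, e2, coe_neg_sphere, smul_neg, ← neg_add, h.2, neg_zero]

/-- The antipodal map reverses the orientation of the target. -/
lemma jac_neg {f : S2 → S2} (x : S2) : jac (fun x => -f x) x = -jac f x := by
  have e : (fderiv ℝ (ext fun x => -f x) (x : E3) +
      (innerSL ℝ (x : E3)).smulRight (((-f x : S2)) : E3) : E3 →L[ℝ] E3) =
      (-1 : ℝ) • (fderiv ℝ (ext f) (x : E3) +
        (innerSL ℝ (x : E3)).smulRight ((f x : S2) : E3)) := by
    ext1 v
    simp [ext_neg, fderiv_neg, add_comm]
  rw [jac, e, ContinuousLinearMap.toLinearMap_smul, LinearMap.det_smul, jac]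
  simp
  norm_num

/-- Composition with the antipodal map changes the sign of the degree. -/
lemma HasDegree.neg {f : S2 → S2} {d : ℤ} (h : HasDegree f d) :
    HasDegree (fun x => -f x) (-d) := by
  refine ⟨fun x => (h.1 x).neg, fun y hy => ?_⟩
  have hreg : ∀ x, f x = -y → jac f x ≠ 0 := fun x hx => by
    have := hy x (neg_eq_iff_eq_neg.mpr hx)
    rwa [jac_neg, neg_ne_zero] at this
  rw [← h.2 (-y) hreg, ← finsum_neg_distrib]
  have hs : {x | -f x = y} = {x | f x = -y} := by
    ext x
    exact neg_eq_iff_eq_neg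
  rw [hs]
  refine finsum_congr fun x => ?_
  rw [← finsum_neg_distrib]
  refine finsum_congr fun _ => ?_
  rw [jac_neg, Left.sign_neg, SignType.coe_neg]

/-- As `n` is not zero, at most one of the two lifts `f` and `-f` has degree `n`. -/
lemma neg_notMem_M (hn : n ≠ 0) {f : S2 → S2} (hf : f ∈ M n) : (fun x => -f x) ∉ M n := by
  intro h
  have := h.2.unique hf.2.neg
  omega

/-- The extension of a map near `x` depends only on the map near `x`, so that harmonicity is local.
-/
lemma ext_eventuallyEq {f f' : S2 → S2} {x : S2} (h : f =ᶠ[𝓝 x] f') :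
    ext f =ᶠ[𝓝 (x : E3)] ext f' := by
  have hc : Tendsto (fun y : E3 => ‖y‖⁻¹ • y) (𝓝 (x : E3)) (𝓝 (x : E3)) := by
    have : ContinuousAt (fun y : E3 => ‖y‖⁻¹ • y) (x : E3) :=
      (continuousAt_id.norm.inv₀ (norm_ne_zero_iff.mpr (S2.ne_zero x))).smul continuousAt_id
    have h2 := this.tendsto
    rwa [norm_eq_of_mem_sphere x, inv_one, one_smul] at h2
  have h1 : ∀ᶠ z in 𝓝 (x : E3), ∀ hz : z ∈ Metric.sphere (0 : E3) 1, f ⟨z, hz⟩ = f' ⟨z, hz⟩ := by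
    rw [nhds_subtype_eq_comap] at h
    obtain ⟨t, ht, hsub⟩ := h
    filter_upwards [ht] with z hz hzS
    exact hsub (show (⟨z, hzS⟩ : S2) ∈ Subtype.val ⁻¹' t from hz)
  filter_upwards [hc.eventually h1, isOpen_ne.mem_nhds (S2.ne_zero x)] with y hy hy0
  have hy0' : y ≠ 0 := hy0
  simp only [ext, dif_pos hy0']
  rw [hy]

lemma HarmonicAt.congr {f f' : S2 → S2} {x : S2} (h : HarmonicAt f x) (he : f =ᶠ[𝓝 x] f') :
    HarmonicAt f' x := by
  have h1 := ext_eventuallyEq he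
  refine ⟨ContDiffAt.congr_of_eventuallyEq h.1 h1.symm, ?_⟩
  rw [← InnerProductSpace.laplacian_congr_nhds h1 |>.self_of_nhds, normSqDeriv, ← h1.fderiv_eq,
    ← he.self_of_nhds]
  exact h.2

lemma SmoothAt.continuousAt {f : S2 → S2} {x : S2} (h : SmoothAt f x) : ContinuousAt f x := by
  have : ContinuousAt (fun x : S2 => ext f (x : E3)) x :=
    ContinuousAt.comp (g := ext f) (ContDiffAt.continuousAt h) continuous_subtype_val.continuousAt
  simp only [ext_coe] at this
  exact Topology.IsInducing.subtypeVal.continuousAt_iff.mpr this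

/-- A continuous lift of a harmonic map of the projective plane is harmonic: near every point it
agrees up to sign with a local harmonic representative. -/
lemma isHarmonic_of_covers {φ : RP2 → RP2} (hφ : IsHarmonicRP φ) {f : S2 → S2}
    (hf : Continuous f) (hc : Covers f φ) : IsHarmonic f := by
  intro x
  obtain ⟨g, hg⟩ := hφ x
  have hgx := hg.self_of_nhds
  have hgc : ContinuousAt g x := hgx.2.1.continuousAt
  have halt : ∀ᶠ y in 𝓝 x, g y = f y ∨ g y = -f y := by
    filter_upwards [hg] with y hy
    exact proj_eq_iff.mp (hy.1.trans (hc y).symm)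
  rcases halt.self_of_nhds with h | h
  · have hne : ∀ᶠ y in 𝓝 x, g y ≠ -f y :=
      (hgc.ne_iff_eventually_ne hf.neg.continuousAt).mp (by
        rw [h]; exact ne_neg_self _)
    refine hgx.2.congr ?_
    filter_upwards [halt, hne] with y h1 h2 using h1.resolve_right h2
  · have hne : ∀ᶠ y in 𝓝 x, g y ≠ f y :=
      (hgc.ne_iff_eventually_ne hf.continuousAt).mp (by
        rw [h]; exact (ne_neg_self _).symm)
    refine hgx.2.neg.congr ?_
    filter_upwards [halt, hne] with y h1 h2
    rw [h1.resolve_left h2, neg_neg]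

lemma Covers.neg {f : S2 → S2} {φ : RP2 → RP2} (h : Covers f φ) : Covers (fun x => -f x) φ :=
  fun x => (proj_neg _).trans (h x)

lemma continuous_of_mem_M {f : S2 → S2} (hf : f ∈ M n) : Continuous f :=
  continuous_of_smoothAt fun x => (hf.1 x).1

/-- A lift of absolute degree `n` has degree `n` or `-n`, and exactly one of its two signs gives
`n`. -/
lemma existsUnique_lift (hn : n ≠ 0) {φ : RP2 → RP2} (hφ : φ ∈ MTilde n) :
    ∃! f, f ∈ M n ∧ Covers f φ := by
  obtain ⟨hh, f, hf, hc, -, hd⟩ := hφ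
  have hfh := isHarmonic_of_covers hh hf hc
  have hex : ∃ f, f ∈ M n ∧ Covers f φ := by
    rcases hd with hd | hd
    · exact ⟨f, ⟨hfh, hd⟩, hc⟩
    · refine ⟨fun x => -f x, ⟨fun x => (hfh x).neg, ?_⟩, hc.neg⟩
      simpa using hd.neg
  obtain ⟨f, hf⟩ := hex
  refine ⟨f, hf, fun f' hf' => ?_⟩
  rcases eq_or_eq_neg_of_proj_eq (continuous_of_mem_M hf'.1) (continuous_of_mem_M hf.1)
    (fun x => (hf'.2 x).trans (hf.2 x).symm) with h | h
  · exact funext h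
  · have e : f' = fun x => -f x := funext h
    exact absurd (e ▸ hf'.1) (neg_notMem_M hn hf.1)

lemma covers_unique {f : S2 → S2} {φ φ' : RP2 → RP2} (h : Covers f φ) (h' : Covers f φ') :
    φ = φ' := by
  funext l
  obtain ⟨x, rfl⟩ := proj_surjective l
  rw [← h x, h' x]

/-- A lift which commutes with the antipodal map exists by the definition of absolute degree, and
the only other lift is its negative. Conversely, an equivariant map descends to the projective
plane. -/
lemma MTildeLift_eq (n : ℕ) : MTildeLift n = equivariant n := by
  ext f
  constructor
  · rintro ⟨hf, φ, ⟨-, f₀, hf₀, hc₀, heq, -⟩, hc⟩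
    refine ⟨hf, ?_⟩
    funext x
    rw [conjAntipodal]
    rcases eq_or_eq_neg_of_proj_eq (continuous_of_mem_M hf) hf₀
      (fun x => (hc x).trans (hc₀ x).symm) with h | h
    · rw [h, h, heq, neg_neg]
    · rw [h, h, heq, neg_neg]
  · rintro ⟨hf, he⟩
    have hodd : ∀ x, f (-x) = -f x := fun x => by
      have := congrFun he x
      rw [conjAntipodal] at this
      rw [← this, neg_neg]
    choose s hs using proj_surjective
    have hc : Covers f (fun l => proj (f (s l))) := by
      intro x
      rcases proj_eq_iff.mp (hs (proj x)) with h | h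
      · simp only [h]
      · simp only [h, hodd, proj_neg]
    refine ⟨hf, _, ⟨fun x => ⟨f, ?_⟩, f, continuous_of_mem_M hf, hc, hodd, Or.inl hf.2⟩, hc⟩
    exact Eventually.of_forall fun y => ⟨hc y, hf.1 y⟩

/-- The map `z ↦ zⁿ` commutes with the antipodal map when `n` is odd. -/
lemma equivariant_nonempty (hn : Odd n) : (equivariant n).Nonempty := by
  set a : Coeff n := fun i => if (i : ℕ) = n ∨ (i : ℕ) = n + 1 then 1 else 0 with ha
  have hnum : ∀ z w, num a z w = z ^ n := by
    intro z w
    rw [num, Finset.sum_eq_single (Fin.last n)]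
    · simp [ha]
    · intro i _ hi
      have h1 : (i : ℕ) ≠ n := fun h => hi (Fin.ext h)
      have h2 : (i : ℕ) ≠ n + 1 := by omega
      simp [ha, h1, h2]
    · simp
  have hden : ∀ z w, den a z w = w ^ n := by
    intro z w
    rw [den, Finset.sum_eq_single 0]
    · simp [ha]
    · intro i _ hi
      have h1 : n + 1 + (i : ℕ) ≠ n := by omega
      have h2 : (i : ℕ) ≠ 0 := fun h => hi (Fin.ext h)
      simp [ha, h1, h2]
    · simp
  have hrat : IsRat a := isRat_of_ne_zero fun z w hzw h => by
    rw [hnum, hden, pow_eq_zero_iff hn.pos.ne', pow_eq_zero_iff hn.pos.ne'] at h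
    exact hzw h
  refine ⟨ratMap a, ratMap_mem_M hrat, ?_⟩
  rw [conjAntipodal_ratMap hn hrat]
  funext x
  rw [ratMap, ratMap, num_antiCoeff hn, den_antiCoeff hn]
  simp only [hnum, hden, hn.neg_pow, map_neg, map_pow, Complex.conj_conj]
  rw [← neg_one_mul, ← neg_one_mul (_ ^ n), invStereo_smul (neg_ne_zero.mpr one_ne_zero)]

end HarmonicL2

end

theorem mainTheorem2 (n : ℕ) (hn : Odd n) :
    HarmonicL2.IsOpenInProjectiveSpace n ∧
    HarmonicL2.IsKahler n ∧
    HarmonicL2.IsAntiholomorphicIsometry n HarmonicL2.conjAntipodal ∧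
    (∀ φ ∈ HarmonicL2.MTilde n, ∃! f, f ∈ HarmonicL2.M n ∧ HarmonicL2.Covers f φ) ∧
    (∀ f ∈ HarmonicL2.MTildeLift n, ∃! φ, φ ∈ HarmonicL2.MTilde n ∧ HarmonicL2.Covers f φ) ∧
    HarmonicL2.MTildeLift n =
      {f | f ∈ HarmonicL2.M n ∧ HarmonicL2.conjAntipodal f = f} ∧
    (HarmonicL2.MTildeLift n).Nonempty ∧
    HarmonicL2.IsSubmanifoldOfM n (2 * n + 1) (HarmonicL2.MTildeLift n) ∧
    HarmonicL2.IsTotallyGeodesic n (HarmonicL2.MTildeLift n) ∧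
    HarmonicL2.IsLagrangian n (HarmonicL2.MTildeLift n) := by
  have hn0 : n ≠ 0 := hn.pos.ne'
  refine ⟨HarmonicL2.isOpenInProjectiveSpace hn0, HarmonicL2.isKahler n,
    HarmonicL2.isAntiholomorphicIsometry hn, fun φ hφ => HarmonicL2.existsUnique_lift hn0 hφ,
    fun f hf => ?_, HarmonicL2.MTildeLift_eq n, ?_⟩
  · obtain ⟨-, φ, hφ, hc⟩ := hf
    exact ⟨φ, ⟨hφ, hc⟩, fun φ' h => HarmonicL2.covers_unique h.2 hc⟩
  · rw [HarmonicL2.MTildeLift_eq]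
    exact ⟨HarmonicL2.equivariant_nonempty hn, HarmonicL2.isSubmanifoldOfM_equivariant hn,
      HarmonicL2.isTotallyGeodesic_equivariant hn, HarmonicL2.isLagrangian_equivariant hn⟩
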